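/- Let $\Omega\subset\mathbf R^2$ be a bounded Lipschitz domain, i.e. a nonempty, bounded, connected open set which near every boundary point is, in suitable Cartesian coordinates, the region strictly above the graph of a Lipschitz function. Let $\boldsymbol\nu$ be the outward unit normal along $\partial\Omega$ (it exists at almost every boundary point), let $\mathrm ds$ be arc length on $\partial\Omega$, and let $$\mathcal C\mathbf u=\begin{pmatrix}-\partial_x u_1+\partial_y u_2\\ \partial_y u_1+\partial_x u_2\end{pmatrix}$$ be the Cauchy–Riemann operator. Let $\mathbf g\in[C(\partial\Omega)]^2$, and suppose that $\mathbf u\in[C^2(\Omega)]^2\cap[C^1(\overline\Omega)]^2$ (that is, $\mathbf u\in [C^2(\Omega)]^2$, and $\mathbf u$ and $\partial\mathbf u$ extend continuously to $\overline\Omega$) solves the Cauchy–Riemann Neumann problem $$\mathcal C\mathbf u=0\ \text{ in }\Omega,\qquad \partial\mathbf u\,\boldsymbol\nu=\mathbf g\ \text{ on }\partial\Omega,$$ where boundary conditions are imposed at all points of $\partial\Omega$ at which $\boldsymbol\nu$ exists. Let $[\mathring H^1(\Omega)]^2$ be the space of all $\mathbf v\in[H^1(\Omega)]^2$ with $\int_\Omega\mathbf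 v\,\mathrm dx=0$. Then there is a constant vector $\mathbf c\in\mathbf R^2$ such that, for every $\alpha>0$, the field $\mathbf u-\mathbf c$ is the unique (up to equality almost everywhere) minimiser over $\mathbf v\in[\mathring H^1(\Omega)]^2$ of $$\frac12\Big(\|\mathcal C\mathbf v\|_{[L^2(\Omega)]^2}^2+\alpha\,\|\partial\mathbf v\|_{[L^2(\Omega)]^{2\times2}}^2\Big)-\alpha\int_{\partial\Omega}\mathbf g\cdot\mathbf v\,\mathrm ds ,$$ where derivatives of $\mathbf v$ are weak derivatives, $\|\partial\mathbf v\|$ is taken with the Frobenius norm of matrices, and the boundary values of $\mathbf v$ are traces. Moreover, $\mathbf u$ solves the Neumann problem $$\Delta\mathbf u=0\ \text{ in }\Omega,\qquad \partial\mathbf u\,\boldsymbol\nu=\mathbf g\ \text{ on }\partial\Omega .$$ -/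

import Mathlib

open MeasureTheory Filter Topology Set
open scoped ContDiff ENNReal NNReal

noncomputable section

namespace CRNeumann

/-- The Euclidean plane. -/
abbrev Plane : Type := EuclideanSpace ℝ (Fin 2)

/-! ### Domains -/

/-- Bounded Lipschitz domain: a bounded, nonempty, connected open set which near each of its boundary
points is, in suitable Cartesian coordinates, the strict epigraph of a Lipschitz function. -/
structure IsLipschitzDomain (Ω : Set Plane) : Prop where
  isOpen : IsOpen Ω
  isConnected : IsConnected Ω
  isBounded : Bornology.IsBounded Ω
  graph : ∀ x ∈ frontier Ω, ∃ (e : Plane ≃ₗᵢ[ℝ] Plane) (K : ℝ≥0) (γ : ℝ → ℝ),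
    LipschitzWith K γ ∧ ∀ᶠ y in 𝓝 x, (y ∈ Ω ↔ γ (e y 0) < e y 1)

/-- Arc length on the boundary of `Ω`. -/
def arcLength (Ω : Set Plane) : Measure Plane :=
  (Measure.hausdorffMeasure 1).restrict (frontier Ω)

/-- `ν` is the outward unit normal of `Ω` at `x`: the half plane `{y | ⟪y - x, ν⟫ < 0}` is tangent to
`Ω` at `x`. There is at most one such `ν`; on the boundary of a Lipschitz domain it exists exactly at
the points where the local graph function is differentiable, hence almost everywhere, and if the
boundary is `C¹` it exists everywhere. -/
def IsOuterNormal (Ω : Set Plane) (x ν : Plane) : Prop :=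
  ‖ν‖ = 1 ∧ ∀ ε > 0, ∀ᶠ y in 𝓝 x,
    (ε * ‖y - x‖ < inner ℝ (y - x) ν → y ∉ Ω) ∧
    (inner ℝ (y - x) ν < -(ε * ‖y - x‖) → y ∈ Ω)

/-! ### Classical derivatives -/

/-- The classical partial derivative in the direction of the `j`-th coordinate. -/
def pderiv (j : Fin 2) (f : Plane → ℝ) (x : Plane) : ℝ :=
  fderiv ℝ f x (EuclideanSpace.single j 1)

/-- The class `C¹(Ω̄)`: `f` is continuous on `Ω̄`, continuously differentiable in `Ω`, and its
derivative extends continuously to `Ω̄`. -/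
structure IsC1Closure {F : Type*} [NormedAddCommGroup F] [NormedSpace ℝ F]
    (Ω : Set Plane) (f : Plane → F) : Prop where
  continuousOn : ContinuousOn f (closure Ω)
  contDiffOn : ContDiffOn ℝ 1 f Ω
  extends_fderiv : ∀ x ∈ frontier Ω, ∃ L, Tendsto (fderiv ℝ f) (𝓝[Ω] x) (𝓝 L)

/-- The derivative `∂u` of a field of class `C¹(Ω̄)` as a function on `Ω̄`, obtained by continuous
extension from `Ω`. -/
def closureFDeriv (Ω : Set Plane) (u : Plane → Plane) : Plane → Plane →L[ℝ] Plane :=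
  extendFrom Ω (fderiv ℝ u)

/-- The Cauchy-Riemann operator `(-∂₀u₀ + ∂₁u₁, ∂₁u₀ + ∂₀u₁)` on differentiable fields. -/
def crOp (u : Plane → Plane) (x : Plane) : Plane :=
  !₂[-pderiv 0 (fun y => u y 0) x + pderiv 1 (fun y => u y 1) x,
    pderiv 1 (fun y => u y 0) x + pderiv 0 (fun y => u y 1) x]

/-- The Neumann boundary condition `∂u ν = g` on `∂Ω`, at the boundary points that have a normal. -/
def NeumannCondition (Ω : Set Plane) (g u : Plane → Plane) : Prop :=
  ∀ x ∈ frontier Ω, ∀ ν, IsOuterNormal Ω x ν → closureFDeriv Ω u x ν = g x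

/-- `u` solves the Cauchy-Riemann Neumann problem on `Ω` with data `g`. -/
structure IsCRNeumannSolution (Ω : Set Plane) (g u : Plane → Plane) : Prop where
  isC1Closure : IsC1Closure Ω u
  crOp_eq_zero : ∀ x ∈ Ω, crOp u x = 0
  neumann : NeumannCondition Ω g u

/-! ### The Sobolev space `H¹(Ω)` and the trace operator -/

/-- `h` is the weak partial derivative `∂ⱼ f` in `Ω`. -/
def HasWeakPDeriv (Ω : Set Plane) (j : Fin 2) (f h : Plane → ℝ) : Prop :=
  ∀ φ : Plane → ℝ, ContDiff ℝ ∞ φ → HasCompactSupport φ → tsupport φ ⊆ Ω →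
    ∫ x in Ω, f x * pderiv j φ x = -∫ x in Ω, h x * φ x

/-- `f` (a representative) belongs to `H¹(Ω)`. -/
def MemH1 (Ω : Set Plane) (f : Plane → ℝ) : Prop :=
  MemLp f 2 (volume.restrict Ω) ∧
    ∀ j, ∃ h, MemLp h 2 (volume.restrict Ω) ∧ HasWeakPDeriv Ω j f h

open Classical in
/-- The weak partial derivative `∂ⱼ f ∈ L²(Ω)` (unique almost everywhere in `Ω`) if there is one,
and `0` otherwise. -/
def weakPDeriv (Ω : Set Plane) (j : Fin 2) (f : Plane → ℝ) : Plane → ℝ :=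
  if H : ∃ h, MemLp h 2 (volume.restrict Ω) ∧ HasWeakPDeriv Ω j f h then H.choose else 0

/-- `t ∈ L²(∂Ω)` is the trace of `f ∈ H¹(Ω)`: some sequence in `C¹(Ω̄)` converges to `f` in `H¹(Ω)`
while its boundary values converge to `t` in `L²(∂Ω)`. -/
def IsTrace (Ω : Set Plane) (f t : Plane → ℝ) : Prop :=
  MemLp t 2 (arcLength Ω) ∧ ∃ φ : ℕ → Plane → ℝ,
    (∀ n, IsC1Closure Ω (φ n)) ∧
    Tendsto (fun n => eLpNorm (φ n - f) 2 (volume.restrict Ω)) atTop (𝓝 0) ∧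
    (∀ j, Tendsto (fun n => eLpNorm (pderiv j (φ n) - weakPDeriv Ω j f) 2 (volume.restrict Ω))
      atTop (𝓝 0)) ∧
    Tendsto (fun n => eLpNorm (φ n - t) 2 (arcLength Ω)) atTop (𝓝 0)

open Classical in
/-- The trace of `f` on `∂Ω`. On a bounded Lipschitz domain every `f ∈ H¹(Ω)` has a trace, and it is
unique almost everywhere on `∂Ω`; the value `0` is taken where there is none. -/
def trace (Ω : Set Plane) (f : Plane → ℝ) : Plane → ℝ :=
  if H : ∃ t, IsTrace Ω f t then H.choose else 0

/-! ### The penalised least-squares problem -/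

/-- `v` belongs to the space of fields in `[H¹(Ω)]²` with mean zero. -/
def MemH1MeanZero (Ω : Set Plane) (v : Plane → Plane) : Prop :=
  ∀ i, MemH1 Ω (fun x => v x i) ∧ ∫ x in Ω, v x i = 0

/-- The Cauchy-Riemann operator on `[H¹(Ω)]²`, with weak derivatives. -/
def weakCrOp (Ω : Set Plane) (v : Plane → Plane) (x : Plane) : Plane :=
  !₂[-weakPDeriv Ω 0 (fun y => v y 0) x + weakPDeriv Ω 1 (fun y => v y 1) x,
    weakPDeriv Ω 1 (fun y => v y 0) x + weakPDeriv Ω 0 (fun y => v y 1) x]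

/-- The functional `½ (‖C v‖² + α ‖∂v‖²) - α ∫_{∂Ω} g · v ds`, with the norms of `L²(Ω)` (and the
Frobenius norm of the matrix `∂v`). -/
def energy (Ω : Set Plane) (g : Plane → Plane) (α : ℝ) (v : Plane → Plane) : ℝ :=
  1 / 2 * ((∫ x in Ω, ‖weakCrOp Ω v x‖ ^ 2) +
      α * ∫ x in Ω, ∑ i, ∑ j, weakPDeriv Ω j (fun y => v y i) x ^ 2) -
    α * ∫ x, ∑ i, g x i * trace Ω (fun y => v y i) x ∂(arcLength Ω)

/-- `w` minimises the functional over the fields in `[H¹(Ω)]²` with mean zero. -/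
def IsMinimiser (Ω : Set Plane) (g : Plane → Plane) (α : ℝ) (w : Plane → Plane) : Prop :=
  MemH1MeanZero Ω w ∧ ∀ v, MemH1MeanZero Ω v → energy Ω g α w ≤ energy Ω g α v

end CRNeumann

end

noncomputable section

namespace CRNeumann

/-! ### Area formula for Lipschitz graphs -/

/-! The Cauchy–Riemann equations and the symmetry of second derivatives make both components of `u`
harmonic (`laplacian_eq_zero`). Green's formula then turns the boundary datum into a volume term, ∫
g_i φ ds = ∫ ∇u_i · ∇φ dx, first for φ in C¹(Ω̄) (`IsCRNeumannSolution.green`) and by approximation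
for H¹ functions with their traces (`IsCRNeumannSolution.green_trace`). Inserting this in the
functional E and completing the square gives (`IsCRNeumannSolution.energy_eq`) E(v) = ½‖C v‖² +
(α/2)‖∂v − ∂u‖² − (α/2)‖∂u‖². Both leading squares vanish at v = u − c, so this field is a minimiser
once c is the mean of `u`, which does not depend on α. Any other minimiser has gradient ∂u almost
everywhere, hence differs from u − c by a constant on the connected set Ω, and the zero mean removes
the constant. No coercivity or compactness is involved.

The length comes from analysis on Lipschitz domains. The divergence theorem
`IsLipschitzDomain.integral_vdiv` is proved in graph charts: it is Fubini after straightening the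
epigraph (`integral_epigraph_fderiv`), then a limit of graphs pushed into the domain, because the
field is C¹ only inside. Arc length is a Hausdorff measure, so the area formula
`hausdorffMeasure_graph` is needed to parametrise it.

The functional contains a chosen trace, with default value zero, so Green's formula applies to it
only once traces are known to exist. This is `MemH1.exists_isTrace`, which combines the density of
smooth functions, obtained by mollifying with kernels that look into the domain
(`IsLipschitzDomain.exists_approximatesH1`), with the trace inequality
(`IsLipschitzDomain.trace_inequality`). Uniqueness of traces is not needed: `green_trace` holds for
any trace. -/

/-- The parametrisation of the graph of `γ` in the coordinates given by `e`. -/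
def graphPt (e : Plane ≃ₗᵢ[ℝ] Plane) (γ : ℝ → ℝ) (x : ℝ) : Plane := e.symm !₂[x, γ x]

/-- The arc length density of the graph of `γ`. -/
def arcDensity (γ : ℝ → ℝ) (x : ℝ) : ℝ := √(1 + deriv γ x ^ 2)

lemma plane_norm_eq (v : Plane) : ‖v‖ = √(v 0 ^ 2 + v 1 ^ 2) := by
  rw [EuclideanSpace.norm_eq]
  simp [Fin.sum_univ_two]

lemma graphPt_zero (e : Plane ≃ₗᵢ[ℝ] Plane) (γ : ℝ → ℝ) (x : ℝ) : e (graphPt e γ x) 0 = x := by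
  simp [graphPt]

lemma graphPt_one (e : Plane ≃ₗᵢ[ℝ] Plane) (γ : ℝ → ℝ) (x : ℝ) : e (graphPt e γ x) 1 = γ x := by
  simp [graphPt]

lemma graphPt_eq (e : Plane ≃ₗᵢ[ℝ] Plane) {γ : ℝ → ℝ} {y : Plane} (h : e y 1 = γ (e y 0)) :
    graphPt e γ (e y 0) = y := by
  rw [graphPt, ← h, LinearIsometryEquiv.symm_apply_eq]
  ext i
  fin_cases i <;> simp

lemma graphPt_injective (e : Plane ≃ₗᵢ[ℝ] Plane) (γ : ℝ → ℝ) : Function.Injective (graphPt e γ) :=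
  fun x y h => by rw [← graphPt_zero e γ x, h, graphPt_zero]

lemma range_graphPt (e : Plane ≃ₗᵢ[ℝ] Plane) (γ : ℝ → ℝ) :
    range (graphPt e γ) = {y | e y 1 = γ (e y 0)} := by
  ext y
  constructor
  · rintro ⟨x, rfl⟩
    simp [graphPt_zero, graphPt_one]
  · exact fun h => ⟨_, graphPt_eq e h⟩

lemma continuous_graphPt (e : Plane ≃ₗᵢ[ℝ] Plane) {γ : ℝ → ℝ} (hγ : Continuous γ) :
    Continuous (graphPt e γ) := by
  unfold graphPt
  fun_prop

lemma measurableEmbedding_graphPt (e : Plane ≃ₗᵢ[ℝ] Plane) {γ : ℝ → ℝ} (hγ : Continuous γ) :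
    MeasurableEmbedding (graphPt e γ) :=
  (continuous_graphPt e hγ).measurableEmbedding (graphPt_injective e γ)

lemma norm_graphPt_sub (e : Plane ≃ₗᵢ[ℝ] Plane) (γ : ℝ → ℝ) (x y : ℝ) :
    ‖graphPt e γ x - graphPt e γ y‖ = √((x - y) ^ 2 + (γ x - γ y) ^ 2) := by
  rw [graphPt, graphPt, ← map_sub, LinearIsometryEquiv.norm_map, plane_norm_eq]
  simp

/-- Reverse triangle inequality between the chord of the graph and the chord of a line of slope `m`
over the same interval: their difference is vertical, of length `|γ x - γ y - m * (x - y)|`. -/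
lemma abs_norm_graphPt_sub_le (e : Plane ≃ₗᵢ[ℝ] Plane) {γ : ℝ → ℝ} {x y m δ : ℝ}
    (h : |γ x - γ y - m * (x - y)| ≤ δ * |x - y|) :
    |(‖graphPt e γ x - graphPt e γ y‖ - √(1 + m ^ 2) * |x - y|)| ≤ δ * |x - y| := by
  have h1 : √(1 + m ^ 2) * |x - y| = ‖e.symm !₂[x - y, m * (x - y)]‖ := by
    rw [LinearIsometryEquiv.norm_map, plane_norm_eq, ← Real.sqrt_sq_eq_abs, ← Real.sqrt_mul (by positivity)]
    congr 1
    simp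
    ring
  rw [h1]
  refine (abs_norm_sub_norm_le _ _).trans (le_trans (le_of_eq ?_) h)
  rw [graphPt, graphPt, ← map_sub, ← map_sub, LinearIsometryEquiv.norm_map, plane_norm_eq,
    ← Real.sqrt_sq_eq_abs]
  simp

lemma one_le_sqrt_one_add_sq (m : ℝ) : 1 ≤ √(1 + m ^ 2) := by
  rw [Real.one_le_sqrt]
  nlinarith [sq_nonneg m]

lemma abs_sqrt_one_add_sq_sub_le (m n : ℝ) : |√(1 + m ^ 2) - √(1 + n ^ 2)| ≤ |m - n| := by
  have h : ∀ t : ℝ, √(1 + t ^ 2) = ‖(!₂[1, t] : Plane)‖ := fun t => by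
    rw [plane_norm_eq]; simp
  rw [h, h]
  refine (abs_norm_sub_norm_le _ _).trans (le_of_eq ?_)
  rw [plane_norm_eq, ← Real.sqrt_sq_eq_abs]
  simp

/-- On `s` the parametrisation is Lipschitz with constant `√(1 + m ^ 2) + δ`, and on the line
one-dimensional Hausdorff measure is Lebesgue measure. -/
lemma hausdorffMeasure_graph_le (e : Plane ≃ₗᵢ[ℝ] Plane) {γ : ℝ → ℝ} {s : Set ℝ} {m δ : ℝ}
    (hδ : 0 ≤ δ) (h : ∀ x ∈ s, ∀ y ∈ s, |γ x - γ y - m * (x - y)| ≤ δ * |x - y|) :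
    Measure.hausdorffMeasure 1 (graphPt e γ '' s) ≤ ENNReal.ofReal (√(1 + m ^ 2) + δ) * volume s := by
  have hL : LipschitzOnWith (Real.toNNReal (√(1 + m ^ 2) + δ)) (graphPt e γ) s := by
    refine LipschitzOnWith.of_dist_le_mul fun x hx y hy => ?_
    rw [Real.coe_toNNReal _ (by positivity), dist_eq_norm, Real.dist_eq]
    have := (abs_le.1 (abs_norm_graphPt_sub_le e (h x hx y hy))).2
    linarith
  have := hL.hausdorffMeasure_image_le zero_le_one
  rwa [ENNReal.rpow_one, hausdorffMeasure_real] at this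

/-- The inverse of the parametrisation is the projection to the first chart coordinate, which is
Lipschitz with constant `(√(1 + m ^ 2) - δ)⁻¹` on the graph piece; `δ < 1` keeps the denominator
positive. -/
lemma le_hausdorffMeasure_graph (e : Plane ≃ₗᵢ[ℝ] Plane) {γ : ℝ → ℝ} {s : Set ℝ} {m δ : ℝ}
    (hδ : δ < 1) (h : ∀ x ∈ s, ∀ y ∈ s, |γ x - γ y - m * (x - y)| ≤ δ * |x - y|) :
    ENNReal.ofReal (√(1 + m ^ 2) - δ) * volume s ≤ Measure.hausdorffMeasure 1 (graphPt e γ '' s) := by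
  have hpos : 0 < √(1 + m ^ 2) - δ := by linarith [one_le_sqrt_one_add_sq m]
  have hL : LipschitzOnWith (Real.toNNReal (√(1 + m ^ 2) - δ)⁻¹) (fun y : Plane => e y 0)
      (graphPt e γ '' s) := by
    refine LipschitzOnWith.of_dist_le_mul ?_
    rintro _ ⟨x, hx, rfl⟩ _ ⟨y, hy, rfl⟩
    rw [Real.coe_toNNReal _ (by positivity), dist_eq_norm (graphPt e γ x), Real.dist_eq, graphPt_zero,
      graphPt_zero, inv_mul_eq_div, le_div_iff₀ hpos]
    have := (abs_le.1 (abs_norm_graphPt_sub_le e (h x hx y hy))).1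
    linarith
  have := hL.hausdorffMeasure_image_le zero_le_one
  rw [ENNReal.rpow_one, hausdorffMeasure_real, image_image] at this
  simp only [graphPt_zero, image_id'] at this
  calc _ ≤ ENNReal.ofReal (√(1 + m ^ 2) - δ) * (ENNReal.ofReal (√(1 + m ^ 2) - δ)⁻¹ *
        Measure.hausdorffMeasure 1 (graphPt e γ '' s)) := by gcongr; exact this
    _ = _ := by
      rw [← mul_assoc, ← ENNReal.ofReal_mul hpos.le, mul_inv_cancel₀ hpos.ne', ENNReal.ofReal_one, one_mul]

/-- The area formula on `s` up to an error proportional to `δ`. -/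
def AreaUpTo (e : Plane ≃ₗᵢ[ℝ] Plane) (γ : ℝ → ℝ) (δ : ℝ≥0∞) (s : Set ℝ) : Prop :=
  Measure.hausdorffMeasure 1 (graphPt e γ '' s) ≤
      (∫⁻ x in s, ENNReal.ofReal (arcDensity γ x)) + δ * volume s ∧
    (∫⁻ x in s, ENNReal.ofReal (arcDensity γ x)) ≤
      Measure.hausdorffMeasure 1 (graphPt e γ '' s) + δ * volume s

/-- The error is proportional to the measure of the set, so it does not accumulate over a countable
partition. -/
lemma AreaUpTo.iUnion {ι : Type*} [Countable ι] {e : Plane ≃ₗᵢ[ℝ] Plane} {γ : ℝ → ℝ} (hγ : Continuous γ)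
    {δ : ℝ≥0∞} {s : ι → Set ℝ} (hs : ∀ n, MeasurableSet (s n)) (hd : Pairwise (Function.onFun Disjoint s))
    (h : ∀ n, AreaUpTo e γ δ (s n)) : AreaUpTo e γ δ (⋃ n, s n) := by
  have h1 : Measure.hausdorffMeasure 1 (graphPt e γ '' (⋃ n, s n)) =
      ∑' n, Measure.hausdorffMeasure 1 (graphPt e γ '' s n) := by
    rw [image_iUnion]
    refine measure_iUnion (fun i j hij => ?_)
      fun n => (measurableEmbedding_graphPt e hγ).measurableSet_image.2 (hs n)
    exact (disjoint_image_iff (graphPt_injective e γ)).2 (hd hij)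
  rw [AreaUpTo, h1, lintegral_iUnion hs hd, measure_iUnion hd hs, ← ENNReal.tsum_mul_left,
    ← ENNReal.tsum_add, ← ENNReal.tsum_add]
  exact ⟨ENNReal.tsum_le_tsum fun n => (h n).1, ENNReal.tsum_le_tsum fun n => (h n).2⟩

/-- One `δ` is lost in comparing Hausdorff measure with `√(1 + m ^ 2)`, the other in comparing `√(1
+ m ^ 2)` with the arc length density. -/
lemma areaUpTo_of_approx {e : Plane ≃ₗᵢ[ℝ] Plane} {γ : ℝ → ℝ} {s : Set ℝ}
    {m δ : ℝ} (hδ : 0 ≤ δ) (hδ1 : δ < 1)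
    (h : ∀ x ∈ s, ∀ y ∈ s, |γ x - γ y - m * (x - y)| ≤ δ * |x - y|)
    (hm : ∀ x ∈ s, |deriv γ x - m| ≤ δ) : AreaUpTo e γ (ENNReal.ofReal (2 * δ)) s := by
  have hc : ∀ c : ℝ≥0∞, c * volume s = ∫⁻ _ in s, c := fun c => by simp
  have hkey : ∀ x ∈ s, |arcDensity γ x - √(1 + m ^ 2)| ≤ δ := fun x hx =>
    (abs_sqrt_one_add_sq_sub_le _ _).trans (hm x hx)
  have hJ : Measurable fun x => ENNReal.ofReal (arcDensity γ x) := by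
    unfold arcDensity
    have := measurable_deriv γ
    fun_prop
  constructor
  · refine (hausdorffMeasure_graph_le e hδ h).trans ?_
    rw [hc, hc, ← lintegral_add_left hJ]
    refine setLIntegral_mono (hJ.add measurable_const) fun x hx => ?_
    rw [← ENNReal.ofReal_add (by unfold arcDensity; positivity) (by positivity)]
    exact ENNReal.ofReal_le_ofReal (by linarith [(abs_le.1 (hkey x hx)).1])
  · refine le_trans ?_ (add_le_add_left (le_hausdorffMeasure_graph e hδ1 h) _)
    rw [hc, hc, ← lintegral_add_left measurable_const]
    refine setLIntegral_mono measurable_const fun x hx => ?_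
    rw [← ENNReal.ofReal_add (by linarith [one_le_sqrt_one_add_sq m]) (by positivity)]
    exact ENNReal.ofReal_le_ofReal (by linarith [(abs_le.1 (hkey x hx)).2])

/-- A differentiable function is `δ`-close to linear on each piece of a countable partition, with
slope equal to its derivative at some point of `s`; by `hm` this slope is within `δ` of the
derivative everywhere on `s`. -/
lemma areaUpTo_of_deriv_close {e : Plane ≃ₗᵢ[ℝ] Plane} {γ : ℝ → ℝ} (hγ : Continuous γ) {s : Set ℝ}
    (hs : MeasurableSet s) {δ : ℝ≥0} (hδ : 0 < δ) (hδ1 : δ < 1)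
    (hd : ∀ x ∈ s, DifferentiableAt ℝ γ x) (hm : ∀ x ∈ s, ∀ y ∈ s, |deriv γ x - deriv γ y| ≤ δ) :
    AreaUpTo e γ (ENNReal.ofReal (2 * δ)) s := by
  obtain ⟨t, A, htd, htm, hst, hA, hy⟩ := exists_partition_approximatesLinearOn_of_hasFDerivWithinAt γ s
    (fun x => fderiv ℝ γ x) (fun x hx => (hd x hx).hasFDerivAt.hasFDerivWithinAt) (fun _ => δ)
    (fun _ => hδ.ne')
  have hU : s = ⋃ n, s ∩ t n := by rw [← inter_iUnion, inter_eq_left.2 hst]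
  rw [hU]
  refine AreaUpTo.iUnion hγ (fun n => hs.inter (htm n))
    (fun i j hij => (htd hij).mono inter_subset_right inter_subset_right) fun n => ?_
  refine areaUpTo_of_approx (m := A n 1) δ.2 hδ1 (fun x hx y hy' => ?_) fun x hx => ?_
  · have := hA n x hx y hy'
    have h2 : A n (x - y) = A n 1 * (x - y) := by
      conv_lhs => rw [← mul_one (x - y), ← smul_eq_mul, map_smul, smul_eq_mul, mul_comm]
    rwa [h2, Real.norm_eq_abs, Real.norm_eq_abs] at this
  · obtain ⟨y, hys, hyA⟩ := hy ⟨x, hx.1⟩ n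
    rw [hyA]
    exact hm x hx.1 y hys

/-- On each level set of `⌊deriv γ x / δ⌋` the derivative oscillates by less than `δ`. -/
lemma areaUpTo_of_differentiable {e : Plane ≃ₗᵢ[ℝ] Plane} {γ : ℝ → ℝ} (hγ : Continuous γ) {s : Set ℝ}
    (hs : MeasurableSet s) {δ : ℝ≥0} (hδ : 0 < δ) (hδ1 : δ < 1) (hd : ∀ x ∈ s, DifferentiableAt ℝ γ x) :
    AreaUpTo e γ (ENNReal.ofReal (2 * δ)) s := by
  have hU : s = ⋃ k : ℤ, s ∩ {x | ⌊deriv γ x / δ⌋ = k} := by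
    rw [← inter_iUnion, eq_comm, inter_eq_left]
    exact fun x _ => mem_iUnion.2 ⟨_, rfl⟩
  have hmeas : Measurable fun x => ⌊deriv γ x / δ⌋ := ((measurable_deriv γ).div_const _).floor
  have hms : ∀ k : ℤ, MeasurableSet (s ∩ {x | ⌊deriv γ x / δ⌋ = k}) := fun k =>
    hs.inter (hmeas (measurableSet_singleton k))
  rw [hU]
  refine AreaUpTo.iUnion hγ hms (fun i j hij => ?_) fun k =>
    areaUpTo_of_deriv_close hγ (hms k) hδ hδ1 (fun x hx => hd x hx.1) fun x hx y hy => ?_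
  · rw [Function.onFun, Set.disjoint_left]
    rintro x ⟨-, h1⟩ ⟨-, h2⟩
    exact hij (h1.symm.trans h2)
  · have h := Int.abs_sub_lt_one_of_floor_eq_floor (hx.2.trans hy.2.symm)
    have hδ' : (0 : ℝ) < δ := hδ
    rw [← sub_div, abs_div, abs_of_pos hδ', div_lt_one hδ'] at h
    exact h.le

/-- Let `δ` tend to zero; the error vanishes because `s` has finite measure. -/
lemma hausdorffMeasure_graph_of_differentiable {e : Plane ≃ₗᵢ[ℝ] Plane} {γ : ℝ → ℝ} (hγ : Continuous γ)
    {s : Set ℝ} (hs : MeasurableSet s) (hs' : volume s ≠ ⊤) (hd : ∀ x ∈ s, DifferentiableAt ℝ γ x) :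
    Measure.hausdorffMeasure 1 (graphPt e γ '' s) = ∫⁻ x in s, ENNReal.ofReal (arcDensity γ x) := by
  have hlim : ∀ c : ℝ≥0∞, Tendsto (fun δ : ℝ≥0 => c + ENNReal.ofReal (2 * δ) * volume s) (𝓝[>] 0) (𝓝 c) := by
    intro c
    have h1 : Tendsto (fun δ : ℝ≥0 => ENNReal.ofReal (2 * δ)) (𝓝[>] 0) (𝓝 0) := by
      have : Continuous fun δ : ℝ≥0 => ENNReal.ofReal (2 * δ) :=
        ENNReal.continuous_ofReal.comp (by fun_prop)
      simpa using (this.tendsto 0).mono_left nhdsWithin_le_nhds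
    have := (ENNReal.Tendsto.mul_const h1 (Or.inr hs')).const_add c
    simpa using this
  have hmem : ∀ᶠ δ : ℝ≥0 in 𝓝[>] 0, 0 < δ ∧ δ < 1 :=
    (eventually_mem_nhdsWithin).and (nhdsWithin_le_nhds (eventually_lt_nhds zero_lt_one))
  refine le_antisymm (ge_of_tendsto (hlim _) ?_) (ge_of_tendsto (hlim _) ?_)
  · filter_upwards [hmem] with δ hδ
    exact (areaUpTo_of_differentiable hγ hs hδ.1 hδ.2 hd).1
  · filter_upwards [hmem] with δ hδ
    exact (areaUpTo_of_differentiable hγ hs hδ.1 hδ.2 hd).2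

lemma lipschitzWith_graphPt (e : Plane ≃ₗᵢ[ℝ] Plane) {γ : ℝ → ℝ} {K : ℝ≥0} (hγ : LipschitzWith K γ) :
    LipschitzWith (1 + K) (graphPt e γ) := by
  refine LipschitzWith.of_dist_le_mul fun x y => ?_
  rw [dist_eq_norm, norm_graphPt_sub]
  have h1 := hγ.dist_le_mul x y
  rw [Real.dist_eq, Real.dist_eq] at *
  refine Real.sqrt_le_iff.2 ⟨by positivity, ?_⟩
  rw [← sq_abs (x - y), ← sq_abs (γ x - γ y)]
  push_cast
  nlinarith [abs_nonneg (γ x - γ y), abs_nonneg (x - y), K.2, mul_nonneg K.2 (abs_nonneg (x - y))]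

/-- **Area formula** for a Lipschitz graph. -/
theorem hausdorffMeasure_graph (e : Plane ≃ₗᵢ[ℝ] Plane) {γ : ℝ → ℝ} {K : ℝ≥0} (hγ : LipschitzWith K γ)
    {s : Set ℝ} (hs : MeasurableSet s) :
    Measure.hausdorffMeasure 1 (graphPt e γ '' s) = ∫⁻ x in s, ENNReal.ofReal (arcDensity γ x) := by
  -- The exceptional set of Rademacher's theorem contributes nothing to the graph, since Lipschitz
  -- maps preserve null sets.
  have hnull : ∀ N : Set ℝ, volume N = 0 → Measure.hausdorffMeasure 1 (graphPt e γ '' N) = 0 := by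
    intro N hN
    have := (lipschitzWith_graphPt e hγ).hausdorffMeasure_image_le zero_le_one N
    rw [hausdorffMeasure_real, hN, mul_zero] at this
    exact le_antisymm this zero_le
  have hD : MeasurableSet {x | DifferentiableAt ℝ γ x} := measurableSet_of_differentiableAt ℝ γ
  have hN : volume {x | ¬ DifferentiableAt ℝ γ x} = 0 := hγ.ae_differentiableAt
  -- Cutting into unit intervals provides the finite measure that the limit `δ → 0` requires.
  have key : ∀ k : ℤ, Measure.hausdorffMeasure 1 (graphPt e γ '' (s ∩ {x | ⌊x⌋ = k})) =
      ∫⁻ x in s ∩ {x | ⌊x⌋ = k}, ENNReal.ofReal (arcDensity γ x) := by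
    intro k
    have hb : volume (s ∩ {x | ⌊x⌋ = k}) ≠ ⊤ := by
      refine ne_top_of_le_ne_top (b := volume (Icc (k : ℝ) (k + 1))) (by simp) (measure_mono fun x hx => ?_)
      obtain ⟨-, hx⟩ := hx
      simp only [mem_ofPred_eq, Int.floor_eq_iff] at hx
      exact ⟨hx.1, hx.2.le⟩
    have hm : MeasurableSet (s ∩ {x | ⌊x⌋ = k}) := hs.inter (Int.measurable_floor (measurableSet_singleton k))
    set S := s ∩ {x | ⌊x⌋ = k}
    have h1 := hausdorffMeasure_graph_of_differentiable (e := e) hγ.continuous (hm.inter hD)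
      (ne_top_of_le_ne_top hb (measure_mono inter_subset_left)) fun x hx => hx.2
    have h2 : Measure.hausdorffMeasure 1 (graphPt e γ '' S) =
        Measure.hausdorffMeasure 1 (graphPt e γ '' (S ∩ {x | DifferentiableAt ℝ γ x})) := by
      refine le_antisymm ?_ (measure_mono (image_mono inter_subset_left))
      have : S ⊆ (S ∩ {x | DifferentiableAt ℝ γ x}) ∪ {x | ¬ DifferentiableAt ℝ γ x} := fun x hx => by
        by_cases h : DifferentiableAt ℝ γ x
        · exact Or.inl ⟨hx, h⟩
        · exact Or.inr h
      refine (measure_mono (image_mono this)).trans ?_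
      rw [image_union]
      refine (measure_union_le _ _).trans ?_
      rw [hnull _ hN, add_zero]
    rw [h2, h1]
    refine setLIntegral_congr (inter_ae_eq_left_of_ae_eq_univ ?_)
    exact eventuallyEq_univ.2 hγ.ae_differentiableAt
  have hU : s = ⋃ k : ℤ, s ∩ {x | ⌊x⌋ = k} := by
    rw [← inter_iUnion, eq_comm, inter_eq_left]
    exact fun x _ => mem_iUnion.2 ⟨_, rfl⟩
  have hm : ∀ k : ℤ, MeasurableSet (s ∩ {x | ⌊x⌋ = k}) := fun k =>
    hs.inter (Int.measurable_floor (measurableSet_singleton k))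
  have hd : Pairwise (Function.onFun Disjoint fun k : ℤ => s ∩ {x | ⌊x⌋ = k}) := by
    intro i j hij
    rw [Function.onFun, Set.disjoint_left]
    rintro x ⟨-, h1⟩ ⟨-, h2⟩
    exact hij (h1.symm.trans h2)
  -- With error zero, `AreaUpTo` is the exact formula, so its additivity reassembles the pieces.
  have hz : ∀ k : ℤ, AreaUpTo e γ 0 (s ∩ {x | ⌊x⌋ = k}) := fun k => by
    constructor <;> simp [key k]
  have := AreaUpTo.iUnion hγ.continuous hm hd hz
  rw [← hU] at this
  exact le_antisymm (by simpa using this.1) (by simpa using this.2)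

lemma map_graphPt (e : Plane ≃ₗᵢ[ℝ] Plane) {γ : ℝ → ℝ} {K : ℝ≥0} (hγ : LipschitzWith K γ) :
    Measure.map (graphPt e γ) (volume.withDensity fun x => ENNReal.ofReal (arcDensity γ x)) =
      (Measure.hausdorffMeasure 1).restrict (range (graphPt e γ)) := by
  have hme := measurableEmbedding_graphPt e hγ.continuous
  ext A hA
  rw [hme.map_apply, withDensity_apply _ (hme.measurable hA),
    ← hausdorffMeasure_graph e hγ (hme.measurable hA), image_preimage_eq_inter_range,
    Measure.restrict_apply hA]

lemma integral_graph (e : Plane ≃ₗᵢ[ℝ] Plane) {γ : ℝ → ℝ} {K : ℝ≥0} (hγ : LipschitzWith K γ)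
    (f : Plane → ℝ) :
    ∫ y in {y | e y 1 = γ (e y 0)}, f y ∂(Measure.hausdorffMeasure 1) =
      ∫ x, arcDensity γ x * f (graphPt e γ x) := by
  rw [← range_graphPt, ← map_graphPt e hγ, (measurableEmbedding_graphPt e hγ.continuous).integral_map,
    integral_withDensity_eq_integral_toReal_smul]
  · refine integral_congr_ae (Eventually.of_forall fun x => ?_)
    simp [arcDensity]
  · unfold arcDensity
    have := measurable_deriv γ
    fun_prop
  · simp

/-! ### Integration over a Lipschitz epigraph -/

/-- The `j`-th coordinate direction of the chart `e`. -/
def chartDir (e : Plane ≃ₗᵢ[ℝ] Plane) (j : Fin 2) : Plane := e.symm (EuclideanSpace.single j 1)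

/-- The parametrisation of the plane that straightens the epigraph of `γ` to a half plane. -/
def straighten (e : Plane ≃ₗᵢ[ℝ] Plane) (γ : ℝ → ℝ) (p : ℝ × ℝ) : Plane :=
  p.1 • chartDir e 0 + (γ p.1 + p.2) • chartDir e 1

lemma toLp_eq_smul_add_smul (a b : ℝ) : (!₂[a, b] : Plane) =
    a • EuclideanSpace.single 0 1 + b • EuclideanSpace.single 1 1 := by
  ext i
  fin_cases i <;> simp

lemma straighten_eq (e : Plane ≃ₗᵢ[ℝ] Plane) (γ : ℝ → ℝ) (p : ℝ × ℝ) :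
    straighten e γ p = e.symm !₂[p.1, γ p.1 + p.2] := by
  rw [toLp_eq_smul_add_smul, map_add, map_smul, map_smul, straighten, chartDir, chartDir]

lemma straighten_mk (e : Plane ≃ₗᵢ[ℝ] Plane) (γ : ℝ → ℝ) (x s : ℝ) :
    straighten e γ (x, s) = graphPt e (fun x => γ x + s) x := straighten_eq e γ (x, s)

lemma eq_smul_chartDir (e : Plane ≃ₗᵢ[ℝ] Plane) (v : Plane) :
    v = e v 0 • chartDir e 0 + e v 1 • chartDir e 1 := by
  rw [chartDir, chartDir, ← map_smul, ← map_smul, ← map_add, ← toLp_eq_smul_add_smul, eq_comm,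
    LinearIsometryEquiv.symm_apply_eq]
  ext i
  fin_cases i <;> simp

lemma norm_chartDir (e : Plane ≃ₗᵢ[ℝ] Plane) (j : Fin 2) : ‖chartDir e j‖ = 1 := by
  rw [chartDir, LinearIsometryEquiv.norm_map]
  simp

lemma continuous_straighten (e : Plane ≃ₗᵢ[ℝ] Plane) {γ : ℝ → ℝ} (hγ : Continuous γ) :
    Continuous (straighten e γ) := by
  unfold straighten
  fun_prop

lemma e_straighten_zero (e : Plane ≃ₗᵢ[ℝ] Plane) (γ : ℝ → ℝ) (p : ℝ × ℝ) :
    e (straighten e γ p) 0 = p.1 := by simp [straighten_eq]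

lemma e_straighten_one (e : Plane ≃ₗᵢ[ℝ] Plane) (γ : ℝ → ℝ) (p : ℝ × ℝ) :
    e (straighten e γ p) 1 = γ p.1 + p.2 := by simp [straighten_eq]

lemma measurableEmbedding_straighten (e : Plane ≃ₗᵢ[ℝ] Plane) {γ : ℝ → ℝ} (hγ : Continuous γ) :
    MeasurableEmbedding (straighten e γ) := by
  refine (continuous_straighten e hγ).measurableEmbedding fun p q h => ?_
  have h0 := e_straighten_zero e γ p
  have h1 := e_straighten_one e γ p
  rw [h, e_straighten_zero] at h0
  rw [h, e_straighten_one, h0] at h1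
  exact Prod.ext h0.symm (by linarith)

/-- Each vertical line is merely translated, so the shear preserves Lebesgue measure without any
differentiability of `γ`; an isometry follows. -/
lemma measurePreserving_straighten (e : Plane ≃ₗᵢ[ℝ] Plane) {γ : ℝ → ℝ} (hγ : Continuous γ) :
    MeasurePreserving (straighten e γ) := by
  have h1 : MeasurePreserving (fun p : ℝ × ℝ => (p.1, γ p.1 + p.2)) :=
    (MeasurePreserving.id (volume : Measure ℝ)).skew_product
      (g := fun a b => γ a + b) (by fun_prop)
      (Eventually.of_forall fun a => map_add_left_eq_self _ _)
  have h2 := ((volume_preserving_finTwoArrow ℝ).symm _).comp h1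
  have h3 := (LinearIsometryEquiv.measurePreserving e.symm).comp
    ((PiLp.volume_preserving_toLp (Fin 2)).comp h2)
  convert! h3 using 1
  ext p : 1
  rw [straighten_eq]
  rfl

/-- The strict epigraph of `γ` in the chart `e`. -/
def epigraph (e : Plane ≃ₗᵢ[ℝ] Plane) (γ : ℝ → ℝ) : Set Plane := {y | γ (e y 0) < e y 1}

lemma isOpen_epigraph (e : Plane ≃ₗᵢ[ℝ] Plane) {γ : ℝ → ℝ} (hγ : Continuous γ) :
    IsOpen (epigraph e γ) := isOpen_lt (by fun_prop) (by fun_prop)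

lemma integral_epigraph (e : Plane ≃ₗᵢ[ℝ] Plane) {γ : ℝ → ℝ} (hγ : Continuous γ) (f : Plane → ℝ) :
    ∫ y in epigraph e γ, f y =
      ∫ p in (univ : Set ℝ) ×ˢ Ioi (0 : ℝ), f (straighten e γ p) ∂(volume.prod volume) := by
  rw [← (measurePreserving_straighten e hγ).setIntegral_preimage_emb
    (measurableEmbedding_straighten e hγ)]
  congr 2
  ext p
  simp [epigraph, e_straighten_zero, e_straighten_one]

/-- Lipschitz functions are absolutely continuous, so the fundamental theorem of calculus applies on
an interval containing the support. -/
lemma integral_deriv_eq_zero_of_lipschitzWith {f : ℝ → ℝ} {K : ℝ≥0} (hf : LipschitzWith K f)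
    (hc : HasCompactSupport f) : ∫ x, deriv f x = 0 := by
  obtain ⟨R, hR⟩ := hc.isCompact.isBounded.subset_ball 0
  have hz : ∀ x, R ≤ |x| → f x = 0 := fun x hx => by
    refine image_eq_zero_of_notMem_tsupport fun h => ?_
    have := hR h
    rw [Metric.mem_ball, dist_zero_right, Real.norm_eq_abs] at this
    linarith
  have hR' : -|R| ≤ |R| := by linarith [abs_nonneg R]
  have hAC := (hf.lipschitzOnWith (s := uIcc (-|R|) |R|)).absolutelyContinuousOnInterval.integral_deriv_eq_sub
  rw [hz, hz, sub_zero, intervalIntegral.integral_of_le hR'] at hAC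
  · rw [← hAC]
    refine (setIntegral_eq_integral_of_forall_compl_eq_zero fun x hx => ?_).symm
    have hx' : R ≤ |x| := by
      by_contra h
      push Not at h
      have h1 := abs_lt.1 (h.trans_le (le_abs_self R))
      exact hx ⟨h1.1, h1.2.le⟩
    have : x ∉ tsupport f := fun h => by
      have := hR h
      rw [Metric.mem_ball, dist_zero_right, Real.norm_eq_abs] at this
      linarith
    exact image_eq_zero_of_notMem_tsupport fun h => this (tsupport_deriv_subset h)
  · rw [abs_neg, abs_abs]; exact le_abs_self R
  · rw [abs_abs]; exact le_abs_self R

/-- The divergence theorem on a Lipschitz epigraph for compactly supported functions of class `C¹`. -/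
theorem integral_epigraph_fderiv (e : Plane ≃ₗᵢ[ℝ] Plane) {γ : ℝ → ℝ} {K : ℝ≥0} (hγ : LipschitzWith K γ)
    {G : Plane → ℝ} (hG : ContDiff ℝ 1 G) (hGc : HasCompactSupport G) (v : Plane) :
    ∫ y in epigraph e γ, fderiv ℝ G y v =
      ∫ x, G (graphPt e γ x) * (deriv γ x * e v 0 - e v 1) := by
  have hγc := hγ.continuous
  have hmp := measurePreserving_straighten e hγc
  have hme := measurableEmbedding_straighten e hγc
  have hψc := continuous_straighten e hγc
  set ψ := straighten e γ with hψ
  -- Derivatives along the chart axes, pulled back. In the straightened coordinates `(x, s)` the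
  -- vertical derivative of `G ∘ ψ` is `D 1` and the horizontal one is `D 0 + γ' * D 1`.
  set D : Fin 2 → ℝ × ℝ → ℝ := fun j p => fderiv ℝ G (ψ p) (chartDir e j) with hD
  have hDint : ∀ j, Integrable (D j) (volume.prod volume) := fun j => by
    refine (hmp.integrable_comp_emb hme (g := fun y => fderiv ℝ G y (chartDir e j))).2 ?_
    exact ((hG.continuous_fderiv one_ne_zero).clm_apply continuous_const).integrable_of_hasCompactSupport
      (hGc.fderiv_apply ℝ _)
  have hγb : ∀ x, ‖deriv γ x‖ ≤ K := fun x => norm_deriv_le_of_lipschitz hγ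
  have hγm : Measurable (deriv γ) := measurable_deriv γ
  have hDγ : Integrable (fun p : ℝ × ℝ => deriv γ p.1 * D 1 p) (volume.prod volume) :=
    (hDint 1).bdd_mul (hγm.comp measurable_fst).aestronglyMeasurable (Eventually.of_forall fun p => hγb p.1)
  set S : Set (ℝ × ℝ) := univ ×ˢ Ioi 0 with hS
  have hψ0 : ∀ x, ψ (x, 0) = graphPt e γ x := fun x => by rw [hψ, straighten_mk]; simp
  -- compact support on lines
  obtain ⟨R, hR⟩ := hGc.isCompact.isBounded.subset_closedBall 0
  have hz : ∀ p : ℝ × ℝ, R < |p.1| ∨ R < |γ p.1 + p.2| → G (ψ p) = 0 := fun p hp => by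
    refine image_eq_zero_of_notMem_tsupport fun h => ?_
    have h1 := hR h
    rw [Metric.mem_closedBall, dist_zero_right, ← e.norm_map] at h1
    have h2 := PiLp.norm_apply_le (e (ψ p)) 0
    have h3 := PiLp.norm_apply_le (e (ψ p)) 1
    rw [e_straighten_zero, Real.norm_eq_abs] at h2
    rw [e_straighten_one, Real.norm_eq_abs] at h3
    rcases hp with hp | hp <;> linarith
  -- vertical
  have hvert : ∀ x, ∫ s in Ioi (0 : ℝ), D 1 (x, s) = -G (graphPt e γ x) := fun x => by
    have hd : ∀ s, HasDerivAt (fun s => G (ψ (x, s))) (D 1 (x, s)) s := fun s => by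
      have h1 : HasDerivAt (fun s => ψ (x, s)) (chartDir e 1) s := by
        have := (((hasDerivAt_id s).const_add (γ x)).smul_const (chartDir e 1)).const_add (x • chartDir e 0)
        convert! this using 1
        simp
      exact ((hG.differentiable one_ne_zero _).hasFDerivAt).comp_hasDerivAt s h1
    have hC : ContDiff ℝ 1 fun s => G (ψ (x, s)) := by
      refine hG.comp ?_
      simp only [hψ, straighten]
      fun_prop
    have hc : HasCompactSupport fun s => G (ψ (x, s)) := by
      refine HasCompactSupport.of_support_subset_isCompact (K := Icc (-R - γ x) (R - γ x)) isCompact_Icc ?_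
      intro s hs
      by_contra h
      refine hs (hz (x, s) (Or.inr ?_))
      by_contra h'
      push Not at h'
      have := abs_le.1 h'
      simp only at this
      exact h ⟨by linarith, by linarith⟩
    rw [← hψ0, ← hc.integral_Ioi_deriv_eq hC 0]
    exact integral_congr_ae (Eventually.of_forall fun s => (hd s).deriv.symm)
  -- horizontal
  have hhor : ∀ s, ∫ x, (D 0 (x, s) + deriv γ x * D 1 (x, s)) = 0 := fun s => by
    obtain ⟨C, hC⟩ := hG.lipschitzWith_of_hasCompactSupport hGc one_ne_zero
    have hγs : LipschitzWith K fun x => γ x + s := by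
      refine LipschitzWith.of_dist_le_mul fun x y => ?_
      simpa using hγ.dist_le_mul x y
    -- Horizontally the composite is only as regular as `γ`, hence Lipschitz; this is why the
    -- absolutely continuous version of the fundamental theorem is used.
    have hL : LipschitzWith (C * (1 + K)) fun x => G (ψ (x, s)) := by
      simp only [hψ, straighten_mk]
      exact hC.comp (lipschitzWith_graphPt e hγs)
    have hc : HasCompactSupport fun x => G (ψ (x, s)) := by
      refine HasCompactSupport.of_support_subset_isCompact (K := Icc (-R) R) isCompact_Icc ?_
      intro x hx
      by_contra h
      refine hx (hz (x, s) (Or.inl ?_))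
      by_contra h'
      push Not at h'
      exact h (abs_le.1 h')
    rw [← integral_deriv_eq_zero_of_lipschitzWith hL hc]
    refine integral_congr_ae ?_
    filter_upwards [hγ.ae_differentiableAt] with x hx
    have h1 : HasDerivAt (fun x => ψ (x, s)) (chartDir e 0 + deriv γ x • chartDir e 1) x := by
      have := ((hasDerivAt_id x).smul_const (chartDir e 0)).add
        ((hx.hasDerivAt.add_const s).smul_const (chartDir e 1))
      convert! this using 1
      simp
    have := (((hG.differentiable one_ne_zero (ψ (x, s))).hasFDerivAt).comp_hasDerivAt x h1).deriv
    rw [Function.comp_def] at this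
    rw [this, map_add, map_smul, smul_eq_mul]
  have hI1 : ∫ p in S, D 1 p ∂(volume.prod volume) = -∫ x, G (graphPt e γ x) := by
    rw [setIntegral_prod _ (hDint 1).integrableOn, Measure.restrict_univ]
    simp only [hvert]
    rw [integral_neg]
  have hI2 : ∫ p in S, deriv γ p.1 * D 1 p ∂(volume.prod volume) =
      -∫ x, deriv γ x * G (graphPt e γ x) := by
    rw [setIntegral_prod _ hDγ.integrableOn, Measure.restrict_univ]
    simp only [integral_const_mul, hvert, mul_neg]
    rw [integral_neg]
  -- Fubini in the other order, horizontal lines first. Together with `hI2` this evaluates the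
  -- integral of `D 0`.
  have hI3 : ∫ p in S, (D 0 p + deriv γ p.1 * D 1 p) ∂(volume.prod volume) = 0 := by
    rw [← Measure.prod_restrict, Measure.restrict_univ, integral_prod_symm]
    · simp only [hhor, integral_zero]
    · rw [← Measure.restrict_univ (μ := (volume : Measure ℝ)), Measure.prod_restrict]
      simp only [Measure.restrict_univ]
      exact ((hDint 0).add hDγ).integrableOn
  rw [integral_add (hDint 0).integrableOn hDγ.integrableOn, hI2] at hI3
  have hGi : Integrable fun x => G (graphPt e γ x) := by
    refine Continuous.integrable_of_hasCompactSupport (hG.continuous.comp (continuous_graphPt e hγc)) ?_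
    refine HasCompactSupport.of_support_subset_isCompact (K := Icc (-R) R) isCompact_Icc ?_
    intro x hx
    by_contra h
    refine hx ?_
    simp only [← hψ0]
    refine hz (x, 0) (Or.inl ?_)
    by_contra h'
    push Not at h'
    exact h (abs_le.1 h')
  have hGi' : Integrable fun x => deriv γ x * G (graphPt e γ x) :=
    hGi.bdd_mul hγm.aestronglyMeasurable (Eventually.of_forall hγb)
  calc ∫ y in epigraph e γ, fderiv ℝ G y v
      = ∫ p in S, (e v 0 * D 0 p + e v 1 * D 1 p) ∂(volume.prod volume) := by
        rw [integral_epigraph e hγc]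
        congr 1
        ext p
        conv_lhs => rw [eq_smul_chartDir e v]
        rw [map_add, map_smul, map_smul]
        rfl
    _ = e v 0 * (∫ x, deriv γ x * G (graphPt e γ x)) - e v 1 * ∫ x, G (graphPt e γ x) := by
        rw [integral_add ((hDint 0).integrableOn.const_mul _) ((hDint 1).integrableOn.const_mul _),
          integral_const_mul, integral_const_mul, hI1]
        rw [show ∫ p in S, D 0 p ∂(volume.prod volume) = ∫ x, deriv γ x * G (graphPt e γ x) by linarith]
        ring
    _ = _ := by
        rw [← integral_const_mul, ← integral_const_mul, ← integral_sub (hGi'.const_mul _) (hGi.const_mul _)]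
        refine integral_congr_ae (Eventually.of_forall fun x => ?_)
        simp only
        ring

/-! ### Graph charts of a Lipschitz domain -/

/-- In the open set `U`, the set `Ω` is the strict epigraph of the `K`-Lipschitz function `γ`, in the
coordinates `e`. -/
structure IsGraphChart (Ω U : Set Plane) (e : Plane ≃ₗᵢ[ℝ] Plane) (K : ℝ≥0) (γ : ℝ → ℝ) : Prop where
  isOpen : IsOpen U
  lipschitz : LipschitzWith K γ
  mem_iff : ∀ y ∈ U, (y ∈ Ω ↔ γ (e y 0) < e y 1)

lemma IsLipschitzDomain.exists_chart {Ω : Set Plane} (hΩ : IsLipschitzDomain Ω) {x : Plane}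
    (hx : x ∈ frontier Ω) : ∃ U e K γ, x ∈ U ∧ IsGraphChart Ω U e K γ := by
  obtain ⟨e, K, γ, hγ, h⟩ := hΩ.graph x hx
  obtain ⟨U, hU, hUo, hxU⟩ := eventually_nhds_iff.1 h
  exact ⟨U, e, K, γ, hxU, hUo, hγ, hU⟩

lemma tendsto_graphPt_add (e : Plane ≃ₗᵢ[ℝ] Plane) (γ : ℝ → ℝ) (x : ℝ) :
    Tendsto (fun t : ℝ => graphPt e (fun x => γ x + t) x) (𝓝 0) (𝓝 (graphPt e γ x)) := by
  have h : Continuous fun t : ℝ => graphPt e (fun x => γ x + t) x := by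
    unfold graphPt
    fun_prop
  simpa using h.tendsto 0

lemma IsGraphChart.graphPt_mem {Ω U : Set Plane} {e : Plane ≃ₗᵢ[ℝ] Plane} {K : ℝ≥0} {γ : ℝ → ℝ}
    (h : IsGraphChart Ω U e K γ) {x : ℝ} (hx : graphPt e γ x ∈ U) :
    ∀ᶠ t in 𝓝[>] (0 : ℝ), graphPt e (fun x => γ x + t) x ∈ Ω := by
  have h1 : ∀ᶠ t in 𝓝[>] (0 : ℝ), graphPt e (fun x => γ x + t) x ∈ U :=
    ((tendsto_graphPt_add e γ x).mono_left nhdsWithin_le_nhds).eventually (h.isOpen.mem_nhds hx)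
  filter_upwards [h1, self_mem_nhdsWithin] with t ht ht0
  rw [h.mem_iff _ ht, graphPt_zero, graphPt_one]
  simpa using ht0

lemma IsGraphChart.mem_closure {Ω U : Set Plane} {e : Plane ≃ₗᵢ[ℝ] Plane} {K : ℝ≥0} {γ : ℝ → ℝ}
    (h : IsGraphChart Ω U e K γ) {x : ℝ} (hx : graphPt e γ x ∈ U) : graphPt e γ x ∈ closure Ω :=
  mem_closure_of_tendsto ((tendsto_graphPt_add e γ x).mono_left nhdsWithin_le_nhds) (h.graphPt_mem hx)

/-- Points strictly below the graph have a neighbourhood disjoint from `Ω`, and points on the graph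
are limits of points of `Ω` vertically above them. -/
lemma IsGraphChart.mem_frontier_iff {Ω U : Set Plane} {e : Plane ≃ₗᵢ[ℝ] Plane} {K : ℝ≥0} {γ : ℝ → ℝ}
    (hΩ : IsOpen Ω) (h : IsGraphChart Ω U e K γ) {y : Plane} (hy : y ∈ U) :
    y ∈ frontier Ω ↔ e y 1 = γ (e y 0) := by
  have hγ := h.lipschitz.continuous
  rw [hΩ.frontier_eq]
  constructor
  · rintro ⟨h1, h2⟩
    rw [h.mem_iff y hy, not_lt] at h2
    refine le_antisymm h2 (not_lt.1 fun h3 => ?_)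
    have ho : IsOpen (U ∩ {z | e z 1 < γ (e z 0)}) :=
      h.isOpen.inter (isOpen_lt (by fun_prop) (by fun_prop))
    obtain ⟨z, ⟨hzU, hz⟩, hzΩ⟩ := mem_closure_iff.1 h1 _ ho ⟨hy, h3⟩
    exact lt_asymm hz ((h.mem_iff z hzU).1 hzΩ)
  · intro h1
    have h2 := graphPt_eq e h1
    have h3 : graphPt e γ (e y 0) ∈ closure Ω := h.mem_closure (by rwa [h2])
    rw [h2] at h3
    refine ⟨h3, fun h3 => ?_⟩
    exact ((h.mem_iff y hy).1 h3).ne' h1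

/-- The (not normalised) outward normal to the epigraph of `γ`. -/
def graphNormal (e : Plane ≃ₗᵢ[ℝ] Plane) (γ : ℝ → ℝ) (x : ℝ) : Plane := e.symm !₂[deriv γ x, -1]

lemma inner_graphNormal (e : Plane ≃ₗᵢ[ℝ] Plane) (γ : ℝ → ℝ) (x : ℝ) (v : Plane) :
    inner ℝ v (graphNormal e γ x) = deriv γ x * e v 0 - e v 1 := by
  rw [graphNormal, ← LinearIsometryEquiv.inner_map_map e, LinearIsometryEquiv.apply_symm_apply]
  simp [PiLp.inner_apply, Fin.sum_univ_two]
  ring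

lemma norm_graphNormal (e : Plane ≃ₗᵢ[ℝ] Plane) (γ : ℝ → ℝ) (x : ℝ) :
    ‖graphNormal e γ x‖ = arcDensity γ x := by
  rw [graphNormal, LinearIsometryEquiv.norm_map, plane_norm_eq, arcDensity]
  congr 1
  simp
  ring

lemma one_le_arcDensity (γ : ℝ → ℝ) (x : ℝ) : 1 ≤ arcDensity γ x := one_le_sqrt_one_add_sq _

/-- This is the factor that appears in `integral_epigraph_fderiv` for the coordinate direction `j`.
-/
lemma graphNormal_apply (e : Plane ≃ₗᵢ[ℝ] Plane) (γ : ℝ → ℝ) (x : ℝ) (j : Fin 2) :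
    graphNormal e γ x j = deriv γ x * e (EuclideanSpace.single j 1) 0 -
      e (EuclideanSpace.single j 1) 1 := by
  rw [← inner_graphNormal, EuclideanSpace.inner_single_left]
  simp

lemma inner_eq_sum_graphNormal (e : Plane ≃ₗᵢ[ℝ] Plane) (γ : ℝ → ℝ) (x : ℝ) (v : Plane) :
    inner ℝ v (graphNormal e γ x) = ∑ j, v j * graphNormal e γ x j := by
  simp [PiLp.inner_apply, Fin.sum_univ_two, mul_comm]

lemma measurable_graphNormal (e : Plane ≃ₗᵢ[ℝ] Plane) (γ : ℝ → ℝ) : Measurable (graphNormal e γ) := by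
  have := measurable_deriv γ
  have h : Measurable fun x => (!₂[deriv γ x, -1] : Plane) := by
    simp only [toLp_eq_smul_add_smul]
    fun_prop
  exact e.symm.continuous.measurable.comp h

lemma arcDensity_le {γ : ℝ → ℝ} {K : ℝ≥0} (hγ : LipschitzWith K γ) (x : ℝ) : arcDensity γ x ≤ 1 + K := by
  refine Real.sqrt_le_iff.2 ⟨by positivity, ?_⟩
  have h1 : |deriv γ x| ≤ K := norm_deriv_le_of_lipschitz hγ
  nlinarith [sq_abs (deriv γ x), abs_nonneg (deriv γ x), K.2]

lemma norm_graphNormal_le (e : Plane ≃ₗᵢ[ℝ] Plane) {γ : ℝ → ℝ} {K : ℝ≥0} (hγ : LipschitzWith K γ) (x : ℝ) :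
    ‖graphNormal e γ x‖ ≤ 1 + K := by
  rw [norm_graphNormal]
  exact arcDensity_le hγ x

/-- Differentiability bounds the deviation of the graph from its tangent by `ε * |e y 0 - x|`;
normalising the normal does no harm because the arc length density is at least one. -/
lemma IsGraphChart.isOuterNormal {Ω U : Set Plane} {e : Plane ≃ₗᵢ[ℝ] Plane} {K : ℝ≥0} {γ : ℝ → ℝ}
    (h : IsGraphChart Ω U e K γ) {x : ℝ} (hx : graphPt e γ x ∈ U) (hd : DifferentiableAt ℝ γ x) :
    IsOuterNormal Ω (graphPt e γ x) ((arcDensity γ x)⁻¹ • graphNormal e γ x) := by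
  have hJ : 0 < arcDensity γ x := by linarith [one_le_arcDensity γ x]
  refine ⟨?_, fun ε hε => ?_⟩
  · rw [norm_smul, norm_graphNormal, Real.norm_of_nonneg (by positivity), inv_mul_cancel₀ hJ.ne']
  · have h1 : ∀ᶠ s in 𝓝 x, |γ s - γ x - deriv γ x * (s - x)| ≤ ε * |s - x| := by
      have := hd.hasDerivAt.isLittleO.def hε
      simpa [mul_comm] using this
    have h2 : Tendsto (fun y : Plane => e y 0) (𝓝 (graphPt e γ x)) (𝓝 x) := by
      have : Continuous fun y : Plane => e y 0 := by fun_prop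
      simpa [graphPt_zero] using this.tendsto (graphPt e γ x)
    filter_upwards [h2.eventually h1, h.isOpen.mem_nhds hx] with y hy hyU
    have h3 : |e y 0 - x| ≤ ‖y - graphPt e γ x‖ := by
      have := PiLp.norm_apply_le (e (y - graphPt e γ x)) 0
      rwa [e.norm_map, map_sub, PiLp.sub_apply, graphPt_zero] at this
    have h4 : inner ℝ (y - graphPt e γ x) ((arcDensity γ x)⁻¹ • graphNormal e γ x) =
        (arcDensity γ x)⁻¹ * (deriv γ x * (e y 0 - x) - (e y 1 - γ x)) := by
      rw [inner_smul_right, inner_graphNormal, map_sub, PiLp.sub_apply, PiLp.sub_apply, graphPt_zero,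
        graphPt_one]
    have h5 : ε * |e y 0 - x| ≤ ε * ‖y - graphPt e γ x‖ := by gcongr
    have h6 : ε * ‖y - graphPt e γ x‖ ≤ arcDensity γ x * (ε * ‖y - graphPt e γ x‖) :=
      le_mul_of_one_le_left (by positivity) (one_le_arcDensity γ x)
    have h7 := abs_le.1 hy
    rw [h4, h.mem_iff y hyU, not_lt]
    constructor
    · intro h8
      rw [inv_mul_eq_div, lt_div_iff₀ hJ] at h8
      linarith
    · intro h8
      rw [inv_mul_eq_div, div_lt_iff₀ hJ] at h8
      linarith

/-! ### The divergence theorem -/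

/-- The divergence of a field. -/
def vdiv (H : Plane → Plane) (x : Plane) : ℝ := ∑ j, pderiv j (fun y => H y j) x

lemma exists_cutoff {k U : Set Plane} (hk : IsCompact k) (hU : IsOpen U) (hkU : k ⊆ U) :
    ∃ χ : Plane → ℝ, ContDiff ℝ ∞ χ ∧ HasCompactSupport χ ∧ tsupport χ ⊆ U ∧ (∀ᶠ x in 𝓝ˢ k, χ x = 1) ∧
      ∀ x, χ x ∈ Icc 0 1 := by
  obtain ⟨k', hk', hkk', hk'U⟩ := exists_compact_between hk hU hkU
  obtain ⟨f, h1, h0, hf⟩ := exists_contMDiffMap_one_nhds_of_subset_interior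
    (modelWithCornersSelf ℝ Plane) (n := ⊤) hk.isClosed hkk'
  have hs : tsupport f ⊆ k' :=
    closure_minimal (fun x hx => by_contra fun h => hx (h0 x h)) hk'.isClosed
  exact ⟨f, f.contMDiff.contDiff, hk'.of_isClosed_subset (isClosed_tsupport _) hs, hs.trans hk'U, h1, hf⟩

lemma hasCompactSupport_comp_graphPt (e : Plane ≃ₗᵢ[ℝ] Plane) (γ : ℝ → ℝ) {E : Type*} [Zero E]
    {G : Plane → E} (hGc : HasCompactSupport G) : HasCompactSupport fun x => G (graphPt e γ x) := by
  obtain ⟨R, hR⟩ := hGc.isCompact.isBounded.subset_closedBall 0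
  refine HasCompactSupport.of_support_subset_isCompact (K := Icc (-R) R) isCompact_Icc fun x hx => ?_
  have h1 := hR (subset_tsupport _ hx)
  rw [Metric.mem_closedBall, dist_zero_right, ← e.norm_map] at h1
  have h2 := PiLp.norm_apply_le (e (graphPt e γ x)) 0
  rw [graphPt_zero, Real.norm_eq_abs] at h2
  exact abs_le.1 (h2.trans h1)

lemma integrable_comp_graphPt (e : Plane ≃ₗᵢ[ℝ] Plane) {γ : ℝ → ℝ} (hγ : Continuous γ) {G : Plane → ℝ}
    (hG : Continuous G) (hGc : HasCompactSupport G) : Integrable fun x => G (graphPt e γ x) :=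
  (hG.comp (continuous_graphPt e hγ)).integrable_of_hasCompactSupport
    (hasCompactSupport_comp_graphPt e γ hGc)

lemma contDiff_smul_of_tsupport_subset {E : Type*} [NormedAddCommGroup E] [NormedSpace ℝ E]
    {n : WithTop ℕ∞} {Ω : Set Plane} (hΩ : IsOpen Ω) {ζ : Plane → ℝ} (hζ : ContDiff ℝ n ζ)
    (hs : tsupport ζ ⊆ Ω) {f : Plane → E} (hf : ContDiffOn ℝ n f Ω) : ContDiff ℝ n fun y => ζ y • f y := by
  rw [contDiff_iff_contDiffAt]
  intro y
  by_cases hy : y ∈ tsupport ζ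
  · exact hζ.contDiffAt.smul (hf.contDiffAt (hΩ.mem_nhds (hs hy)))
  · have : (fun y => ζ y • f y) =ᶠ[𝓝 y] fun _ => 0 := by
      filter_upwards [(isClosed_tsupport ζ).isOpen_compl.mem_nhds hy] with z hz
      rw [image_eq_zero_of_notMem_tsupport hz, zero_smul]
    exact contDiffAt_const.congr_of_eventuallyEq this

lemma pderiv_congr {f g : Plane → ℝ} {y : Plane} (h : f =ᶠ[𝓝 y] g) (j : Fin 2) :
    pderiv j f y = pderiv j g y := by rw [pderiv, pderiv, h.fderiv_eq]

lemma vdiv_congr {F H : Plane → Plane} {y : Plane} (h : F =ᶠ[𝓝 y] H) : vdiv F y = vdiv H y :=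
  Finset.sum_congr rfl fun j _ => pderiv_congr (h.mono fun z hz => by simp only [hz]) j

lemma integrable_pderiv {G : Plane → ℝ} (hG : ContDiff ℝ 1 G) (hGc : HasCompactSupport G) (j : Fin 2) :
    Integrable (pderiv j G) :=
  ((hG.continuous_fderiv one_ne_zero).clm_apply continuous_const).integrable_of_hasCompactSupport
    (hGc.fderiv_apply ℝ _)

lemma integral_pderiv_eq_zero {G : Plane → ℝ} (hG : ContDiff ℝ 1 G) (hGc : HasCompactSupport G)
    (j : Fin 2) : ∫ x, pderiv j G x = 0 := by
  have := integral_mul_fderiv_eq_neg_fderiv_mul_of_integrable (μ := volume) (f := fun _ : Plane => (1 : ℝ))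
    (g := G) (v := EuclideanSpace.single j 1) (by simp)
    (by simpa using! integrable_pderiv hG hGc j)
    (by simpa using hG.continuous.integrable_of_hasCompactSupport hGc)
    (fun _ _ => differentiableAt_const _) (fun _ _ => hG.differentiable one_ne_zero _)
  simpa using! this

section chart

variable {Ω U : Set Plane} {e : Plane ≃ₗᵢ[ℝ] Plane} {K : ℝ≥0} {γ : ℝ → ℝ} {H : Plane → Plane} {k : Set Plane}

/-- The raised graph lies inside `Ω` wherever it meets `k`, so a cutoff replaces `H`, which is `C¹`
only in `Ω`, by a field that is `C¹` on the whole plane and equal to `H` on and above the raised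
graph. The continuity is recorded for the limit `t → 0`. -/
lemma IsGraphChart.shift (hΩ : IsOpen Ω) (h : IsGraphChart Ω U e K γ) (hk : IsCompact k) (hkU : k ⊆ U)
    (hH0 : ∀ y ∉ k, H y = 0) (hH1 : ContDiffOn ℝ 1 H Ω) {t : ℝ} (ht : 0 < t) :
    (∫ y in epigraph e (fun x => γ x + t), vdiv H y =
      ∫ x, inner ℝ (H (graphPt e (fun x => γ x + t) x)) (graphNormal e γ x)) ∧
    Continuous fun x => H (graphPt e (fun x => γ x + t) x) := by
  have hγ := h.lipschitz.continuous
  have hγt : LipschitzWith K fun x => γ x + t := by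
    refine LipschitzWith.of_dist_le_mul fun x y => ?_
    simpa using h.lipschitz.dist_le_mul x y
  set S : Set Plane := {y | γ (e y 0) + t ≤ e y 1} with hS
  have hSc : IsClosed S := isClosed_le (by fun_prop) (by fun_prop)
  have hkS : k ∩ S ⊆ U ∩ Ω := fun y hy => ⟨hkU hy.1, (h.mem_iff y (hkU hy.1)).2 (by
    have := hy.2
    rw [hS, mem_ofPred_eq] at this
    linarith)⟩
  obtain ⟨ζ, hζ, hζc, hζU, hζ1, -⟩ := exists_cutoff (hk.inter_right hSc) (h.isOpen.inter hΩ) hkS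
  have hζ1' : ∀ y ∈ k ∩ S, ζ y = 1 := fun y hy => hζ1.self_of_nhdsSet y hy
  have hHS : ∀ y ∈ S, ζ y • H y = H y := fun y hy => by
    by_cases hyk : y ∈ k
    · rw [hζ1' y ⟨hyk, hy⟩, one_smul]
    · rw [hH0 y hyk, smul_zero]
  have hG : ContDiff ℝ 1 fun y => ζ y • H y :=
    contDiff_smul_of_tsupport_subset hΩ (hζ.of_le (by simp)) (hζU.trans inter_subset_right) hH1
  have hGj : ∀ j : Fin 2, ContDiff ℝ 1 fun y => (ζ y • H y) j := fun j =>
    contDiff_euclidean.1 hG j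
  have hGc : ∀ j : Fin 2, HasCompactSupport fun y => (ζ y • H y) j := fun j =>
    hζc.mono fun y hy => by
      simp only [PiLp.smul_apply, smul_eq_mul, Function.mem_support] at hy
      exact left_ne_zero_of_mul hy
  have hgS : ∀ x, graphPt e (fun x => γ x + t) x ∈ S := fun x => by
    simp [hS, graphPt_zero, graphPt_one]
  have hPc := continuous_graphPt e hγt.continuous
  constructor
  · have h1 : ∀ y ∈ epigraph e (fun x => γ x + t), vdiv H y =
        ∑ j, fderiv ℝ (fun y => (ζ y • H y) j) y (EuclideanSpace.single j 1) := fun y hy => by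
      refine vdiv_congr (H := fun y => ζ y • H y) ?_
      filter_upwards [(isOpen_epigraph e hγt.continuous).mem_nhds hy] with z hz
      exact (hHS z (show γ (e z 0) + t ≤ e z 1 from le_of_lt hz)).symm
    rw [setIntegral_congr_fun (isOpen_epigraph e hγt.continuous).measurableSet h1, integral_finsetSum]
    · simp only [inner_eq_sum_graphNormal]
      rw [integral_finsetSum]
      · refine Finset.sum_congr rfl fun j _ => ?_
        rw [integral_epigraph_fderiv e hγt (hGj j) (hGc j)]
        simp only [hHS _ (hgS _), graphNormal_apply, deriv_add_const]
      · intro j _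
        have hi : Integrable fun x => H (graphPt e (fun x => γ x + t) x) j := by
          have := integrable_comp_graphPt e hγt.continuous (hGj j).continuous (hGc j)
          simpa only [hHS _ (hgS _)] using this
        refine hi.mul_bdd (c := 1 + K) ?_ (Eventually.of_forall fun x => ?_)
        · have := measurable_graphNormal e γ
          exact (EuclideanSpace.proj (𝕜 := ℝ) j).continuous.measurable.comp this |>.aestronglyMeasurable
        · exact (PiLp.norm_apply_le _ j).trans (norm_graphNormal_le e h.lipschitz x)
    · intro j _
      exact (integrable_pderiv (hGj j) (hGc j) j).integrableOn
  · have := hG.continuous.comp hPc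
    simpa only [Function.comp_def, hHS _ (hgS _)] using this

lemma IsGraphChart.indicator_eq (h : IsGraphChart Ω U e K γ) (hkU : k ⊆ U) {f : Plane → ℝ}
    (hf : ∀ y ∉ k, f y = 0) : (epigraph e γ).indicator f = Ω.indicator f := by
  ext y
  by_cases hy : y ∈ k
  · have := h.mem_iff y (hkU hy)
    by_cases hy' : y ∈ Ω
    · rw [indicator_of_mem hy', indicator_of_mem (show y ∈ epigraph e γ from this.1 hy')]
    · rw [indicator_of_notMem hy', indicator_of_notMem (show y ∉ epigraph e γ from fun h => hy' (this.2 h))]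
  · simp [indicator, hf y hy]

lemma vdiv_eq_zero_of_notMem (hk : IsClosed k) (hH0 : ∀ y ∉ k, H y = 0) : ∀ y ∉ k, vdiv H y = 0 := by
  intro y hy
  have : H =ᶠ[𝓝 y] fun _ => 0 := by
    filter_upwards [hk.isOpen_compl.mem_nhds hy] with z hz using hH0 z hz
  rw [vdiv_congr this]
  simp [vdiv, pderiv]

/-- The divergence theorem inside a graph chart, with the boundary integral in parametrised form. -/
theorem IsGraphChart.integral_vdiv (hΩ : IsOpen Ω) (h : IsGraphChart Ω U e K γ) (hk : IsCompact k)
    (hkU : k ⊆ U) (hH0 : ∀ y ∉ k, H y = 0) (hHc : ContinuousOn H (closure Ω)) (hH1 : ContDiffOn ℝ 1 H Ω)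
    (hint : IntegrableOn (vdiv H) Ω) :
    ∫ y in Ω, vdiv H y = ∫ x, inner ℝ (H (graphPt e γ x)) (graphNormal e γ x) := by
  have hγ := h.lipschitz.continuous
  have hme : MeasurableSet (epigraph e γ) := (isOpen_epigraph e hγ).measurableSet
  have hind := h.indicator_eq hkU (vdiv_eq_zero_of_notMem hk.isClosed hH0)
  have hint' : IntegrableOn (vdiv H) (epigraph e γ) := by
    rw [← integrable_indicator_iff hme, hind, integrable_indicator_iff hΩ.measurableSet]
    exact hint
  have heq : ∫ y in Ω, vdiv H y = ∫ y in epigraph e γ, vdiv H y := by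
    rw [← integral_indicator hΩ.measurableSet, ← hind, integral_indicator hme]
  rw [heq]
  set t : ℕ → ℝ := fun n => 1 / ((n : ℝ) + 1) with ht
  have ht0 : ∀ n, 0 < t n := fun n => Nat.one_div_pos_of_nat
  have htl : Tendsto t atTop (𝓝[>] 0) :=
    tendsto_nhdsWithin_iff.2 ⟨tendsto_one_div_add_atTop_nhds_zero_nat, Eventually.of_forall ht0⟩
  have hU : epigraph e γ = ⋃ n, epigraph e (fun x => γ x + t n) := by
    ext y
    simp only [epigraph, mem_iUnion, mem_ofPred_eq]
    constructor
    · intro hy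
      obtain ⟨n, hn⟩ := ((htl.mono_right nhdsWithin_le_nhds).eventually
        (eventually_lt_nhds (sub_pos.2 hy))).exists
      exact ⟨n, by linarith⟩
    · rintro ⟨n, hn⟩
      linarith [ht0 n]
  -- The raised epigraphs exhaust the epigraph monotonically; integrability of the divergence
  -- suffices here, and no bound on it near the boundary is used.
  have hlim1 : Tendsto (fun n => ∫ y in epigraph e (fun x => γ x + t n), vdiv H y) atTop
      (𝓝 (∫ y in epigraph e γ, vdiv H y)) := by
    rw [hU] at hint' ⊢
    refine tendsto_setIntegral_of_monotone
      (fun n => (isOpen_epigraph e (by fun_prop)).measurableSet) (fun m n hmn y hy => ?_) hint'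
    simp only [epigraph, mem_ofPred_eq] at hy ⊢
    have : t n ≤ t m := Nat.one_div_le_one_div hmn
    linarith
  refine tendsto_nhds_unique hlim1 ?_
  simp only [fun n => (h.shift hΩ hk hkU hH0 hH1 (ht0 n)).1]
  obtain ⟨M, hM⟩ := (hk.inter_right isClosed_closure).exists_bound_of_continuousOn
    (hHc.mono (inter_subset_right (s := k)))
  obtain ⟨R, hR⟩ := hk.isBounded.subset_closedBall 0
  -- Domination for the boundary integrals: `H` is bounded on the compact set `k ∩ closure Ω` and
  -- vanishes off `k`.
  have hb : ∀ n x, ‖H (graphPt e (fun x => γ x + t n) x)‖ ≤ (Icc (-R) R).indicator (fun _ => |M|) x := by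
    intro n x
    by_cases hx : graphPt e (fun x => γ x + t n) x ∈ k
    · have h1 := hR hx
      rw [Metric.mem_closedBall, dist_zero_right, ← e.norm_map] at h1
      have h2 := PiLp.norm_apply_le (e (graphPt e (fun x => γ x + t n) x)) 0
      rw [graphPt_zero, Real.norm_eq_abs] at h2
      rw [indicator_of_mem (show x ∈ Icc (-R) R from abs_le.1 (h2.trans h1))]
      refine (hM _ ⟨hx, subset_closure ((h.mem_iff _ (hkU hx)).2 ?_)⟩).trans (le_abs_self M)
      rw [graphPt_zero, graphPt_one]
      linarith [ht0 n]
    · rw [hH0 _ hx, norm_zero]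
      exact indicator_nonneg (fun _ _ => abs_nonneg M) x
  refine tendsto_integral_of_dominated_convergence
    (fun x => (Icc (-R) R).indicator (fun _ => |M|) x * (1 + K)) (fun n => ?_) ?_ (fun n => ?_) ?_
  · have h1 := (h.shift hΩ hk hkU hH0 hH1 (ht0 n)).2
    exact (h1.measurable.inner (measurable_graphNormal e γ)).aestronglyMeasurable
  · refine Integrable.mul_const ?_ _
    rw [integrable_indicator_iff measurableSet_Icc]
    exact integrableOn_const (by simp)
  · refine Eventually.of_forall fun x => (norm_inner_le_norm _ _).trans ?_
    exact mul_le_mul (hb n x) (norm_graphNormal_le e h.lipschitz x) (norm_nonneg _) ((norm_nonneg _).trans (hb n x))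
  · refine Eventually.of_forall fun x => Tendsto.inner ?_ tendsto_const_nhds
    have hP : Tendsto (fun n => graphPt e (fun x => γ x + t n) x) atTop (𝓝 (graphPt e γ x)) :=
      (tendsto_graphPt_add e γ x).comp (htl.mono_right nhdsWithin_le_nhds)
    by_cases hx : graphPt e γ x ∈ k
    · have h1 := hHc _ (h.mem_closure (hkU hx))
      refine h1.tendsto.comp (tendsto_nhdsWithin_iff.2 ⟨hP, ?_⟩)
      exact (htl.eventually (h.graphPt_mem (hkU hx))).mono fun n hn => subset_closure hn
    · rw [hH0 _ hx]
      refine tendsto_const_nhds.congr' ?_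
      filter_upwards [hP.eventually (hk.isClosed.isOpen_compl.mem_nhds hx)] with n hn
      exact (hH0 _ hn).symm

/-- The divergence theorem inside a graph chart. -/
theorem IsGraphChart.integral_vdiv_eq_arcLength (hΩ : IsOpen Ω) (h : IsGraphChart Ω U e K γ)
    (hk : IsCompact k) (hkU : k ⊆ U) (hH0 : ∀ y ∉ k, H y = 0) (hHc : ContinuousOn H (closure Ω))
    (hH1 : ContDiffOn ℝ 1 H Ω) (hint : IntegrableOn (vdiv H) Ω) {b : Plane → ℝ} (hb0 : ∀ y ∉ k, b y = 0)
    (hb : ∀ x ∈ frontier Ω, ∀ ν, IsOuterNormal Ω x ν → inner ℝ (H x) ν = b x) :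
    ∫ y in Ω, vdiv H y = ∫ y, b y ∂(arcLength Ω) := by
  have hγ := h.lipschitz.continuous
  rw [h.integral_vdiv hΩ hk hkU hH0 hHc hH1 hint]
  have h1 : ∫ x, inner ℝ (H (graphPt e γ x)) (graphNormal e γ x) =
      ∫ x, arcDensity γ x * b (graphPt e γ x) := by
    refine integral_congr_ae ?_
    -- A normal exists at almost every parameter, so the boundary condition is needed only at such
    -- points. The density cancels the normalisation of the normal.
    filter_upwards [h.lipschitz.ae_differentiableAt] with x hx
    by_cases hxk : graphPt e γ x ∈ k
    · have hxU := hkU hxk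
      have hf : graphPt e γ x ∈ frontier Ω := by
        rw [h.mem_frontier_iff hΩ hxU, graphPt_zero, graphPt_one]
      rw [← hb _ hf _ (h.isOuterNormal hxU hx), inner_smul_right, ← mul_assoc, mul_inv_cancel₀, one_mul]
      linarith [one_le_arcDensity γ x]
    · rw [hH0 _ hxk, hb0 _ hxk, inner_zero_left, mul_zero]
  rw [h1, ← integral_graph e h.lipschitz, arcLength]
  have hm : MeasurableSet {y | e y 1 = γ (e y 0)} :=
    (isClosed_eq (by fun_prop) (by fun_prop)).measurableSet
  rw [← integral_indicator hm, ← integral_indicator isClosed_frontier.measurableSet]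
  congr 1
  ext y
  by_cases hy : y ∈ k
  · simp only [indicator, h.mem_frontier_iff hΩ (hkU hy), mem_ofPred_eq]
  · simp [indicator, hb0 y hy]

end chart

/-- The boundary is compact and locally contained in the Lipschitz image of a bounded interval. -/
lemma IsLipschitzDomain.isFiniteMeasure_arcLength {Ω : Set Plane} (hΩ : IsLipschitzDomain Ω) :
    IsFiniteMeasure (arcLength Ω) := by
  have hc : IsCompact (frontier Ω) :=
    Metric.isCompact_of_isClosed_isBounded isClosed_frontier
      (hΩ.isBounded.closure.subset frontier_subset_closure)
  rw [arcLength, isFiniteMeasure_restrict]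
  refine (hc.measure_lt_top_of_nhdsWithin fun x hx => ?_).ne
  obtain ⟨U, e, K, γ, hxU, h⟩ := hΩ.exists_chart hx
  obtain ⟨r, hr, hrU⟩ := Metric.isOpen_iff.1 h.isOpen x hxU
  refine ⟨frontier Ω ∩ Metric.ball x r, inter_mem_nhdsWithin _ (Metric.ball_mem_nhds x hr), ?_⟩
  have hsub : frontier Ω ∩ Metric.ball x r ⊆ graphPt e γ '' Metric.ball (e x 0) r := by
    rintro y ⟨hy, hyr⟩
    refine ⟨e y 0, ?_, graphPt_eq e ((h.mem_frontier_iff hΩ.isOpen (hrU hyr)).1 hy)⟩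
    rw [Metric.mem_ball, dist_eq_norm] at hyr ⊢
    have := PiLp.norm_apply_le (e (y - x)) 0
    rw [e.norm_map, map_sub, PiLp.sub_apply] at this
    exact this.trans_lt hyr
  refine (measure_mono hsub).trans_lt ?_
  have := (lipschitzWith_graphPt e h.lipschitz).hausdorffMeasure_image_le zero_le_one
    (Metric.ball (e x 0) r)
  rw [ENNReal.rpow_one, hausdorffMeasure_real] at this
  exact this.trans_lt (ENNReal.mul_lt_top (by simp) measure_ball_lt_top)

lemma pderiv_mul {f g : Plane → ℝ} {x : Plane} (hf : DifferentiableAt ℝ f x) (hg : DifferentiableAt ℝ g x)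
    (j : Fin 2) : pderiv j (fun y => f y * g y) x = f x * pderiv j g x + g x * pderiv j f x := by
  rw [pderiv, fderiv_fun_mul hf hg]
  rfl

lemma vdiv_smul {f : Plane → ℝ} {F : Plane → Plane} {x : Plane} (hf : DifferentiableAt ℝ f x)
    (hF : DifferentiableAt ℝ F x) :
    vdiv (fun y => f y • F y) x = f x * vdiv F x + ∑ j, F x j * pderiv j f x := by
  simp only [vdiv, PiLp.smul_apply, smul_eq_mul]
  rw [Finset.mul_sum, ← Finset.sum_add_distrib]
  exact Finset.sum_congr rfl fun j _ => pderiv_mul hf (by fun_prop) j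

/-- A property of smooth cutoff functions that is additive and holds for functions supported near any
given point of the compact set `k` holds for a cutoff function of `k`. -/
lemma exists_cutoff_of_local {k : Set Plane} (hk : IsCompact k) (P : (Plane → ℝ) → Prop) (h0 : P fun _ => 0)
    (hadd : ∀ f g, ContDiff ℝ ∞ f → HasCompactSupport f → ContDiff ℝ ∞ g → HasCompactSupport g →
      P f → P g → P (fun x => f x + g x))
    (hloc : ∀ x ∈ k, ∃ U, IsOpen U ∧ x ∈ U ∧ ∀ f, ContDiff ℝ ∞ f → HasCompactSupport f → tsupport f ⊆ U →
      P f) :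
    ∃ χ, ContDiff ℝ ∞ χ ∧ HasCompactSupport χ ∧ (∀ᶠ x in 𝓝ˢ k, χ x = 1) ∧ P χ := by
  have key : ∃ U, IsOpen U ∧ k ⊆ U ∧ ∀ f, ContDiff ℝ ∞ f → HasCompactSupport f → tsupport f ⊆ U → P f := by
    refine hk.induction_on (p := fun s => ∃ U, IsOpen U ∧ s ⊆ U ∧ ∀ f, ContDiff ℝ ∞ f →
      HasCompactSupport f → tsupport f ⊆ U → P f) ⟨∅, isOpen_empty, subset_rfl, fun f _ _ hf => ?_⟩ ?_ ?_ ?_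
    · have : f = fun _ => 0 := funext fun x => image_eq_zero_of_notMem_tsupport fun hx => hf hx
      rwa [this]
    · rintro s t hst ⟨U, hU, htU, h⟩
      exact ⟨U, hU, hst.trans htU, h⟩
    · rintro s t ⟨U, hU, hsU, hP⟩ ⟨V, hV, htV, hQ⟩
      refine ⟨U ∪ V, hU.union hV, union_subset_union hsU htV, fun f hf hfc hfUV => ?_⟩
      -- A two-set partition of unity: `θ` is one near `k₁`, so `θ * f` is supported in `U` and `(1
      -- - θ) * f` in `k₂ ⊆ V`.
      obtain ⟨k₁, k₂, hk₁, hk₂, h1, h2, h12⟩ := hfc.isCompact.binary_compact_cover hU hV hfUV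
      obtain ⟨θ, hθ, hθc, hθU, hθ1, -⟩ := exists_cutoff hk₁ hU h1
      have hsum : f = fun x => θ x * f x + (1 - θ x) * f x := by ext x; ring
      rw [hsum]
      refine hadd _ _ (hθ.mul hf) hθc.mul_right ((contDiff_const.sub hθ).mul hf) hfc.mul_left
        (hP _ (hθ.mul hf) hθc.mul_right ((closure_mono (Function.support_mul_subset_left _ _)).trans hθU))
        (hQ _ ((contDiff_const.sub hθ).mul hf) hfc.mul_left fun x hx => h2 ?_)
      have hxf : x ∈ tsupport f := closure_mono (Function.support_mul_subset_right _ _) hx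
      rw [h12] at hxf
      refine hxf.resolve_left fun hx1 => ?_
      refine (notMem_tsupport_iff_eventuallyEq.2 ?_) hx
      filter_upwards [(eventually_nhdsSet_iff_forall.1 hθ1) x hx1] with y hy
      simp [hy]
    · intro x hx
      obtain ⟨U, hU, hxU, hP⟩ := hloc x hx
      exact ⟨U, mem_nhdsWithin_of_mem_nhds (hU.mem_nhds hxU), U, hU, subset_rfl, hP⟩
  obtain ⟨U, hU, hkU, hP⟩ := key
  obtain ⟨χ, h1, h2, h3, h4, -⟩ := exists_cutoff hk hU hkU
  exact ⟨χ, h1, h2, h4, hP χ h1 h2 h3⟩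

lemma IsLipschitzDomain.isCompact_closure {Ω : Set Plane} (hΩ : IsLipschitzDomain Ω) :
    IsCompact (closure Ω) :=
  hΩ.isBounded.isCompact_closure

lemma ContDiff.continuous_pderiv {f : Plane → ℝ} (hf : ContDiff ℝ 1 f) (j : Fin 2) :
    Continuous (pderiv j f) :=
  (hf.continuous_fderiv one_ne_zero).clm_apply continuous_const

lemma IsLipschitzDomain.integrableOn_of_continuousOn {Ω : Set Plane} (hΩ : IsLipschitzDomain Ω)
    {f : Plane → ℝ} (hf : ContinuousOn f (closure Ω)) : IntegrableOn f Ω :=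
  (hf.integrableOn_compact hΩ.isCompact_closure).mono_set subset_closure

lemma IsLipschitzDomain.integrableOn_vdiv_smul {Ω : Set Plane} (hΩ : IsLipschitzDomain Ω)
    {F : Plane → Plane} (hFc : ContinuousOn F (closure Ω)) (hF1 : ContDiffOn ℝ 1 F Ω)
    (hint : IntegrableOn (vdiv F) Ω) {f : Plane → ℝ} (hf : ContDiff ℝ 1 f) (hfc : HasCompactSupport f) :
    IntegrableOn (vdiv fun y => f y • F y) Ω := by
  obtain ⟨C, hC⟩ := hfc.exists_bound_of_continuous hf.continuous
  have h1 : IntegrableOn (fun x => f x * vdiv F x + ∑ j, F x j * pderiv j f x) Ω := by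
    refine Integrable.add (hint.bdd_mul hf.continuous.aestronglyMeasurable (Eventually.of_forall hC)) ?_
    refine integrable_finsetSum _ fun j _ => hΩ.integrableOn_of_continuousOn ?_
    have := ContDiff.continuous_pderiv hf j
    fun_prop
  refine h1.congr_fun (fun x hx => ?_) hΩ.isOpen.measurableSet
  exact (vdiv_smul (hf.differentiable one_ne_zero _)
    ((hF1.differentiableOn one_ne_zero).differentiableAt (hΩ.isOpen.mem_nhds hx))).symm

lemma pderiv_add {f g : Plane → ℝ} {x : Plane} (hf : DifferentiableAt ℝ f x) (hg : DifferentiableAt ℝ g x)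
    (j : Fin 2) : pderiv j (fun y => f y + g y) x = pderiv j f x + pderiv j g x := by
  rw [pderiv, fderiv_fun_add hf hg]
  rfl

/-- **Divergence theorem** on a bounded Lipschitz domain, for fields that are continuous up to the
boundary, of class `C¹` inside, and have an integrable divergence. -/
theorem IsLipschitzDomain.integral_vdiv {Ω : Set Plane} (hΩ : IsLipschitzDomain Ω)
    {F : Plane → Plane} (hFc : ContinuousOn F (closure Ω)) (hF1 : ContDiffOn ℝ 1 F Ω)
    (hint : IntegrableOn (vdiv F) Ω) {b : Plane → ℝ} (hbi : Integrable b (arcLength Ω))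
    (hb : ∀ x ∈ frontier Ω, ∀ ν, IsOuterNormal Ω x ν → inner ℝ (F x) ν = b x) :
    ∫ y in Ω, vdiv F y = ∫ y, b y ∂(arcLength Ω) := by
  have hsm : ∀ {f : Plane → ℝ}, ContDiff ℝ ∞ f → ContDiff ℝ 1 f := fun h => h.of_le (by simp)
  have hFd : ∀ y ∈ Ω, DifferentiableAt ℝ F y := fun y hy =>
    (hF1.differentiableOn one_ne_zero).differentiableAt (hΩ.isOpen.mem_nhds hy)
  have hbint : ∀ f : Plane → ℝ, ContDiff ℝ ∞ f → HasCompactSupport f →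
      Integrable (fun y => f y * b y) (arcLength Ω) := fun f hf hfc => by
    obtain ⟨C, hC⟩ := hfc.exists_bound_of_continuous hf.continuous
    exact hbi.bdd_mul hf.continuous.aestronglyMeasurable (Eventually.of_forall hC)
  have key : ∃ χ : Plane → ℝ, ContDiff ℝ ∞ χ ∧ HasCompactSupport χ ∧ (∀ᶠ x in 𝓝ˢ (closure Ω), χ x = 1) ∧
      ∫ y in Ω, vdiv (fun z => χ z • F z) y = ∫ y, χ y * b y ∂(arcLength Ω) := by
    refine exists_cutoff_of_local hΩ.isCompact_closure
      (fun f => ∫ y in Ω, vdiv (fun z => f z • F z) y = ∫ y, f y * b y ∂(arcLength Ω))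
      (by simp [vdiv, pderiv]) (fun f g hf hfc hg hgc h1 h2 => ?_) (fun x hx => ?_)
    · have h3 : ∀ y ∈ Ω, vdiv (fun z => (f z + g z) • F z) y =
          vdiv (fun z => f z • F z) y + vdiv (fun z => g z • F z) y := fun y hy => by
        have hfd := (hsm hf).differentiable one_ne_zero y
        have hgd := (hsm hg).differentiable one_ne_zero y
        rw [vdiv_smul (f := fun z => f z + g z) (hfd.add hgd) (hFd y hy), vdiv_smul hfd (hFd y hy), vdiv_smul hgd (hFd y hy)]
        simp only [pderiv_add hfd hgd, mul_add, Finset.sum_add_distrib]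
        ring
      rw [setIntegral_congr_fun hΩ.isOpen.measurableSet h3,
        integral_add (hΩ.integrableOn_vdiv_smul hFc hF1 hint (hsm hf) hfc)
          (hΩ.integrableOn_vdiv_smul hFc hF1 hint (hsm hg) hgc), h1, h2,
        ← integral_add (hbint f hf hfc) (hbint g hg hgc)]
      simp only [add_mul]
    · by_cases hxΩ : x ∈ Ω
      · refine ⟨Ω, hΩ.isOpen, hxΩ, fun f hf hfc hfΩ => ?_⟩
        -- For interior cutoffs both sides vanish: `f • F` is `C¹` with compact support in the
        -- plane, and `f` is zero on the boundary.
        have hC := contDiff_smul_of_tsupport_subset hΩ.isOpen (hsm hf) hfΩ hF1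
        have hr : ∫ y, f y * b y ∂(arcLength Ω) = 0 := by
          refine setIntegral_eq_zero_of_forall_eq_zero fun y hy => ?_
          have : y ∉ tsupport f := fun h => by
            rw [hΩ.isOpen.frontier_eq] at hy
            exact hy.2 (hfΩ h)
          rw [image_eq_zero_of_notMem_tsupport this, zero_mul]
        have hz : ∀ y ∉ Ω, vdiv (fun z => f z • F z) y = 0 := fun y hy => by
          refine vdiv_eq_zero_of_notMem (k := tsupport f) (isClosed_tsupport f) (fun z hz => ?_) y
            fun h => hy (hfΩ h)
          rw [image_eq_zero_of_notMem_tsupport hz, zero_smul]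
        have hCj : ∀ j : Fin 2, ContDiff ℝ 1 fun y => (f y • F y) j := fun j => contDiff_euclidean.1 hC j
        have hcj : ∀ j : Fin 2, HasCompactSupport fun y => (f y • F y) j := fun j =>
          hfc.mono fun y hy => by
            simp only [PiLp.smul_apply, smul_eq_mul, Function.mem_support] at hy
            exact left_ne_zero_of_mul hy
        rw [hr, setIntegral_eq_integral_of_forall_compl_eq_zero hz]
        simp only [vdiv]
        rw [integral_finsetSum _ fun j _ => integrable_pderiv (hCj j) (hcj j) j]
        exact Finset.sum_eq_zero fun j _ => integral_pderiv_eq_zero (hCj j) (hcj j) j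
      · have hxf : x ∈ frontier Ω := by
          rw [hΩ.isOpen.frontier_eq]
          exact ⟨hx, hxΩ⟩
        obtain ⟨U, e, K, γ, hxU, h⟩ := hΩ.exists_chart hxf
        refine ⟨U, h.isOpen, hxU, fun f hf hfc hfU => ?_⟩
        refine h.integral_vdiv_eq_arcLength (H := fun z => f z • F z) hΩ.isOpen hfc.isCompact hfU (fun y hy => ?_)
          (hf.continuous.continuousOn.smul hFc) ((hsm hf).contDiffOn.smul hF1)
          (hΩ.integrableOn_vdiv_smul hFc hF1 hint (hsm hf) hfc) (fun y hy => ?_) fun y hy ν hν => ?_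
        · rw [image_eq_zero_of_notMem_tsupport hy, zero_smul]
        · rw [image_eq_zero_of_notMem_tsupport hy, zero_mul]
        · rw [inner_smul_left, hb y hy ν hν]
          rfl
  obtain ⟨χ, hχ, hχc, hχ1, hP⟩ := key
  have h1 : ∫ y in Ω, vdiv F y = ∫ y in Ω, vdiv (fun z => χ z • F z) y := by
    refine setIntegral_congr_fun hΩ.isOpen.measurableSet fun y hy => vdiv_congr ?_
    filter_upwards [(eventually_nhdsSet_iff_forall.1 hχ1) y (subset_closure hy)] with z hz
    rw [hz, one_smul]
  rw [h1, hP]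
  refine setIntegral_congr_fun isClosed_frontier.measurableSet fun y hy => ?_
  simp only [hχ1.self_of_nhdsSet y (frontier_subset_closure hy), one_mul]

/-! ### The class `C¹(Ω̄)` -/

section C1Closure

variable {F : Type*} [NormedAddCommGroup F] [NormedSpace ℝ F] {Ω : Set Plane} {f : Plane → F}

lemma IsC1Closure.differentiableAt (hΩ : IsOpen Ω) (hf : IsC1Closure Ω f) {x : Plane} (hx : x ∈ Ω) :
    DifferentiableAt ℝ f x :=
  (hf.contDiffOn.differentiableOn one_ne_zero).differentiableAt (hΩ.mem_nhds hx)

lemma IsC1Closure.continuousOn_fderiv (hΩ : IsOpen Ω) (hf : IsC1Closure Ω f) :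
    ContinuousOn (fderiv ℝ f) Ω :=
  hf.contDiffOn.continuousOn_fderiv_of_isOpen hΩ le_rfl

lemma IsC1Closure.continuousOn_extendFrom (hΩ : IsOpen Ω) (hf : IsC1Closure Ω f) :
    ContinuousOn (extendFrom Ω (fderiv ℝ f)) (closure Ω) := by
  refine _root_.continuousOn_extendFrom subset_rfl fun x hx => ?_
  by_cases hxΩ : x ∈ Ω
  · exact ⟨_, hf.continuousOn_fderiv hΩ x hxΩ⟩
  · exact hf.extends_fderiv x (by rw [hΩ.frontier_eq]; exact ⟨hx, hxΩ⟩)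

lemma IsC1Closure.extendFrom_eq (hΩ : IsOpen Ω) (hf : IsC1Closure Ω f) {x : Plane} (hx : x ∈ Ω) :
    extendFrom Ω (fderiv ℝ f) x = fderiv ℝ f x :=
  extendFrom_extends (hf.continuousOn_fderiv hΩ) x hx

lemma IsC1Closure.comp_clm {F' : Type*} [NormedAddCommGroup F'] [NormedSpace ℝ F'] (hΩ : IsOpen Ω)
    (hf : IsC1Closure Ω f) (L : F →L[ℝ] F') : IsC1Closure Ω fun x => L (f x) := by
  refine ⟨L.continuous.comp_continuousOn hf.continuousOn, L.contDiff.comp_contDiffOn hf.contDiffOn,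
    fun x hx => ?_⟩
  obtain ⟨M, hM⟩ := hf.extends_fderiv x hx
  refine ⟨L.comp M, ?_⟩
  have h1 : Tendsto (fun y => L.comp (fderiv ℝ f y)) (𝓝[Ω] x) (𝓝 (L.comp M)) :=
    ((ContinuousLinearMap.compL ℝ Plane F F' L).continuous.tendsto M).comp hM
  refine h1.congr' ?_
  filter_upwards [self_mem_nhdsWithin] with y hy
  exact (L.hasFDerivAt.comp y (hf.differentiableAt hΩ hy).hasFDerivAt).fderiv.symm

lemma IsC1Closure.sub_const (hf : IsC1Closure Ω f) (c : F) : IsC1Closure Ω fun x => f x - c := by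
  refine ⟨hf.continuousOn.sub continuousOn_const, hf.contDiffOn.sub contDiffOn_const, fun x hx => ?_⟩
  obtain ⟨M, hM⟩ := hf.extends_fderiv x hx
  refine ⟨M, ?_⟩
  have : (fderiv ℝ fun x => f x - c) = fderiv ℝ f := funext fun x => fderiv_sub_const c
  rwa [this]

lemma isC1Closure_of_contDiff (Ω : Set Plane) (hf : ContDiff ℝ 1 f) : IsC1Closure Ω f :=
  ⟨hf.continuous.continuousOn, hf.contDiffOn, fun x _ =>
    ⟨_, ((hf.continuous_fderiv one_ne_zero).tendsto x).mono_left nhdsWithin_le_nhds⟩⟩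

end C1Closure

lemma IsC1Closure.apply {Ω : Set Plane} (hΩ : IsOpen Ω) {u : Plane → Plane} (hu : IsC1Closure Ω u)
    (i : Fin 2) : IsC1Closure Ω fun x => u x i :=
  hu.comp_clm hΩ (EuclideanSpace.proj i)

lemma pderiv_apply {u : Plane → Plane} {x : Plane} (hu : DifferentiableAt ℝ u x) (i j : Fin 2) :
    pderiv j (fun y => u y i) x = fderiv ℝ u x (EuclideanSpace.single j 1) i := by
  have := ((EuclideanSpace.proj (𝕜 := ℝ) i).hasFDerivAt.comp x hu.hasFDerivAt).fderiv
  rw [Function.comp_def] at this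
  exact congrArg (fun L => L (EuclideanSpace.single j 1)) this

lemma IsLipschitzDomain.memLp_of_continuousOn {Ω : Set Plane} (hΩ : IsLipschitzDomain Ω)
    {f : Plane → ℝ} (hf : ContinuousOn f (closure Ω)) (p : ℝ≥0∞) : MemLp f p (volume.restrict Ω) := by
  obtain ⟨C, hC⟩ := hΩ.isCompact_closure.exists_bound_of_continuousOn hf
  have : IsFiniteMeasure (volume.restrict Ω) := by
    rw [isFiniteMeasure_restrict]
    exact hΩ.isBounded.measure_lt_top.ne
  refine MemLp.of_bound ?_ C ?_
  · exact (hf.mono subset_closure).aestronglyMeasurable hΩ.isOpen.measurableSet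
  · exact (ae_restrict_mem hΩ.isOpen.measurableSet).mono fun x hx => hC x (subset_closure hx)

lemma IsLipschitzDomain.memLp_pderiv {Ω : Set Plane} (hΩ : IsLipschitzDomain Ω)
    {f : Plane → ℝ} (hf : IsC1Closure Ω f) (p : ℝ≥0∞) (j : Fin 2) :
    MemLp (pderiv j f) p (volume.restrict Ω) := by
  have h : ContinuousOn (fun x => extendFrom Ω (fderiv ℝ f) x (EuclideanSpace.single j 1)) (closure Ω) :=
    (hf.continuousOn_extendFrom hΩ.isOpen).clm_apply continuousOn_const
  refine (hΩ.memLp_of_continuousOn h p).ae_eq ?_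
  filter_upwards [ae_restrict_mem hΩ.isOpen.measurableSet] with x hx
  rw [hf.extendFrom_eq hΩ.isOpen hx, pderiv]

lemma IsLipschitzDomain.isCompact_frontier {Ω : Set Plane} (hΩ : IsLipschitzDomain Ω) :
    IsCompact (frontier Ω) :=
  hΩ.isCompact_closure.of_isClosed_subset isClosed_frontier frontier_subset_closure

lemma IsLipschitzDomain.memLp_arcLength {Ω : Set Plane} (hΩ : IsLipschitzDomain Ω) {f : Plane → ℝ}
    (hf : ContinuousOn f (frontier Ω)) (p : ℝ≥0∞) : MemLp f p (arcLength Ω) := by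
  have hfin := hΩ.isFiniteMeasure_arcLength
  obtain ⟨C, hC⟩ := hΩ.isCompact_frontier.exists_bound_of_continuousOn hf
  refine MemLp.of_bound (hf.aestronglyMeasurable isClosed_frontier.measurableSet) C ?_
  exact (ae_restrict_mem isClosed_frontier.measurableSet).mono hC

lemma integrable_mul_of_memLp_two {X : Type*} [MeasurableSpace X] {μ : Measure X} {f g : X → ℝ}
    (hf : MemLp f 2 μ) (hg : MemLp g 2 μ) : Integrable (fun x => f x * g x) μ :=
  hf.integrable_mul hg

/-! ### Weak derivatives -/

section weak

variable {Ω : Set Plane} {j : Fin 2} {f g h k : Plane → ℝ}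

lemma setIntegral_eq_integral_of_tsupport_subset {φ f : Plane → ℝ} (hφ : tsupport φ ⊆ Ω)
    (hf : ∀ x, φ x = 0 → f x = 0) : ∫ x in Ω, f x = ∫ x, f x :=
  setIntegral_eq_integral_of_forall_compl_eq_zero fun x hx =>
    hf x (image_eq_zero_of_notMem_tsupport fun h => hx (hφ h))

/-- The product with a test function extends by zero to a compactly supported `C¹` function on the
plane, whose derivative has integral zero. Boundary regularity plays no part. -/
lemma hasWeakPDeriv_pderiv (hΩ : IsLipschitzDomain Ω) (hf : IsC1Closure Ω f) (j : Fin 2) :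
    HasWeakPDeriv Ω j f (pderiv j f) := by
  intro φ hφ hφc hφΩ
  have hφ1 : ContDiff ℝ 1 φ := hφ.of_le (by simp)
  have hC : ContDiff ℝ 1 fun y => φ y • f y := contDiff_smul_of_tsupport_subset hΩ.isOpen hφ1 hφΩ hf.contDiffOn
  have hc : HasCompactSupport fun y => φ y • f y := hφc.smul_right
  have h0 := integral_pderiv_eq_zero hC hc j
  have h1 : ∫ x, pderiv j (fun y => φ y • f y) x = ∫ x in Ω, pderiv j (fun y => φ y • f y) x := by
    refine (setIntegral_eq_integral_of_forall_compl_eq_zero fun x hx => ?_).symm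
    have : (fun y => φ y • f y) =ᶠ[𝓝 x] fun _ => 0 := by
      filter_upwards [(isClosed_tsupport φ).isOpen_compl.mem_nhds fun h => hx (hφΩ h)] with y hy
      rw [image_eq_zero_of_notMem_tsupport hy, zero_smul]
    rw [pderiv_congr this]
    simp [pderiv]
  have h2 : ∫ x in Ω, pderiv j (fun y => φ y • f y) x = ∫ x in Ω, (f x * pderiv j φ x + pderiv j f x * φ x) := by
    refine setIntegral_congr_fun hΩ.isOpen.measurableSet fun x hx => ?_
    have := pderiv_mul (hφ1.differentiable one_ne_zero x) (hf.differentiableAt hΩ.isOpen hx) j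
    simp only [smul_eq_mul]
    rw [this]
    ring
  obtain ⟨C, hC⟩ := hφc.exists_bound_of_continuous hφ1.continuous
  rw [h1, h2, integral_add] at h0
  · linarith
  · exact hΩ.integrableOn_of_continuousOn
      (hf.continuousOn.mul (ContDiff.continuous_pderiv hφ1 j).continuousOn)
  · exact (memLp_one_iff_integrable.1 (hΩ.memLp_pderiv hf 1 j)).mul_bdd
      hφ1.continuous.aestronglyMeasurable (Eventually.of_forall hC)

/-- The test functions on `Ω` are square integrable, and so are their derivatives. -/
lemma memLp_testFunction {φ : Plane → ℝ} (hφ : ContDiff ℝ ∞ φ) (hφc : HasCompactSupport φ) (p : ℝ≥0∞) :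
    MemLp φ p (volume.restrict Ω) ∧ ∀ j, MemLp (pderiv j φ) p (volume.restrict Ω) := by
  have hφ1 : ContDiff ℝ 1 φ := hφ.of_le (by simp)
  exact ⟨(hφ1.continuous.memLp_of_hasCompactSupport hφc).restrict Ω, fun j =>
    ((ContDiff.continuous_pderiv hφ1 j).memLp_of_hasCompactSupport (hφc.fderiv_apply ℝ _)).restrict Ω⟩

lemma HasWeakPDeriv.sub (hf : MemLp f 2 (volume.restrict Ω)) (hg : MemLp g 2 (volume.restrict Ω))
    (hh : MemLp h 2 (volume.restrict Ω)) (hk : MemLp k 2 (volume.restrict Ω))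
    (h1 : HasWeakPDeriv Ω j f h) (h2 : HasWeakPDeriv Ω j g k) :
    HasWeakPDeriv Ω j (fun x => f x - g x) (fun x => h x - k x) := by
  intro φ hφ hφc hφΩ
  obtain ⟨h3, h4⟩ := memLp_testFunction (Ω := Ω) hφ hφc 2
  simp only [sub_mul]
  rw [integral_sub (integrable_mul_of_memLp_two hf (h4 j)) (integrable_mul_of_memLp_two hg (h4 j)),
    integral_sub (integrable_mul_of_memLp_two hh h3) (integrable_mul_of_memLp_two hk h3), h1 φ hφ hφc hφΩ, h2 φ hφ hφc hφΩ]
  ring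

lemma HasWeakPDeriv.congr (h1 : HasWeakPDeriv Ω j f h) (h2 : h =ᵐ[volume.restrict Ω] k) :
    HasWeakPDeriv Ω j f k := by
  intro φ hφ hφc hφΩ
  rw [h1 φ hφ hφc hφΩ]
  congr 1
  refine integral_congr_ae ?_
  filter_upwards [h2] with x hx
  rw [hx]

lemma MemLp.locallyIntegrableOn (hf : MemLp f 2 (volume.restrict Ω)) : LocallyIntegrableOn f Ω := by
  intro x _
  refine ⟨Metric.ball x 1 ∩ Ω, inter_mem (mem_nhdsWithin_of_mem_nhds (Metric.ball_mem_nhds x one_pos))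
    self_mem_nhdsWithin, ?_⟩
  have h1 : MemLp f 2 (volume.restrict (Metric.ball x 1 ∩ Ω)) :=
    hf.mono_measure (Measure.restrict_mono inter_subset_right le_rfl)
  have : IsFiniteMeasure (volume.restrict (Metric.ball x 1 ∩ Ω)) := by
    rw [isFiniteMeasure_restrict]
    exact (lt_of_le_of_lt (measure_mono inter_subset_left) measure_ball_lt_top).ne
  exact h1.integrable one_le_two

/-- Weak derivatives are unique. -/
lemma HasWeakPDeriv.ae_eq (hΩ : IsOpen Ω) (hh : MemLp h 2 (volume.restrict Ω))
    (hk : MemLp k 2 (volume.restrict Ω)) (h1 : HasWeakPDeriv Ω j f h) (h2 : HasWeakPDeriv Ω j f k) :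
    h =ᵐ[volume.restrict Ω] k := by
  have hloc : LocallyIntegrableOn (fun x => h x - k x) Ω := MemLp.locallyIntegrableOn (hh.sub hk)
  have := hΩ.ae_eq_zero_of_integral_contDiff_smul_eq_zero hloc fun φ hφ hφc hφΩ => ?_
  · rw [Filter.EventuallyEq, ae_restrict_iff' hΩ.measurableSet]
    filter_upwards [this] with x hx hxΩ
    linarith [hx hxΩ]
  · obtain ⟨h3, -⟩ := memLp_testFunction (Ω := Ω) hφ hφc 2
    rw [← setIntegral_eq_integral_of_tsupport_subset hφΩ (fun x hx => by simp [hx])]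
    have : ∀ x, φ x • (h x - k x) = h x * φ x - k x * φ x := fun x => by rw [smul_eq_mul]; ring
    simp only [this]
    rw [integral_sub (integrable_mul_of_memLp_two hh h3) (integrable_mul_of_memLp_two hk h3)]
    have h4 := h1 φ hφ hφc hφΩ
    have h5 := h2 φ hφ hφc hφΩ
    linarith

lemma MemH1.weakPDeriv_spec (hf : MemH1 Ω f) (j : Fin 2) :
    MemLp (weakPDeriv Ω j f) 2 (volume.restrict Ω) ∧ HasWeakPDeriv Ω j f (weakPDeriv Ω j f) := by
  have H := hf.2 j
  rw [weakPDeriv, dif_pos H]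
  exact H.choose_spec

lemma memH1_of_isC1Closure (hΩ : IsLipschitzDomain Ω) (hf : IsC1Closure Ω f) : MemH1 Ω f :=
  ⟨hΩ.memLp_of_continuousOn hf.continuousOn 2, fun j =>
    ⟨_, hΩ.memLp_pderiv hf 2 j, hasWeakPDeriv_pderiv hΩ hf j⟩⟩

lemma weakPDeriv_ae_eq (hΩ : IsLipschitzDomain Ω) (hf : IsC1Closure Ω f) (j : Fin 2) :
    weakPDeriv Ω j f =ᵐ[volume.restrict Ω] pderiv j f := by
  have h := (memH1_of_isC1Closure hΩ hf).weakPDeriv_spec j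
  exact HasWeakPDeriv.ae_eq hΩ.isOpen h.1 (hΩ.memLp_pderiv hf 2 j) h.2 (hasWeakPDeriv_pderiv hΩ hf j)

end weak

/-! ### Green's formula -/

lemma tendsto_integral_mul_of_tendsto_eLpNorm {X : Type*} [MeasurableSpace X] {μ : Measure X} {h t : X → ℝ}
    {φ : ℕ → X → ℝ} (hh : MemLp h 2 μ) (ht : MemLp t 2 μ) (hφ : ∀ n, MemLp (φ n) 2 μ)
    (hlim : Tendsto (fun n => eLpNorm (φ n - t) 2 μ) atTop (𝓝 0)) :
    Tendsto (fun n => ∫ x, h x * φ n x ∂μ) atTop (𝓝 (∫ x, h x * t x ∂μ)) := by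
  refine tendsto_integral_of_L1 _ (integrable_mul_of_memLp_two hh ht).aestronglyMeasurable
    (Eventually.of_forall fun n => integrable_mul_of_memLp_two hh (hφ n)) ?_
  have h1 : Tendsto (fun n => eLpNorm h 2 μ * eLpNorm (φ n - t) 2 μ) atTop (𝓝 0) := by
    have := ENNReal.Tendsto.const_mul hlim (Or.inr hh.eLpNorm_ne_top)
    rwa [mul_zero] at this
  refine tendsto_of_tendsto_of_tendsto_of_le_of_le tendsto_const_nhds h1 (fun _ => zero_le) fun n => ?_
  have := eLpNorm_smul_le_mul_eLpNorm (p := 2) (q := 2) (r := 1) ((hφ n).sub ht).aestronglyMeasurable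
    hh.aestronglyMeasurable
  refine le_trans (le_of_eq ?_) this
  rw [eLpNorm_one_eq_lintegral_enorm]
  refine lintegral_congr fun x => ?_
  simp only [Pi.smul_apply', Pi.sub_apply, smul_eq_mul, mul_sub]

lemma crOp_eq_zero_iff {u : Plane → Plane} {x : Plane} (hu : DifferentiableAt ℝ u x) :
    crOp u x = 0 ↔ fderiv ℝ u x (EuclideanSpace.single 0 1) 0 = fderiv ℝ u x (EuclideanSpace.single 1 1) 1 ∧
      fderiv ℝ u x (EuclideanSpace.single 1 1) 0 = -fderiv ℝ u x (EuclideanSpace.single 0 1) 1 := by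
  rw [crOp, pderiv_apply hu, pderiv_apply hu, pderiv_apply hu, pderiv_apply hu]
  constructor
  · intro h
    have h0 := congrArg (fun v : Plane => v 0) h
    have h1 := congrArg (fun v : Plane => v 1) h
    simp at h0 h1
    constructor <;> linarith
  · rintro ⟨h0, h1⟩
    ext i
    fin_cases i
    · simp [h0]
    · simp [h1]

/-- The components of a solution of the Cauchy-Riemann equations are harmonic. -/
lemma sum_fderiv_fderiv_eq_zero {Ω : Set Plane} (hΩ : IsOpen Ω) {u : Plane → Plane} (hu : ContDiffOn ℝ 2 u Ω)
    (hcr : ∀ x ∈ Ω, crOp u x = 0) {x : Plane} (hx : x ∈ Ω) :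
    ∑ j : Fin 2, fderiv ℝ (fderiv ℝ u) x (EuclideanSpace.single j 1) (EuclideanSpace.single j 1) = 0 := by
  have hd : ∀ y ∈ Ω, DifferentiableAt ℝ u y := fun y hy =>
    (hu.differentiableOn two_ne_zero).differentiableAt (hΩ.mem_nhds hy)
  have hdd : DifferentiableAt ℝ (fderiv ℝ u) x :=
    (((hu.fderiv_of_isOpen hΩ (m := 1) (by norm_num)).differentiableOn one_ne_zero)).differentiableAt
      (hΩ.mem_nhds hx)
  have hsymm : IsSymmSndFDerivAt ℝ u x :=
    (hu.contDiffAt (hΩ.mem_nhds hx)).isSymmSndFDerivAt (by simp)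
  set B := fderiv ℝ (fderiv ℝ u) x with hB
  have hder : ∀ (w : Plane) (i : Fin 2), HasFDerivAt (fun y => fderiv ℝ u y w i)
      ((EuclideanSpace.proj (𝕜 := ℝ) i).comp (B.flip w)) x := fun w i =>
    (EuclideanSpace.proj (𝕜 := ℝ) i).hasFDerivAt.comp x (hdd.hasFDerivAt.clm_apply (hasFDerivAt_const w x)
      |>.congr_fderiv (by ext; simp [hB]))
  -- Differentiate the first Cauchy–Riemann equation in the direction `v`; `h1` does the same for
  -- the second. Symmetry of `B` then matches the mixed derivatives.
  have h0 : ∀ v, B v (EuclideanSpace.single 0 1) 0 = B v (EuclideanSpace.single 1 1) 1 := fun v => by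
    have h1 : (fun y => fderiv ℝ u y (EuclideanSpace.single 0 1) 0) =ᶠ[𝓝 x]
        fun y => fderiv ℝ u y (EuclideanSpace.single 1 1) 1 := by
      filter_upwards [hΩ.mem_nhds hx] with y hy
      exact ((crOp_eq_zero_iff (hd y hy)).1 (hcr y hy)).1
    have := (hder (EuclideanSpace.single 0 1) 0).unique ((hder (EuclideanSpace.single 1 1) 1).congr_of_eventuallyEq h1)
    exact congrArg (fun L => L v) this
  have h1 : ∀ v, B v (EuclideanSpace.single 1 1) 0 = -B v (EuclideanSpace.single 0 1) 1 := fun v => by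
    have h1 : (fun y => fderiv ℝ u y (EuclideanSpace.single 1 1) 0) =ᶠ[𝓝 x]
        fun y => -fderiv ℝ u y (EuclideanSpace.single 0 1) 1 := by
      filter_upwards [hΩ.mem_nhds hx] with y hy
      exact ((crOp_eq_zero_iff (hd y hy)).1 (hcr y hy)).2
    have := (hder (EuclideanSpace.single 1 1) 0).unique
      ((hder (EuclideanSpace.single 0 1) 1).neg.congr_of_eventuallyEq h1)
    exact congrArg (fun L => L v) this
  have hs : B (EuclideanSpace.single 0 1) (EuclideanSpace.single 1 1) =
      B (EuclideanSpace.single 1 1) (EuclideanSpace.single 0 1) := hsymm _ _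
  have hs0 := congrArg (fun v : Plane => v 0) hs
  have hs1 := congrArg (fun v : Plane => v 1) hs
  rw [Fin.sum_univ_two]
  ext i
  fin_cases i
  · have a := h0 (EuclideanSpace.single 0 1)
    have b := h1 (EuclideanSpace.single 1 1)
    simp only at hs0 hs1
    simp only [Fin.zero_eta, PiLp.add_apply, PiLp.zero_apply]
    linarith
  · have a := h0 (EuclideanSpace.single 1 1)
    have b := h1 (EuclideanSpace.single 0 1)
    simp only at hs0 hs1
    simp only [Fin.mk_one, PiLp.add_apply, PiLp.zero_apply]
    linarith

lemma laplacian_eq_zero {Ω : Set Plane} (hΩ : IsOpen Ω) {u : Plane → Plane} (hu : ContDiffOn ℝ 2 u Ω)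
    (hcr : ∀ x ∈ Ω, crOp u x = 0) {x : Plane} (hx : x ∈ Ω) : Laplacian.laplacian u x = 0 := by
  rw [InnerProductSpace.laplacian_eq_iteratedFDeriv_orthonormalBasis u (EuclideanSpace.basisFun (Fin 2) ℝ),
    ← sum_fderiv_fderiv_eq_zero hΩ hu hcr hx]
  refine Finset.sum_congr rfl fun j _ => ?_
  rw [iteratedFDeriv_two_apply]
  simp

/-- **Green's formula** for the components of a solution of the Cauchy-Riemann Neumann problem. -/
theorem IsCRNeumannSolution.green {Ω : Set Plane} (hΩ : IsLipschitzDomain Ω) {g u : Plane → Plane}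
    (hg : ContinuousOn g (frontier Ω)) (hu2 : ContDiffOn ℝ 2 u Ω) (hu : IsCRNeumannSolution Ω g u)
    {φ : Plane → ℝ} (hφ : IsC1Closure Ω φ) (i : Fin 2) :
    ∫ x in Ω, ∑ j, pderiv j (fun y => u y i) x * pderiv j φ x =
      ∫ x, g x i * φ x ∂(arcLength Ω) := by
  have hΩo := hΩ.isOpen
  have hu1 := hu.isC1Closure
  set L := closureFDeriv Ω u with hL
  have hLc : ContinuousOn L (closure Ω) := hu1.continuousOn_extendFrom hΩo
  have hLe : ∀ x ∈ Ω, L x = fderiv ℝ u x := fun x hx => hu1.extendFrom_eq hΩo hx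
  have hL1 : ContDiffOn ℝ 1 L Ω :=
    (hu2.fderiv_of_isOpen hΩo (m := 1) (by norm_num)).congr hLe
  -- The gradient of the `i`-th component, extended continuously to the closure; the divergence
  -- theorem is applied to `φ • G`.
  set G : Plane → Plane := fun x => WithLp.toLp 2 fun j => L x (EuclideanSpace.single j 1) i with hG
  have hGj : ∀ x j, G x j = L x (EuclideanSpace.single j 1) i := fun _ _ => rfl
  have hGc : ContinuousOn G (closure Ω) := by
    refine (PiLp.continuous_toLp 2 _).comp_continuousOn (continuousOn_pi.2 fun j => ?_)
    exact (EuclideanSpace.proj (𝕜 := ℝ) i).continuous.comp_continuousOn (hLc.clm_apply continuousOn_const)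
  have hG1 : ContDiffOn ℝ 1 G Ω := by
    refine contDiffOn_euclidean.2 fun j => ?_
    exact (EuclideanSpace.proj (𝕜 := ℝ) i).contDiff.comp_contDiffOn (hL1.clm_apply contDiffOn_const)
  have hGu : ∀ x ∈ Ω, ∀ j, G x j = pderiv j (fun y => u y i) x := fun x hx j => by
    rw [hGj, hLe x hx, pderiv_apply (hu1.differentiableAt hΩo hx)]
  have hGdiv : ∀ x ∈ Ω, vdiv G x = 0 := fun x hx => by
    have hdd : DifferentiableAt ℝ (fderiv ℝ u) x :=
      (((hu2.fderiv_of_isOpen hΩo (m := 1) (by norm_num)).differentiableOn one_ne_zero)).differentiableAt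
        (hΩo.mem_nhds hx)
    have hs := congrArg (fun v : Plane => v i) (sum_fderiv_fderiv_eq_zero hΩo hu2 hu.crOp_eq_zero hx)
    rw [Fin.sum_univ_two] at hs
    rw [vdiv, Fin.sum_univ_two]
    have hp : ∀ j : Fin 2, pderiv j (fun y => G y j) x =
        fderiv ℝ (fderiv ℝ u) x (EuclideanSpace.single j 1) (EuclideanSpace.single j 1) i := fun j => by
      have h1 : (fun y => G y j) =ᶠ[𝓝 x] fun y => fderiv ℝ u y (EuclideanSpace.single j 1) i := by
        filter_upwards [hΩo.mem_nhds hx] with y hy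
        rw [hGj, hLe y hy]
      rw [pderiv_congr h1, pderiv_apply (u := fun y => fderiv ℝ u y (EuclideanSpace.single j 1))
        (hdd.clm_apply (differentiableAt_const _))]
      rw [(hdd.hasFDerivAt.clm_apply (hasFDerivAt_const (EuclideanSpace.single j (1 : ℝ)) x)).fderiv]
      simp
    rw [hp, hp]
    exact hs
  have hdiv : ∀ x ∈ Ω, vdiv (fun y => φ y • G y) x = ∑ j, pderiv j (fun y => u y i) x * pderiv j φ x :=
    fun x hx => by
      rw [vdiv_smul (hφ.differentiableAt hΩo hx)
        ((hG1.differentiableOn one_ne_zero).differentiableAt (hΩo.mem_nhds hx)), hGdiv x hx, mul_zero, zero_add]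
      exact Finset.sum_congr rfl fun j _ => by rw [hGu x hx j]
  -- Second derivatives of `u` may blow up at the boundary, but `G` is divergence free, so the
  -- divergence of `φ • G` contains first derivatives only.
  have hint : IntegrableOn (fun x => ∑ j, pderiv j (fun y => u y i) x * pderiv j φ x) Ω :=
    integrable_finsetSum _ fun j _ =>
      (hΩ.memLp_pderiv (hu1.apply hΩo i) 2 j).integrable_mul (hΩ.memLp_pderiv hφ 2 j)
  rw [← setIntegral_congr_fun hΩo.measurableSet hdiv]
  refine hΩ.integral_vdiv (hφ.continuousOn.smul hGc) (hφ.contDiffOn.smul hG1)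
    (hint.congr_fun (fun x hx => (hdiv x hx).symm) hΩo.measurableSet) ?_ fun x hx ν hν => ?_
  · have hc : ContinuousOn (fun x => g x i * φ x) (frontier Ω) :=
      ((EuclideanSpace.proj (𝕜 := ℝ) i).continuous.comp_continuousOn hg).mul
        (hφ.continuousOn.mono frontier_subset_closure)
    exact memLp_one_iff_integrable.1 (hΩ.memLp_arcLength hc 1)
  · rw [← hu.neumann x hx ν hν]
    have hν2 : ν = ν 0 • EuclideanSpace.single 0 1 + ν 1 • EuclideanSpace.single 1 1 := by
      rw [← toLp_eq_smul_add_smul]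
      ext k
      fin_cases k <;> simp
    have : closureFDeriv Ω u x ν i = ν 0 * L x (EuclideanSpace.single 0 1) i +
        ν 1 * L x (EuclideanSpace.single 1 1) i := by
      conv_lhs => rw [hν2, map_add, map_smul, map_smul]
      simp [hL]
    rw [this]
    simp only [Pi.smul_apply', inner_smul_left, PiLp.inner_apply, Fin.sum_univ_two, hGj]
    simp
    ring

/-- Green's formula, extended to the functions of `H¹(Ω)` that have a trace. -/
lemma IsCRNeumannSolution.green_trace {Ω : Set Plane} (hΩ : IsLipschitzDomain Ω) {g u : Plane → Plane}
    (hg : ContinuousOn g (frontier Ω)) (hu2 : ContDiffOn ℝ 2 u Ω) (hu : IsCRNeumannSolution Ω g u)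
    {f t : Plane → ℝ} (hf : MemH1 Ω f) (ht : IsTrace Ω f t) (i : Fin 2) :
    ∫ x, g x i * t x ∂(arcLength Ω) =
      ∑ j, ∫ x in Ω, pderiv j (fun y => u y i) x * weakPDeriv Ω j f x := by
  obtain ⟨htL, φ, hφ, -, hφd, hφt⟩ := ht
  -- Only the convergence of gradients and of boundary values enters, so the `L²` convergence of `φ
  -- n` itself is dropped above.
  have hui := hu.isC1Closure.apply hΩ.isOpen i
  have h1 := tendsto_integral_mul_of_tendsto_eLpNorm
    (hΩ.memLp_arcLength ((EuclideanSpace.proj (𝕜 := ℝ) i).continuous.comp_continuousOn hg) 2) htL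
    (fun n => hΩ.memLp_arcLength ((hφ n).continuousOn.mono frontier_subset_closure) 2) hφt
  have h2 := tendsto_finsetSum Finset.univ fun j _ => tendsto_integral_mul_of_tendsto_eLpNorm
    (hΩ.memLp_pderiv hui 2 j) (hf.weakPDeriv_spec j).1 (fun n => hΩ.memLp_pderiv (hφ n) 2 j) (hφd j)
  refine tendsto_nhds_unique h1 (h2.congr fun n => ?_)
  rw [← integral_finsetSum _ fun j _ => integrable_mul_of_memLp_two (hΩ.memLp_pderiv hui 2 j)
    (hΩ.memLp_pderiv (hφ n) 2 j)]
  exact hu.green hΩ hg hu2 (hφ n) i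

/-! ### Mollification -/

/-- The convolution of `f` with the kernel `η`. -/
def mollify (η f : Plane → ℝ) (x : Plane) : ℝ := ∫ y, f y * η (x - y)

lemma mollify_eq_convolution (η f : Plane → ℝ) :
    mollify η f = convolution f η (ContinuousLinearMap.mul ℝ ℝ) volume := rfl

/-- The kernel as first factor is the form used by the convergence and distance estimates for
convolutions; the other order serves differentiation of the kernel. -/
lemma mollify_eq_convolution_lsmul (η f : Plane → ℝ) :
    mollify η f = convolution η f (ContinuousLinearMap.lsmul ℝ ℝ) volume := by
  rw [mollify_eq_convolution, ← convolution_flip]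
  congr 1
  ext
  simp

lemma contDiff_mollify {η f : Plane → ℝ} (hf : LocallyIntegrable f) (hη : ContDiff ℝ 1 η)
    (hηc : HasCompactSupport η) : ContDiff ℝ 1 (mollify η f) := by
  rw [mollify_eq_convolution]
  exact hηc.contDiff_convolution_right (n := 1) _ hf hη

lemma pderiv_mollify {η f : Plane → ℝ} (hf : LocallyIntegrable f) (hη : ContDiff ℝ 1 η)
    (hηc : HasCompactSupport η) (j : Fin 2) (x : Plane) :
    pderiv j (mollify η f) x = mollify (pderiv j η) f x := by
  rw [mollify_eq_convolution, pderiv,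
    (hηc.hasFDerivAt_convolution_right (ContinuousLinearMap.mul ℝ ℝ) hf hη x).fderiv,
    convolution_precompR_apply (ContinuousLinearMap.mul ℝ ℝ) hf (hηc.fderiv ℝ)
      (hη.continuous_fderiv one_ne_zero)]
  rfl

lemma mollify_indicator {Ω : Set Plane} (hΩ : IsOpen Ω) (η f : Plane → ℝ) (x : Plane) :
    mollify η (Ω.indicator f) x = ∫ y in Ω, f y * η (x - y) := by
  rw [mollify, ← integral_indicator hΩ.measurableSet]
  congr 1
  ext y
  by_cases hy : y ∈ Ω <;> simp [hy]

/-- Where the kernel only sees points of `Ω`, mollification turns weak derivatives into derivatives. -/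
lemma HasWeakPDeriv.pderiv_mollify {Ω : Set Plane} (hΩ : IsOpen Ω) {f h η : Plane → ℝ} {j : Fin 2}
    (hw : HasWeakPDeriv Ω j f h) (hf : LocallyIntegrable (Ω.indicator f)) (hη : ContDiff ℝ ∞ η)
    (hηc : HasCompactSupport η) {x : Plane} (hx : ∀ y, x - y ∈ tsupport η → y ∈ Ω) :
    pderiv j (mollify η (Ω.indicator f)) x = mollify η (Ω.indicator h) x := by
  rw [CRNeumann.pderiv_mollify hf (hη.of_le (by simp)) hηc, mollify_indicator hΩ, mollify_indicator hΩ]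
  have h1 : tsupport (fun y => η (x - y)) = (Homeomorph.subLeft x) ⁻¹' tsupport η :=
    tsupport_comp_eq_preimage η (Homeomorph.subLeft x)
  -- The reflected kernel is an admissible test function precisely because it sees only `Ω`; the
  -- sign from reflecting cancels the sign in the definition of the weak derivative.
  have h2 := hw (fun y => η (x - y)) (hη.comp (contDiff_const.sub contDiff_id))
    (hηc.comp_homeomorph (Homeomorph.subLeft x)) (by rw [h1]; exact fun y hy => hx y hy)
  have h3 : ∀ y, pderiv j (fun y => η (x - y)) y = -pderiv j η (x - y) := fun y => by
    have hd : HasFDerivAt (fun y => η (x - y)) ((fderiv ℝ η (x - y)).comp (-ContinuousLinearMap.id ℝ Plane)) y :=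
      ((hη.differentiable (by simp)) (x - y)).hasFDerivAt.comp y ((hasFDerivAt_id y).const_sub x)
    rw [pderiv, hd.fderiv, pderiv]
    simp
  simp only [h3, mul_neg] at h2
  rw [integral_neg] at h2
  linarith

lemma locallyIntegrable_indicator {Ω : Set Plane} (hΩ : IsOpen Ω) {f : Plane → ℝ}
    (hf : MemLp f 2 (volume.restrict Ω)) : LocallyIntegrable (Ω.indicator f) :=
  ((memLp_indicator_iff_restrict hΩ.measurableSet).2 hf).locallyIntegrable one_le_two

/-! ### Functions with vanishing weak gradient -/

/-- On the half-radius ball, mollifications at scale below `r` have zero gradient, hence are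
constant, and they converge almost everywhere to `f`. -/
lemma ae_eq_const_ball_of_hasWeakPDeriv_zero {Ω : Set Plane} (hΩ : IsOpen Ω) {f : Plane → ℝ}
    (hf : MemLp f 2 (volume.restrict Ω)) (hw : ∀ j, HasWeakPDeriv Ω j f 0) {x : Plane} (hx : x ∈ Ω) :
    ∃ r > 0, ∃ c, Metric.ball x r ⊆ Ω ∧ ∀ᵐ y, y ∈ Metric.ball x r → f y = c := by
  obtain ⟨R, hR, hRΩ⟩ := Metric.isOpen_iff.1 hΩ x hx
  set r := R / 2 with hr
  have hr0 : 0 < r := by positivity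
  have hloc := locallyIntegrable_indicator hΩ hf
  -- The ratio of outer to inner radius is kept equal to 2, since almost everywhere convergence
  -- needs it bounded.
  let φ : ℕ → ContDiffBump (0 : Plane) := fun n =>
    ⟨r / (n + 2) / 2, r / (n + 2), by positivity, half_lt_self (by positivity)⟩
  have hφr : ∀ n, (φ n).rOut < r := fun n => by
    change r / (n + 2) < r
    rw [div_lt_iff₀ (by positivity)]
    nlinarith [(Nat.cast_nonneg n : (0 : ℝ) ≤ n)]
  have hφ0 : Tendsto (fun n => (φ n).rOut) atTop (𝓝 0) := by
    change Tendsto (fun n : ℕ => r / ((n : ℝ) + 2)) atTop (𝓝 0)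
    exact tendsto_const_nhds.div_atTop (tendsto_atTop_add_const_right _ _ tendsto_natCast_atTop_atTop)
  have hconv := ContDiffBump.ae_convolution_tendsto_right_of_locallyIntegrable (μ := volume) (K := 2) hφ0
    (Eventually.of_forall fun n => by
      change r / (n + 2) ≤ 2 * (r / (n + 2) / 2)
      linarith) hloc
  have hηs : ∀ n, ContDiff ℝ ∞ ((φ n).normed volume) := fun n => (φ n).contDiff_normed
  have hηc : ∀ n, HasCompactSupport ((φ n).normed volume) := fun n => (φ n).hasCompactSupport_normed
  have hconst : ∀ n, ∀ y ∈ Metric.ball x r, mollify ((φ n).normed volume) (Ω.indicator f) y =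
      mollify ((φ n).normed volume) (Ω.indicator f) x := by
    intro n y hy
    have hd := contDiff_mollify hloc ((hηs n).of_le (by simp)) (hηc n)
    refine Metric.isOpen_ball.is_const_of_fderiv_eq_zero (𝕜 := ℝ) (convex_ball x r).isPreconnected
      (hd.differentiable one_ne_zero).differentiableOn (fun z hz => ?_) hy (Metric.mem_ball_self hr0)
    have hp : ∀ j, pderiv j (mollify ((φ n).normed volume) (Ω.indicator f)) z = 0 := fun j => by
      rw [(hw j).pderiv_mollify hΩ hloc (hηs n) (hηc n) (fun w hw => hRΩ ?_)]
      · simp [mollify]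
      · rw [(φ n).tsupport_normed_eq, Metric.mem_closedBall, dist_zero_right] at hw
        rw [Metric.mem_ball] at hz ⊢
        have h1 : dist w z ≤ (φ n).rOut := by rwa [dist_comm, dist_eq_norm]
        have := dist_triangle w z x
        linarith [hφr n]
    ext v
    have hv : v = v 0 • EuclideanSpace.single 0 1 + v 1 • EuclideanSpace.single 1 1 := by
      rw [← toLp_eq_smul_add_smul]
      ext k
      fin_cases k <;> simp
    have h0 := hp 0
    have h1 := hp 1
    rw [pderiv] at h0 h1
    rw [hv, map_add, map_smul, map_smul, h0, h1]
    simp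
  have hlim : ∀ᵐ y, y ∈ Metric.ball x r →
      Tendsto (fun n => mollify ((φ n).normed volume) (Ω.indicator f) x) atTop (𝓝 (f y)) := by
    filter_upwards [hconv] with y hy hyr
    have hyΩ : y ∈ Ω := hRΩ (Metric.ball_subset_ball (by linarith) hyr)
    rw [indicator_of_mem hyΩ] at hy
    refine hy.congr fun n => ?_
    rw [← hconst n y hyr, mollify_eq_convolution_lsmul]
  -- The sequence of constants does not depend on `y`; a ball has positive measure, so at least one
  -- point identifies its limit.
  have hne : ∃ y ∈ Metric.ball x r,
      Tendsto (fun n => mollify ((φ n).normed volume) (Ω.indicator f) x) atTop (𝓝 (f y)) := by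
    by_contra! h
    have : volume (Metric.ball x r) = 0 := by
      refine measure_mono_null (fun y hy => ?_) hlim
      simp only [mem_compl_iff, mem_ofPred_eq, Classical.not_imp]
      exact ⟨hy, h y hy⟩
    exact (Metric.measure_ball_pos volume x hr0).ne' this
  obtain ⟨y₀, -, hy₀⟩ := hne
  refine ⟨r, hr0, f y₀, (Metric.ball_subset_ball (by linarith)).trans hRΩ, ?_⟩
  filter_upwards [hlim] with y hy hyr
  exact tendsto_nhds_unique (hy hyr) hy₀

/-- A function with vanishing weak gradient on a connected open set is constant. -/
lemma ae_eq_const_of_hasWeakPDeriv_zero {Ω : Set Plane} (hΩ : IsOpen Ω) (hc : IsConnected Ω) {f : Plane → ℝ}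
    (hf : MemLp f 2 (volume.restrict Ω)) (hw : ∀ j, HasWeakPDeriv Ω j f 0) :
    ∃ c, ∀ᵐ x ∂(volume.restrict Ω), f x = c := by
  have H := fun x : Ω => ae_eq_const_ball_of_hasWeakPDeriv_zero hΩ hf hw x.2
  choose r hr c hrΩ hc' using H
  classical
  let C : Plane → ℝ := fun x => if hx : x ∈ Ω then c ⟨x, hx⟩ else 0
  have hCx : ∀ x (hx : x ∈ Ω), C x = c ⟨x, hx⟩ := fun x hx => dif_pos hx
  -- The balls around `x` and `y` overlap in a nonempty open set, which has positive measure, so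
  -- their constants agree. Thus `C` is locally constant.
  have hloc : ∀ x (hx : x ∈ Ω), ∀ y ∈ Metric.ball x (r ⟨x, hx⟩), C y = C x := by
    intro x hx y hy
    have hyΩ := hrΩ ⟨x, hx⟩ hy
    rw [hCx x hx, hCx y hyΩ]
    have ho : IsOpen (Metric.ball x (r ⟨x, hx⟩) ∩ Metric.ball y (r ⟨y, hyΩ⟩)) :=
      Metric.isOpen_ball.inter Metric.isOpen_ball
    by_contra hne
    refine (ho.measure_pos volume ⟨y, hy, Metric.mem_ball_self (hr _)⟩).ne' ?_
    have h3 : ∀ᵐ z, ¬ z ∈ Metric.ball x (r ⟨x, hx⟩) ∩ Metric.ball y (r ⟨y, hyΩ⟩) := by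
      filter_upwards [hc' ⟨x, hx⟩, hc' ⟨y, hyΩ⟩] with z h1 h2 hz
      exact hne ((h2 hz.2).symm.trans (h1 hz.1))
    rw [ae_iff] at h3
    simp only [not_not] at h3
    exact h3
  have hEq : ∀ x (hx : x ∈ Ω), C =ᶠ[𝓝 x] fun _ => C x := fun x hx => by
    filter_upwards [Metric.ball_mem_nhds x (hr ⟨x, hx⟩)] with y hy using hloc x hx y hy
  obtain ⟨x₀, hx₀⟩ := hc.nonempty
  have hconst : ∀ x ∈ Ω, C x = C x₀ := fun x hx => by
    refine hΩ.is_const_of_fderiv_eq_zero (𝕜 := ℝ) hc.isPreconnected (fun y hy => ?_) (fun y hy => ?_) hx hx₀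
    · exact ((differentiableAt_const (C y)).congr_of_eventuallyEq (hEq y hy)).differentiableWithinAt
    · rw [(hEq y hy).fderiv_eq]
      simp
  refine ⟨C x₀, ?_⟩
  rw [ae_restrict_iff' hΩ.measurableSet, ae_iff]
  refine measure_null_of_locally_null _ fun x hx => ?_
  simp only [mem_ofPred_eq, Classical.not_imp] at hx
  refine ⟨{y | ¬ (y ∈ Ω → f y = C x₀)} ∩ Metric.ball x (r ⟨x, hx.1⟩),
    inter_mem self_mem_nhdsWithin (mem_nhdsWithin_of_mem_nhds (Metric.ball_mem_nhds x (hr _))), ?_⟩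
  refine measure_mono_null ?_ (hc' ⟨x, hx.1⟩)
  rintro y ⟨hy, hyb⟩
  simp only [mem_ofPred_eq, Classical.not_imp] at hy
  simp only [mem_compl_iff, mem_ofPred_eq, Classical.not_imp]
  refine ⟨hyb, fun h => hy.2 ?_⟩
  exact h.trans ((hCx x hx.1).symm.trans (hconst x hx.1))

/-! ### Mollification in `L²` -/

lemma eLpNorm_two_sq {X : Type*} [MeasurableSpace X] (f : X → ℝ) (μ : Measure X) :
    eLpNorm f 2 μ ^ 2 = ∫⁻ x, ‖f x‖ₑ ^ 2 ∂μ := by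
  rw [eLpNorm_eq_lintegral_rpow_enorm_toReal two_ne_zero ENNReal.ofNat_ne_top, ← ENNReal.rpow_natCast,
    ← ENNReal.rpow_mul]
  simp

/-- Cauchy–Schwarz for the splitting `F * η = (F ^ 2 * η) ^ (1 / 2) * η ^ (1 / 2)`. -/
lemma sq_lintegral_mul_le {X : Type*} [MeasurableSpace X] {μ : Measure X} {F η : X → ℝ≥0∞}
    (hF : AEMeasurable F μ) (hη : AEMeasurable η μ) (hη1 : ∫⁻ x, η x ∂μ ≤ 1) :
    (∫⁻ x, F x * η x ∂μ) ^ 2 ≤ ∫⁻ x, F x ^ 2 * η x ∂μ := by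
  have h := ENNReal.lintegral_mul_norm_pow_le (μ := μ) (f := fun x => F x ^ 2 * η x) (g := η)
    (p := 1 / 2) (q := 1 / 2) ((hF.pow_const 2).mul hη) hη (by norm_num) (by norm_num) (by norm_num)
  have h1 : ∀ x, (F x ^ 2 * η x) ^ (1 / 2 : ℝ) * η x ^ (1 / 2 : ℝ) = F x * η x := fun x => by
    rw [ENNReal.mul_rpow_of_nonneg _ _ (by norm_num), mul_assoc,
      ← ENNReal.rpow_add_of_nonneg _ _ (by norm_num) (by norm_num), ← ENNReal.rpow_natCast,
      ← ENNReal.rpow_mul]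
    norm_num
  simp only [h1] at h
  have h2 : (∫⁻ x, F x * η x ∂μ) ≤ (∫⁻ x, F x ^ 2 * η x ∂μ) ^ (1 / 2 : ℝ) :=
    h.trans (mul_le_of_le_one_right zero_le (ENNReal.rpow_le_one hη1 (by norm_num)))
  calc _ ≤ ((∫⁻ x, F x ^ 2 * η x ∂μ) ^ (1 / 2 : ℝ)) ^ 2 := by gcongr
    _ = _ := by
      rw [← ENNReal.rpow_natCast, ← ENNReal.rpow_mul]
      norm_num

/-- A nonnegative smooth kernel with compact support and integral one. -/
structure IsKernel (η : Plane → ℝ) : Prop where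
  contDiff : ContDiff ℝ ∞ η
  hasCompactSupport : HasCompactSupport η
  nonneg : ∀ z, 0 ≤ η z
  integral_eq_one : ∫ z, η z = 1

lemma IsKernel.lintegral_enorm {η : Plane → ℝ} (hη : IsKernel η) : ∫⁻ z, ‖η z‖ₑ = 1 := by
  have h1 : ∀ z, ‖η z‖ₑ = ENNReal.ofReal (η z) := fun z => Real.enorm_of_nonneg (hη.nonneg z)
  simp only [h1]
  rw [← ofReal_integral_eq_lintegral_ofReal
    (hη.contDiff.continuous.integrable_of_hasCompactSupport hη.hasCompactSupport)
    (Eventually.of_forall hη.nonneg), hη.integral_eq_one, ENNReal.ofReal_one]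

/-- Cauchy–Schwarz against the probability density `η (x - ·)`, then Tonelli: integrating the kernel
in `x` gives one again. -/
lemma eLpNorm_mollify_le {η F : Plane → ℝ} (hη : IsKernel η) (hF : AEStronglyMeasurable F volume) :
    eLpNorm (mollify η F) 2 volume ≤ eLpNorm F 2 volume := by
  rw [← ENNReal.pow_le_pow_left_iff two_ne_zero, eLpNorm_two_sq, eLpNorm_two_sq]
  have hηm : Measurable fun z => ‖η z‖ₑ := hη.contDiff.continuous.measurable.enorm
  have hFm : AEMeasurable (fun y => ‖F y‖ₑ) volume := hF.enorm
  have h1 : ∀ x, ‖mollify η F x‖ₑ ^ 2 ≤ ∫⁻ y, ‖F y‖ₑ ^ 2 * ‖η (x - y)‖ₑ := fun x => by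
    refine le_trans ?_ (sq_lintegral_mul_le hFm (hηm.comp (measurable_const.sub measurable_id)).aemeasurable
      (le_of_eq ?_))
    · gcongr
      refine (enorm_integral_le_lintegral_enorm _).trans (le_of_eq (lintegral_congr fun y => ?_))
      rw [enorm_mul]
    · exact (lintegral_sub_left_eq_self (fun z => ‖η z‖ₑ) x).trans hη.lintegral_enorm
  refine (lintegral_mono h1).trans ?_
  rw [lintegral_lintegral_swap]
  · refine lintegral_mono fun y => ?_
    have hm : Measurable fun x => ‖η (x - y)‖ₑ := hηm.comp (measurable_id.sub measurable_const)
    rw [lintegral_const_mul _ hm,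
      lintegral_sub_right_eq_self (fun z => ‖η z‖ₑ) y, hη.lintegral_enorm, mul_one]
  · change AEMeasurable (fun p : Plane × Plane => ‖F p.2‖ₑ ^ 2 * ‖η (p.1 - p.2)‖ₑ) _
    have ha : AEMeasurable (fun p : Plane × Plane => ‖F p.2‖ₑ ^ 2) (volume.prod volume) :=
      (hFm.pow_const 2).comp_quasiMeasurePreserving Measure.quasiMeasurePreserving_snd
    have hb : Measurable fun p : Plane × Plane => ‖η (p.1 - p.2)‖ₑ :=
      hηm.comp (measurable_fst.sub measurable_snd)
    exact ha.mul hb.aemeasurable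

lemma integrable_mul_kernel {η F : Plane → ℝ} (hη : IsKernel η) (hF : MemLp F 2 volume) (x : Plane) :
    Integrable fun y => F y * η (x - y) := by
  refine integrable_mul_of_memLp_two hF ?_
  have h : Continuous fun y => η (x - y) := hη.contDiff.continuous.comp (continuous_const.sub continuous_id)
  exact h.memLp_of_hasCompactSupport (hη.hasCompactSupport.comp_homeomorph (Homeomorph.subLeft x))

lemma mollify_sub {η F G : Plane → ℝ} (hη : IsKernel η) (hF : MemLp F 2 volume) (hG : MemLp G 2 volume) :
    mollify η (F - G) = mollify η F - mollify η G := by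
  ext x
  simp only [mollify, Pi.sub_apply, sub_mul]
  exact integral_sub (integrable_mul_kernel hη hF x) (integrable_mul_kernel hη hG x)

/-- Uniform continuity makes the difference uniformly small, and once `δ n < 1` it vanishes outside
a fixed compact neighbourhood of the support. -/
lemma tendsto_mollify_of_continuous {η : ℕ → Plane → ℝ} {δ : ℕ → ℝ} (hη : ∀ n, IsKernel (η n))
    (hηδ : ∀ n, Function.support (η n) ⊆ Metric.ball 0 (δ n)) (hδ : Tendsto δ atTop (𝓝 0))
    {G : Plane → ℝ} (hG : Continuous G) (hGc : HasCompactSupport G) :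
    Tendsto (fun n => eLpNorm (mollify (η n) G - G) 2 volume) atTop (𝓝 0) := by
  set S := Metric.cthickening 1 (tsupport G) with hS
  have hSc : IsCompact S := hGc.isCompact.cthickening
  have key : ∀ c : ℝ, 0 < c → ∀ᶠ n in atTop,
      eLpNorm (mollify (η n) G - G) 2 volume ≤ ENNReal.ofReal c * volume S ^ (1 / 2 : ℝ) := by
    intro c hc
    have huc : UniformContinuous G := by
      refine hG.uniformContinuous_of_tendsto_cocompact (x := 0) (tendsto_const_nhds.congr' ?_)
      rw [← coclosedCompact_eq_cocompact]
      exact (hasCompactSupport_iff_eventuallyEq.1 hGc).symm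
    obtain ⟨d, hd, hdG⟩ := Metric.uniformContinuous_iff.1 huc c hc
    filter_upwards [hδ.eventually (eventually_lt_nhds hd), hδ.eventually (eventually_lt_nhds one_pos)]
      with n hn hn1
    have hb : ∀ x, ‖(mollify (η n) G - G) x‖ ≤ ‖S.indicator (fun _ => c) x‖ := by
      intro x
      rw [Pi.sub_apply, ← dist_eq_norm, mollify_eq_convolution_lsmul]
      refine dist_convolution_le (norm_nonneg _) (hηδ n) (hη n).nonneg (hη n).integral_eq_one
        hG.aestronglyMeasurable fun y hy => ?_
      by_cases hx : x ∈ S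
      · rw [indicator_of_mem hx, Real.norm_of_nonneg hc.le]
        exact (hdG ((Metric.mem_ball.1 hy).trans hn)).le
      · have h0 : ∀ z, dist x z ≤ 1 → G z = 0 := fun z hz =>
          image_eq_zero_of_notMem_tsupport fun h => hx (Metric.mem_cthickening_of_dist_le x z 1 _ h hz)
        rw [h0 y (by rw [dist_comm]; exact ((Metric.mem_ball.1 hy).trans hn1).le), h0 x (by simp)]
        simp
    refine (eLpNorm_mono hb).trans ?_
    rw [eLpNorm_indicator_const hSc.measurableSet two_ne_zero ENNReal.ofNat_ne_top,
      Real.enorm_of_nonneg hc.le]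
    simp
  have hV : volume S ^ (1 / 2 : ℝ) ≠ ⊤ := ENNReal.rpow_ne_top_of_nonneg (by norm_num) hSc.measure_lt_top.ne
  have hlim : Tendsto (fun c : ℝ => ENNReal.ofReal c * volume S ^ (1 / 2 : ℝ)) (𝓝[>] 0) (𝓝 0) := by
    have h1 : Tendsto (fun c : ℝ => ENNReal.ofReal c) (𝓝[>] 0) (𝓝 0) := by
      simpa using (ENNReal.continuous_ofReal.tendsto 0).mono_left nhdsWithin_le_nhds
    have := ENNReal.Tendsto.mul_const h1 (Or.inr hV)
    rwa [zero_mul] at this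
  rw [ENNReal.tendsto_nhds_zero]
  intro ε hε
  obtain ⟨c, hc, hc0⟩ := ((ENNReal.tendsto_nhds_zero.1 hlim ε hε).and self_mem_nhdsWithin).exists
  exact (key c hc0).mono fun n hn => hn.trans hc

/-- Compactly supported continuous functions are dense in `L²`, and mollification is a contraction
there: a three-term estimate. -/
lemma tendsto_mollify {η : ℕ → Plane → ℝ} {δ : ℕ → ℝ} (hη : ∀ n, IsKernel (η n))
    (hηδ : ∀ n, Function.support (η n) ⊆ Metric.ball 0 (δ n)) (hδ : Tendsto δ atTop (𝓝 0))
    {F : Plane → ℝ} (hF : MemLp F 2 volume) :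
    Tendsto (fun n => eLpNorm (mollify (η n) F - F) 2 volume) atTop (𝓝 0) := by
  rw [ENNReal.tendsto_nhds_zero]
  intro ε hε
  have hε3 : ε / 3 ≠ 0 := (ENNReal.div_pos hε.ne' (by simp)).ne'
  obtain ⟨G, hGc, hFG, hG, hGL⟩ := hF.exists_hasCompactSupport_eLpNorm_sub_le (by simp) hε3
  have h1 := ENNReal.tendsto_nhds_zero.1 (tendsto_mollify_of_continuous hη hηδ hδ hG hGc) _
    (pos_iff_ne_zero.2 hε3)
  filter_upwards [h1] with n hn
  have hms : ∀ {E : Plane → ℝ}, MemLp E 2 volume → AEStronglyMeasurable (mollify (η n) E) volume := fun hE =>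
    (contDiff_mollify (hE.locallyIntegrable one_le_two) ((hη n).contDiff.of_le (by simp))
      (hη n).hasCompactSupport).continuous.aestronglyMeasurable
  have hsplit : mollify (η n) F - F = mollify (η n) (F - G) + (mollify (η n) G - G) + (G - F) := by
    rw [mollify_sub (hη n) hF hGL]
    abel
  rw [hsplit]
  refine (eLpNorm_add_le ((hms (hF.sub hGL)).add ((hms hGL).sub hGL.aestronglyMeasurable))
    (hGL.sub hF).aestronglyMeasurable one_le_two).trans ?_
  refine (add_le_add_left (eLpNorm_add_le (hms (hF.sub hGL)) ((hms hGL).sub hGL.aestronglyMeasurable)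
    one_le_two) _).trans ?_
  have h2 : eLpNorm (G - F) 2 volume ≤ ε / 3 := by rwa [eLpNorm_sub_comm]
  have h3 := (eLpNorm_mollify_le (hη n) (hF.sub hGL).aestronglyMeasurable).trans hFG
  refine (add_le_add (add_le_add h3 hn) h2).trans (le_of_eq (ENNReal.add_thirds ε))

/-- Kernels concentrated near `-ε • d`. -/
lemma exists_kernel (d : Plane) {ε : ℝ} (hε : 0 < ε) :
    ∃ η, IsKernel η ∧ tsupport η ⊆ Metric.closedBall (-(ε • d)) ε ∧
      Function.support η ⊆ Metric.ball 0 ((‖d‖ + 1) * ε) := by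
  -- The minus sign makes mollification at `x` average over the ball of radius `ε` around `x + ε •
  -- d`.
  let φ : ContDiffBump (-(ε • d)) := ⟨ε / 2, ε, by positivity, half_lt_self hε⟩
  refine ⟨φ.normed volume, ⟨φ.contDiff_normed, φ.hasCompactSupport_normed, φ.nonneg_normed, φ.integral_normed⟩,
    φ.tsupport_normed_eq.subset, ?_⟩
  rw [φ.support_normed_eq]
  intro z hz
  rw [Metric.mem_ball, dist_eq_norm, sub_neg_eq_add] at hz
  rw [Metric.mem_ball, dist_zero_right]
  have h1 : ‖z‖ ≤ ‖z + ε • d‖ + ‖ε • d‖ := by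
    have := norm_sub_le (z + ε • d) (ε • d)
    rwa [add_sub_cancel_right] at this
  rw [norm_smul, Real.norm_of_nonneg hε.le] at h1
  change _ < ε at hz
  nlinarith

/-! ### Density of `C¹(Ω̄)` in `H¹(Ω)` -/

/-- Near each point of the closure, a bounded Lipschitz domain can be pushed inside itself. -/
lemma IsLipschitzDomain.exists_shift {Ω : Set Plane} (hΩ : IsLipschitzDomain Ω) {x : Plane}
    (hx : x ∈ closure Ω) : ∃ U, IsOpen U ∧ x ∈ U ∧ ∃ d : Plane, ∀ k, IsCompact k → k ⊆ U → ∃ ε₀ > 0,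
      ∀ ε, 0 < ε → ε < ε₀ → ∀ y ∈ k ∩ Ω, Metric.closedBall (y + ε • d) ε ⊆ Ω := by
  by_cases hxΩ : x ∈ Ω
  · refine ⟨Ω, hΩ.isOpen, hxΩ, 0, fun k hk hkΩ => ?_⟩
    obtain ⟨δ, hδ, h⟩ := hk.exists_cthickening_subset_open hΩ.isOpen hkΩ
    refine ⟨δ, hδ, fun ε _ hε y hy => ?_⟩
    rw [smul_zero, add_zero]
    exact (Metric.closedBall_subset_closedBall hε.le).trans
      ((Metric.closedBall_subset_cthickening hy.1 δ).trans h)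
  · have hxf : x ∈ frontier Ω := by
      rw [hΩ.isOpen.frontier_eq]
      exact ⟨hx, hxΩ⟩
    obtain ⟨U, e, K, γ, hxU, hU⟩ := hΩ.exists_chart hxf
    -- Rising by `(K + 2) * ε` outweighs the rise `K * ε` of the graph over a horizontal distance
    -- `ε` and the possible descent `ε` within the ball.
    refine ⟨U, hU.isOpen, hxU, ((K : ℝ) + 2) • chartDir e 1, fun k hk hkU => ?_⟩
    obtain ⟨δ, hδ, h⟩ := hk.exists_cthickening_subset_open hU.isOpen hkU
    have hK : (0 : ℝ) ≤ K := K.2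
    -- The total displacement is at most `(K + 2) * ε + ε`, which must stay below `δ` to remain in
    -- the chart.
    refine ⟨δ / (K + 3), by positivity, fun ε hε0 hε y hy z hz => ?_⟩
    rw [lt_div_iff₀ (by positivity)] at hε
    rw [Metric.mem_closedBall, dist_eq_norm] at hz
    set w := z - (y + ε • ((K : ℝ) + 2) • chartDir e 1) with hw
    have hzw : z - y = ε • ((K : ℝ) + 2) • chartDir e 1 + w := by rw [hw]; abel
    have hzU : z ∈ U := by
      refine h (Metric.mem_cthickening_of_dist_le z y δ k hy.1 ?_)
      rw [dist_eq_norm, hzw]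
      refine (norm_add_le _ _).trans ?_
      rw [norm_smul, norm_smul, norm_chartDir, Real.norm_of_nonneg hε0.le, Real.norm_of_nonneg (by positivity)]
      linarith
    have hez : e z = e y + (ε • ((K : ℝ) + 2) • EuclideanSpace.single 1 1 + e w) := by
      have : z = y + (ε • ((K : ℝ) + 2) • chartDir e 1 + w) := by rw [← hzw]; abel
      rw [this, map_add, map_add, map_smul, map_smul, chartDir, LinearIsometryEquiv.apply_symm_apply]
    have h0 : e z 0 = e y 0 + e w 0 := by rw [hez]; simp
    have h1 : e z 1 = e y 1 + (ε * (K + 2) + e w 1) := by rw [hez]; simp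
    have hw0 : |e w 0| ≤ ε := by
      have := PiLp.norm_apply_le (e w) 0
      rw [e.norm_map] at this
      exact this.trans hz
    have hw1 : |e w 1| ≤ ε := by
      have := PiLp.norm_apply_le (e w) 1
      rw [e.norm_map] at this
      exact this.trans hz
    have hyΩ := (hU.mem_iff y (hkU hy.1)).1 hy.2
    have hγ := hU.lipschitz.dist_le_mul (e z 0) (e y 0)
    rw [Real.dist_eq, Real.dist_eq, show e z 0 - e y 0 = e w 0 by rw [h0]; ring] at hγ
    rw [hU.mem_iff z hzU, h1]
    have h2 := (abs_le.1 hγ).2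
    have h3 := (abs_le.1 hw1).1
    have h4 : (K : ℝ) * |e w 0| ≤ K * ε := by gcongr
    linarith

section

variable {Ω : Set Plane} {f : Plane → ℝ}

/-- Test the weak derivative of `f` with `χ * φ` and expand by the product rule. -/
lemma HasWeakPDeriv.cutoff_mul {j : Fin 2} {h χ : Plane → ℝ} (hf : MemLp f 2 (volume.restrict Ω))
    (hh : MemLp h 2 (volume.restrict Ω)) (hw : HasWeakPDeriv Ω j f h) (hχ : ContDiff ℝ ∞ χ)
    (hχc : HasCompactSupport χ) :
    HasWeakPDeriv Ω j (fun x => χ x * f x) (fun x => χ x * h x + f x * pderiv j χ x) := by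
  intro φ hφ hφc hφΩ
  have h1 := hw (fun x => χ x * φ x) (hχ.mul hφ) hφc.mul_left
    ((closure_mono (Function.support_mul_subset_right _ _)).trans hφΩ)
  have hd : ∀ {ψ : Plane → ℝ}, ContDiff ℝ ∞ ψ → ∀ x, DifferentiableAt ℝ ψ x := fun hψ x =>
    hψ.differentiable (by simp) x
  have h2 : ∀ x, f x * pderiv j (fun x => χ x * φ x) x =
      χ x * f x * pderiv j φ x + f x * (φ x * pderiv j χ x) := fun x => by
    rw [pderiv_mul (hd hχ x) (hd hφ x)]
    ring
  have hχφ : ∀ {p : Plane → ℝ}, Continuous p → MemLp (fun x => φ x * p x) 2 (volume.restrict Ω) := fun hp =>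
    ((hφ.continuous.mul hp).memLp_of_hasCompactSupport hφc.mul_right).restrict Ω
  have hχd : Continuous (pderiv j χ) := ContDiff.continuous_pderiv (hχ.of_le (by simp)) j
  have hi1 : Integrable (fun x => χ x * f x * pderiv j φ x) (volume.restrict Ω) := by
    have hm : MemLp (fun x => χ x * pderiv j φ x) 2 (volume.restrict Ω) :=
      ((hχ.continuous.mul (ContDiff.continuous_pderiv (hφ.of_le (by simp)) j)).memLp_of_hasCompactSupport
        hχc.mul_right).restrict Ω
    refine (integrable_mul_of_memLp_two hf hm).congr (Eventually.of_forall fun x => ?_)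
    simp only
    ring
  have hi2 : Integrable (fun x => f x * (φ x * pderiv j χ x)) (volume.restrict Ω) :=
    integrable_mul_of_memLp_two hf (hχφ hχd)
  have hi3 : Integrable (fun x => h x * (χ x * φ x)) (volume.restrict Ω) := by
    refine (integrable_mul_of_memLp_two hh (hχφ hχ.continuous)).congr (Eventually.of_forall fun x => ?_)
    simp only
    ring
  simp only [h2] at h1
  rw [integral_add hi1 hi2] at h1
  have h3 : ∫ x in Ω, (χ x * h x + f x * pderiv j χ x) * φ x =
      (∫ x in Ω, h x * (χ x * φ x)) + ∫ x in Ω, f x * (φ x * pderiv j χ x) := by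
    rw [← integral_add hi3 hi2]
    refine integral_congr_ae (Eventually.of_forall fun x => ?_)
    simp only
    ring
  rw [h3]
  linarith

lemma memLp_cutoff_mul {χ : Plane → ℝ} (hf : MemLp f 2 (volume.restrict Ω)) (hχ : Continuous χ)
    (hχc : HasCompactSupport χ) : MemLp (fun x => χ x * f x) 2 (volume.restrict Ω) := by
  obtain ⟨C, hC⟩ := hχc.exists_bound_of_continuous hχ
  exact MemLp.of_le_mul (c := C) hf (hχ.aestronglyMeasurable.mul hf.aestronglyMeasurable)
    (Eventually.of_forall fun x => by
      rw [norm_mul]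
      gcongr
      exact hC x)

/-- The functions `φ n`, smooth up to the boundary, approximate `f` and its gradient `h`. -/
def ApproximatesH1 (Ω : Set Plane) (φ : ℕ → Plane → ℝ) (f : Plane → ℝ) (h : Fin 2 → Plane → ℝ) : Prop :=
  (∀ n, ContDiff ℝ 1 (φ n)) ∧ Tendsto (fun n => eLpNorm (φ n - f) 2 (volume.restrict Ω)) atTop (𝓝 0) ∧
    ∀ j, Tendsto (fun n => eLpNorm (pderiv j (φ n) - h j) 2 (volume.restrict Ω)) atTop (𝓝 0)

lemma tendsto_eLpNorm_add {X : Type*} [MeasurableSpace X] {μ : Measure X} {a b : ℕ → X → ℝ}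
    (ham : ∀ n, AEStronglyMeasurable (a n) μ) (hbm : ∀ n, AEStronglyMeasurable (b n) μ)
    (ha : Tendsto (fun n => eLpNorm (a n) 2 μ) atTop (𝓝 0))
    (hb : Tendsto (fun n => eLpNorm (b n) 2 μ) atTop (𝓝 0)) :
    Tendsto (fun n => eLpNorm (a n + b n) 2 μ) atTop (𝓝 0) := by
  have h := ha.add hb
  rw [add_zero] at h
  exact tendsto_of_tendsto_of_tendsto_of_le_of_le tendsto_const_nhds h (fun _ => zero_le)
    fun n => eLpNorm_add_le (ham n) (hbm n) one_le_two

/-- Extension by zero may destroy weak differentiability across the boundary. The shifted kernels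
avoid the boundary: at points of `Ω` near the support of `χ` they see only `Ω`, so mollification
commutes with differentiation there, and at points far from the support both sides are zero. -/
lemma exists_approximatesH1_cutoff (hΩ : IsOpen Ω) (hf : MemH1 Ω f) {U : Set Plane} (hU : IsOpen U) {d : Plane}
    (hd : ∀ k, IsCompact k → k ⊆ U → ∃ ε₀ > 0,
      ∀ ε, 0 < ε → ε < ε₀ → ∀ y ∈ k ∩ Ω, Metric.closedBall (y + ε • d) ε ⊆ Ω)
    {χ : Plane → ℝ} (hχ : ContDiff ℝ ∞ χ) (hχc : HasCompactSupport χ) (hχU : tsupport χ ⊆ U) :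
    ∃ φ, ApproximatesH1 Ω φ (fun x => χ x * f x)
      fun j x => χ x * weakPDeriv Ω j f x + f x * pderiv j χ x := by
  obtain ⟨δ, hδ, hδU⟩ := hχc.isCompact.exists_cthickening_subset_open hU hχU
  obtain ⟨ε₀, hε₀, hball⟩ := hd _ hχc.isCompact.cthickening hδU
  set h : Fin 2 → Plane → ℝ := fun j x => χ x * weakPDeriv Ω j f x + f x * pderiv j χ x with hh
  set v : Plane → ℝ := fun x => χ x * f x with hv
  have hχ1 : ContDiff ℝ 1 χ := hχ.of_le (by simp)
  have hvL : MemLp v 2 (volume.restrict Ω) := memLp_cutoff_mul hf.1 hχ.continuous hχc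
  have hhL : ∀ j, MemLp (h j) 2 (volume.restrict Ω) := fun j => by
    refine (memLp_cutoff_mul (hf.weakPDeriv_spec j).1 hχ.continuous hχc).add ?_
    have := memLp_cutoff_mul hf.1 (ContDiff.continuous_pderiv hχ1 j) (hχc.fderiv_apply ℝ _)
    simpa only [mul_comm] using this
  have hw : ∀ j, HasWeakPDeriv Ω j v (h j) := fun j =>
    (hf.weakPDeriv_spec j).2.cutoff_mul hf.1 (hf.weakPDeriv_spec j).1 hχ hχc
  have hv0 : ∀ x ∉ tsupport χ, v x = 0 := fun x hx => by
    simp only [hv, image_eq_zero_of_notMem_tsupport hx, zero_mul]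
  have hh0 : ∀ j, ∀ x ∉ tsupport χ, h j x = 0 := fun j x hx => by
    have : pderiv j χ x = 0 := by
      rw [pderiv, image_eq_zero_of_notMem_tsupport fun h => hx (tsupport_fderiv_subset ℝ h)]
      rfl
    simp only [hh, this, image_eq_zero_of_notMem_tsupport hx, zero_mul, mul_zero, add_zero]
  -- The first bound keeps the averaging balls in `Ω`; the second prevents a kernel centred outside
  -- the `δ`-thickening from reaching the support of `χ`.
  set ε₁ : ℝ := min (ε₀ / 2) (δ / (‖d‖ + 1)) with hε₁
  have hε₁0 : 0 < ε₁ := lt_min (by positivity) (by positivity)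
  set ε : ℕ → ℝ := fun n => ε₁ * (1 / ((n : ℝ) + 1)) with hε
  have hεpos : ∀ n, 0 < ε n := fun n => mul_pos hε₁0 Nat.one_div_pos_of_nat
  have hεle : ∀ n, ε n ≤ ε₁ := fun n => mul_le_of_le_one_right hε₁0.le (by
    rw [div_le_one (by positivity)]
    linarith [(Nat.cast_nonneg n : (0 : ℝ) ≤ n)])
  have hεlim : Tendsto ε atTop (𝓝 0) := by
    have := tendsto_one_div_add_atTop_nhds_zero_nat (𝕜 := ℝ).const_mul ε₁
    rwa [mul_zero] at this
  choose η hη hηt hηs using fun n => exists_kernel d (hεpos n)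
  have hvloc := locallyIntegrable_indicator hΩ hvL
  have hφ : ∀ n, ContDiff ℝ 1 (mollify (η n) (Ω.indicator v)) := fun n =>
    contDiff_mollify hvloc ((hη n).contDiff.of_le (by simp)) (hη n).hasCompactSupport
  have hδlim : Tendsto (fun n => (‖d‖ + 1) * ε n) atTop (𝓝 0) := by
    have := hεlim.const_mul (‖d‖ + 1)
    rwa [mul_zero] at this
  have hpd : ∀ n j, ∀ x ∈ Ω, pderiv j (mollify (η n) (Ω.indicator v)) x = mollify (η n) (Ω.indicator (h j)) x := by
    intro n j x hx
    by_cases hxk : x ∈ Metric.cthickening δ (tsupport χ)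
    · refine (hw j).pderiv_mollify hΩ hvloc (hη n).contDiff (hη n).hasCompactSupport fun y hy => ?_
      refine hball (ε n) (hεpos n) ((hεle n).trans_lt ((min_le_left _ _).trans_lt (half_lt_self hε₀))) x ⟨hxk, hx⟩ ?_
      have := hηt n hy
      rw [Metric.mem_closedBall, dist_eq_norm] at this ⊢
      rw [← norm_neg]
      convert! this using 2
      abel
    · have hy : ∀ y ∈ tsupport χ, x - y ∉ tsupport (η n) := fun y hy h' => by
        refine hxk (Metric.mem_cthickening_of_dist_le x y δ _ hy ?_)
        have h1 := hηt n h'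
        rw [Metric.mem_closedBall, dist_eq_norm, sub_neg_eq_add] at h1
        have h2 : ‖x - y‖ ≤ ‖x - y + ε n • d‖ + ‖ε n • d‖ := by
          have := norm_sub_le (x - y + ε n • d) (ε n • d)
          rwa [add_sub_cancel_right] at this
        rw [norm_smul, Real.norm_of_nonneg (hεpos n).le] at h2
        have h3 : ε n * (‖d‖ + 1) ≤ δ := by
          rw [← le_div_iff₀ (by positivity)]
          exact (hεle n).trans (min_le_right _ _)
        rw [dist_eq_norm]
        linarith
      have hz : ∀ (F p : Plane → ℝ), (∀ z ∉ tsupport χ, F z = 0) → (∀ z ∉ tsupport (η n), p z = 0) →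
          mollify p (Ω.indicator F) x = 0 := by
        intro F p hF hp
        rw [mollify, ← integral_zero Plane ℝ (μ := volume)]
        refine integral_congr_ae (Eventually.of_forall fun y => ?_)
        by_cases hyχ : y ∈ tsupport χ
        · simp only [hp _ (hy y hyχ), mul_zero]
        · simp only [indicator, hF y hyχ, ite_self, zero_mul]
      rw [pderiv_mollify hvloc ((hη n).contDiff.of_le (by simp)) (hη n).hasCompactSupport,
        hz v _ hv0 fun z hz => ?_, hz (h j) _ (hh0 j) fun z hz => image_eq_zero_of_notMem_tsupport hz]
      rw [pderiv, image_eq_zero_of_notMem_tsupport fun h => hz (tsupport_fderiv_subset ℝ h)]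
      rfl
  have hlim : ∀ {F : Plane → ℝ}, MemLp F 2 (volume.restrict Ω) →
      Tendsto (fun n => eLpNorm (mollify (η n) (Ω.indicator F) - F) 2 (volume.restrict Ω)) atTop (𝓝 0) := by
    intro F hF
    have h1 := tendsto_mollify hη hηs hδlim ((memLp_indicator_iff_restrict hΩ.measurableSet).2 hF)
    refine tendsto_of_tendsto_of_tendsto_of_le_of_le tendsto_const_nhds h1 (fun _ => zero_le) fun n => ?_
    refine le_trans (le_of_eq (eLpNorm_congr_ae ?_)) (eLpNorm_mono_measure _ Measure.restrict_le_self)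
    filter_upwards [ae_restrict_mem hΩ.measurableSet] with x hx
    rw [Pi.sub_apply, Pi.sub_apply, indicator_of_mem hx]
  refine ⟨fun n => mollify (η n) (Ω.indicator v), hφ, hlim hvL, fun j => ?_⟩
  refine (hlim (hhL j)).congr fun n => eLpNorm_congr_ae ?_
  filter_upwards [ae_restrict_mem hΩ.measurableSet] with x hx
  rw [Pi.sub_apply, Pi.sub_apply, hpd n j x hx]

/-- Functions that are smooth up to the boundary are dense in `H¹(Ω)`. -/
theorem IsLipschitzDomain.exists_approximatesH1 (hΩ : IsLipschitzDomain Ω) (hf : MemH1 Ω f) :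
    ∃ φ, ApproximatesH1 Ω φ f fun j => weakPDeriv Ω j f := by
  have key : ∃ χ : Plane → ℝ, ContDiff ℝ ∞ χ ∧ HasCompactSupport χ ∧ (∀ᶠ x in 𝓝ˢ (closure Ω), χ x = 1) ∧
      ∃ φ, ApproximatesH1 Ω φ (fun x => χ x * f x)
        fun j x => χ x * weakPDeriv Ω j f x + f x * pderiv j χ x := by
    refine exists_cutoff_of_local hΩ.isCompact_closure (fun χ => ∃ φ, ApproximatesH1 Ω φ (fun x => χ x * f x)
      fun j x => χ x * weakPDeriv Ω j f x + f x * pderiv j χ x) ?_ ?_ fun x hx => ?_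
    · refine ⟨fun _ _ => 0, fun _ => contDiff_const, ?_, fun j => ?_⟩
      · have : ((fun _ => 0 : Plane → ℝ) - fun x => 0 * f x) = 0 := by ext; simp
        simp only [this, eLpNorm_zero]
        exact tendsto_const_nhds
      · have : (pderiv j (fun _ => 0 : Plane → ℝ) - fun x => 0 * weakPDeriv Ω j f x +
            f x * pderiv j (fun _ => 0) x) = 0 := by ext; simp [pderiv]
        simp only [this, eLpNorm_zero]
        exact tendsto_const_nhds
    · rintro χ θ hχ hχc hθ hθc ⟨φ, h1, h2, h3⟩ ⟨ψ, h4, h5, h6⟩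
      have hm : ∀ {χ : Plane → ℝ}, ContDiff ℝ ∞ χ → AEStronglyMeasurable (fun x => χ x * f x) (volume.restrict Ω) :=
        fun hχ => hχ.continuous.aestronglyMeasurable.mul hf.1.aestronglyMeasurable
      have hm' : ∀ {χ : Plane → ℝ}, ContDiff ℝ ∞ χ → ∀ j, AEStronglyMeasurable
          (fun x => χ x * weakPDeriv Ω j f x + f x * pderiv j χ x) (volume.restrict Ω) := fun hχ j =>
        (hχ.continuous.aestronglyMeasurable.mul (hf.weakPDeriv_spec j).1.aestronglyMeasurable).add
          (hf.1.aestronglyMeasurable.mul (ContDiff.continuous_pderiv (hχ.of_le (by simp)) j).aestronglyMeasurable)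
      refine ⟨fun n x => φ n x + ψ n x, fun n => (h1 n).add (h4 n), ?_, fun j => ?_⟩
      · refine (tendsto_eLpNorm_add (fun n => (h1 n).continuous.aestronglyMeasurable.sub (hm hχ))
          (fun n => (h4 n).continuous.aestronglyMeasurable.sub (hm hθ)) h2 h5).congr fun n => ?_
        congr 1
        ext x
        simp only [Pi.add_apply, Pi.sub_apply]
        ring
      · refine (tendsto_eLpNorm_add
          (fun n => (ContDiff.continuous_pderiv (h1 n) j).aestronglyMeasurable.sub (hm' hχ j))
          (fun n => (ContDiff.continuous_pderiv (h4 n) j).aestronglyMeasurable.sub (hm' hθ j))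
          (h3 j) (h6 j)).congr fun n => ?_
        congr 1
        ext x
        simp only [Pi.add_apply, Pi.sub_apply]
        rw [pderiv_add ((h1 n).differentiable one_ne_zero x) ((h4 n).differentiable one_ne_zero x),
          pderiv_add (hχ.differentiable (by simp) x) (hθ.differentiable (by simp) x)]
        ring
    · obtain ⟨U, hU, hxU, d, hd⟩ := hΩ.exists_shift hx
      exact ⟨U, hU, hxU, fun χ hχ hχc hχU => exists_approximatesH1_cutoff hΩ.isOpen hf hU hd hχ hχc hχU⟩
  obtain ⟨χ, hχ, hχc, hχ1, φ, h1, h2, h3⟩ := key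
  refine ⟨φ, h1, h2.congr fun n => eLpNorm_congr_ae ?_, fun j => (h3 j).congr fun n => eLpNorm_congr_ae ?_⟩
  · filter_upwards [ae_restrict_mem hΩ.isOpen.measurableSet] with x hx
    simp only [Pi.sub_apply, hχ1.self_of_nhdsSet x (subset_closure hx), one_mul]
  · filter_upwards [ae_restrict_mem hΩ.isOpen.measurableSet] with x hx
    -- Since `χ` is one on a neighbourhood of the closure, its derivative term drops out.
    have : χ =ᶠ[𝓝 x] fun _ => 1 := (eventually_nhdsSet_iff_forall.1 hχ1) x (subset_closure hx)
    simp only [Pi.sub_apply, hχ1.self_of_nhdsSet x (subset_closure hx), one_mul, pderiv_congr this]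
    simp [pderiv]

end

/-! ### The trace theorem -/

section

variable {Ω : Set Plane}

lemma pderiv_sq {ψ : Plane → ℝ} {x : Plane} (hψ : DifferentiableAt ℝ ψ x) (j : Fin 2) :
    pderiv j (fun y => ψ y ^ 2) x = 2 * ψ x * pderiv j ψ x := by
  simp only [pow_two]
  rw [pderiv_mul hψ hψ]
  ring

/-- The boundary integral of `ψ²`, for `ψ` supported in a graph chart, as a volume integral. -/
lemma IsGraphChart.integral_sq_le (hΩ : IsLipschitzDomain Ω) {U : Set Plane} {e : Plane ≃ₗᵢ[ℝ] Plane}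
    {K : ℝ≥0} {γ : ℝ → ℝ} (h : IsGraphChart Ω U e K γ) {ψ : Plane → ℝ} (hψ : IsC1Closure Ω ψ)
    {k : Set Plane} (hk : IsCompact k) (hkU : k ⊆ U) (hψ0 : ∀ y ∉ k, ψ y = 0) :
    ∫ y, ψ y ^ 2 ∂(arcLength Ω) ≤
      (1 + K) * ∫ x in Ω, ∑ j, -(chartDir e 1 j) * (2 * ψ x * pderiv j ψ x) := by
  have hΩo := hΩ.isOpen
  set d := chartDir e 1 with hd
  -- The downward chart direction is transversal to the graph: its inner product with the
  -- unnormalised normal is one, so the flux is exactly `ψ ^ 2`. The factor `1 + K` then bounds the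
  -- arc length density.
  set H : Plane → Plane := fun y => (ψ y ^ 2) • (-d) with hH
  have hdiv : ∀ x ∈ Ω, vdiv H x = ∑ j, -(d j) * (2 * ψ x * pderiv j ψ x) := fun x hx => by
    have hψd := hψ.differentiableAt hΩo hx
    rw [hH, vdiv_smul (f := fun y => ψ y ^ 2) (F := fun _ => -d) (hψd.pow 2) (differentiableAt_const _)]
    have h0 : vdiv (fun _ => -d) x = 0 := by simp [vdiv, pderiv]
    rw [h0, mul_zero, zero_add]
    exact Finset.sum_congr rfl fun j _ => by rw [pderiv_sq hψd]; rfl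
  have hint : IntegrableOn (fun x => ∑ j, -(d j) * (2 * ψ x * pderiv j ψ x)) Ω := by
    refine integrable_finsetSum _ fun j _ => Integrable.const_mul ?_ _
    have := (integrable_mul_of_memLp_two (hΩ.memLp_of_continuousOn hψ.continuousOn 2)
      (hΩ.memLp_pderiv hψ 2 j)).const_mul 2
    simpa only [mul_assoc] using this
  have hH0 : ∀ y ∉ k, H y = 0 := fun y hy => by simp [hH, hψ0 y hy]
  have hmain := h.integral_vdiv hΩo hk hkU hH0 ((hψ.continuousOn.pow 2).smul continuousOn_const)
    ((hψ.contDiffOn.pow 2).smul contDiffOn_const)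
    (hint.congr_fun (fun x hx => (hdiv x hx).symm) hΩo.measurableSet)
  have hinner : ∀ x, inner ℝ (H (graphPt e γ x)) (graphNormal e γ x) = ψ (graphPt e γ x) ^ 2 := fun x => by
    rw [hH]
    simp only
    rw [inner_smul_left, inner_graphNormal, map_neg, hd, chartDir, LinearIsometryEquiv.apply_symm_apply]
    simp
  rw [setIntegral_congr_fun hΩo.measurableSet hdiv] at hmain
  simp only [hinner] at hmain
  rw [hmain]
  -- the boundary integral in parametrised form
  have hm : MeasurableSet {y | e y 1 = γ (e y 0)} :=
    (isClosed_eq (by fun_prop) (by have := h.lipschitz.continuous; fun_prop)).measurableSet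
  have hpar : ∫ y, ψ y ^ 2 ∂(arcLength Ω) = ∫ x, arcDensity γ x * ψ (graphPt e γ x) ^ 2 := by
    rw [← integral_graph e h.lipschitz fun y => ψ y ^ 2, arcLength, ← integral_indicator hm,
      ← integral_indicator isClosed_frontier.measurableSet]
    congr 1
    ext y
    by_cases hy : y ∈ k
    · simp only [indicator, h.mem_frontier_iff hΩo (hkU hy), mem_ofPred_eq]
    · simp [indicator, hψ0 y hy]
  -- integrability of the parametrised integrand
  set G : Plane → ℝ := (frontier Ω).indicator fun y => ψ y ^ 2 with hG
  have hGψ : ∀ x, ψ (graphPt e γ x) ^ 2 = G (graphPt e γ x) := fun x => by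
    by_cases hx : graphPt e γ x ∈ k
    · rw [hG, indicator_of_mem]
      rw [h.mem_frontier_iff hΩo (hkU hx), graphPt_zero, graphPt_one]
    · simp [hG, indicator, hψ0 _ hx]
  have hψf : ContinuousOn (fun y => ψ y ^ 2) (frontier Ω) :=
    (hψ.continuousOn.mono frontier_subset_closure).pow 2
  have hGm : Measurable G := by
    classical
    rw [hG, ← piecewise_eq_indicator]
    exact hψf.measurable_piecewise continuousOn_const isClosed_frontier.measurableSet
  obtain ⟨M, hM⟩ := hΩ.isCompact_frontier.exists_bound_of_continuousOn hψf
  obtain ⟨R, hR⟩ := hk.isBounded.subset_closedBall 0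
  have hGi : Integrable fun x => G (graphPt e γ x) := by
    refine Integrable.mono' (g := (Icc (-R) R).indicator fun _ => |M|) ?_
      (hGm.comp (continuous_graphPt e h.lipschitz.continuous).measurable).aestronglyMeasurable
      (Eventually.of_forall fun x => ?_)
    · rw [integrable_indicator_iff measurableSet_Icc]
      exact integrableOn_const (by simp)
    · by_cases hx : graphPt e γ x ∈ k
      · have h1 := hR hx
        rw [Metric.mem_closedBall, dist_zero_right, ← e.norm_map] at h1
        have h2 := PiLp.norm_apply_le (e (graphPt e γ x)) 0
        rw [graphPt_zero, Real.norm_eq_abs] at h2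
        rw [indicator_of_mem (show x ∈ Icc (-R) R from abs_le.1 (h2.trans h1)), ← hGψ]
        refine (hM _ ?_).trans (le_abs_self M)
        rw [h.mem_frontier_iff hΩo (hkU hx), graphPt_zero, graphPt_one]
      · rw [← hGψ, hψ0 _ hx]
        simpa using indicator_nonneg (fun _ _ => abs_nonneg M) x
  rw [hpar, ← integral_const_mul]
  simp only [hGψ]
  have hG0 : ∀ x, 0 ≤ G x := fun x => indicator_nonneg (fun _ _ => sq_nonneg _) x
  refine integral_mono_of_nonneg (Eventually.of_forall fun x => ?_) (hGi.const_mul _)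
    (Eventually.of_forall fun x => ?_)
  · exact mul_nonneg (by linarith [one_le_arcDensity γ x]) (hG0 _)
  · exact mul_le_mul_of_nonneg_right (arcDensity_le h.lipschitz x) (hG0 _)

lemma IsC1Closure.mul_of_contDiff {χ φ : Plane → ℝ} (hΩ : IsOpen Ω) (hχ : ContDiff ℝ 1 χ)
    (hφ : IsC1Closure Ω φ) : IsC1Closure Ω fun x => χ x * φ x := by
  refine ⟨hχ.continuous.continuousOn.mul hφ.continuousOn, hχ.contDiffOn.mul hφ.contDiffOn, fun x hx => ?_⟩
  obtain ⟨L, hL⟩ := hφ.extends_fderiv x hx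
  have hφx : Tendsto φ (𝓝[Ω] x) (𝓝 (φ x)) :=
    (hφ.continuousOn x (frontier_subset_closure hx)).mono subset_closure
  have hχx : Tendsto χ (𝓝[Ω] x) (𝓝 (χ x)) := (hχ.continuous.tendsto x).mono_left nhdsWithin_le_nhds
  have hχ' : Tendsto (fderiv ℝ χ) (𝓝[Ω] x) (𝓝 (fderiv ℝ χ x)) :=
    ((hχ.continuous_fderiv one_ne_zero).tendsto x).mono_left nhdsWithin_le_nhds
  refine ⟨_, ((hχx.smul hL).add (hφx.smul hχ')).congr' ?_⟩
  filter_upwards [self_mem_nhdsWithin] with y hy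
  exact (fderiv_fun_mul (hχ.differentiable one_ne_zero y) (hφ.differentiableAt hΩ hy)).symm

/-- The square of the norm of `H¹(Ω)` on `C¹(Ω̄)`. -/
def h1NormSq (Ω : Set Plane) (φ : Plane → ℝ) : ℝ := ∫ x in Ω, (φ x ^ 2 + ∑ j, pderiv j φ x ^ 2)

lemma integrableOn_h1NormSq (hΩ : IsLipschitzDomain Ω) {φ : Plane → ℝ} (hφ : IsC1Closure Ω φ) :
    IntegrableOn (fun x => φ x ^ 2 + ∑ j, pderiv j φ x ^ 2) Ω :=
  (hΩ.memLp_of_continuousOn hφ.continuousOn 2).integrable_sq.add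
    (integrable_finsetSum _ fun j _ => (hΩ.memLp_pderiv hφ 2 j).integrable_sq)

lemma IsGraphChart.trace_inequality (hΩ : IsLipschitzDomain Ω) {U : Set Plane} {e : Plane ≃ₗᵢ[ℝ] Plane}
    {K : ℝ≥0} {γ : ℝ → ℝ} (h : IsGraphChart Ω U e K γ) {χ : Plane → ℝ} (hχ : ContDiff ℝ 1 χ)
    (hχc : HasCompactSupport χ) (hχU : tsupport χ ⊆ U) :
    ∃ C : ℝ, 0 ≤ C ∧ ∀ φ, IsC1Closure Ω φ → ∫ y, (χ y * φ y) ^ 2 ∂(arcLength Ω) ≤ C * h1NormSq Ω φ := by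
  obtain ⟨M₀, hM₀⟩ := hχc.exists_bound_of_continuous hχ.continuous
  obtain ⟨M₁, hM₁⟩ := (hχc.fderiv ℝ).exists_bound_of_continuous (hχ.continuous_fderiv one_ne_zero)
  set M := max M₀ M₁ with hM
  have hMχ : ∀ x, |χ x| ≤ M := fun x => (hM₀ x).trans (le_max_left _ _)
  have hM0 : 0 ≤ M := (abs_nonneg _).trans (hMχ 0)
  have hMd : ∀ j x, |pderiv j χ x| ≤ M := fun j x => by
    refine ((fderiv ℝ χ x).le_opNorm _).trans ?_
    have : ‖(EuclideanSpace.single j (1 : ℝ) : Plane)‖ = 1 := by simp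
    rw [this, mul_one]
    exact (hM₁ x).trans (le_max_right _ _)
  -- Young's inequality bounds each of the two directional terms by `3 * M ^ 2 * φ ^ 2` plus `M ^ 2`
  -- times a squared derivative; `M` bounds `χ` and its gradient.
  refine ⟨(1 + K) * (6 * M ^ 2), by positivity, fun φ hφ => ?_⟩
  have hψ := hφ.mul_of_contDiff hΩ.isOpen hχ
  refine (h.integral_sq_le hΩ hψ hχc.isCompact hχU fun y hy => by
    rw [image_eq_zero_of_notMem_tsupport hy, zero_mul]).trans ?_
  rw [mul_assoc]
  refine mul_le_mul_of_nonneg_left ?_ (by positivity)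
  rw [h1NormSq, ← integral_const_mul]
  refine setIntegral_mono_on ?_ ((integrableOn_h1NormSq hΩ hφ).const_mul _) hΩ.isOpen.measurableSet
    fun x hx => ?_
  · refine integrable_finsetSum _ fun j _ => Integrable.const_mul ?_ _
    have := (integrable_mul_of_memLp_two (hΩ.memLp_of_continuousOn hψ.continuousOn 2)
      (hΩ.memLp_pderiv hψ 2 j)).const_mul 2
    simpa only [mul_assoc] using this
  · have hterm : ∀ j, -(chartDir e 1 j) * (2 * (χ x * φ x) * pderiv j (fun y => χ y * φ y) x) ≤
        3 * M ^ 2 * φ x ^ 2 + M ^ 2 * pderiv j φ x ^ 2 := fun j => by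
      rw [pderiv_mul (hχ.differentiable one_ne_zero x) (hφ.differentiableAt hΩ.isOpen hx)]
      have hd : |chartDir e 1 j| ≤ 1 := by
        have := PiLp.norm_apply_le (chartDir e 1) j
        rwa [norm_chartDir] at this
      set p := pderiv j φ x
      set q := pderiv j χ x
      have hq : |q| ≤ M := hMd j x
      have hc := hMχ x
      calc -(chartDir e 1 j) * (2 * (χ x * φ x) * (χ x * p + φ x * q))
          ≤ |-(chartDir e 1 j) * (2 * (χ x * φ x) * (χ x * p + φ x * q))| := le_abs_self _
        _ ≤ 1 * (2 * (M * |φ x|) * (M * |p| + |φ x| * M)) := by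
          rw [abs_mul, abs_neg, abs_mul, abs_mul, abs_mul, abs_of_pos (zero_lt_two' ℝ)]
          gcongr
          refine (abs_add_le _ _).trans ?_
          rw [abs_mul, abs_mul]
          gcongr
        _ ≤ _ := by
          nlinarith [sq_abs (φ x), sq_abs p, mul_nonneg (sq_nonneg M) (sq_nonneg (|φ x| - |p|))]
    rw [Fin.sum_univ_two, Fin.sum_univ_two]
    have h0 := hterm 0
    have h1 := hterm 1
    nlinarith [mul_nonneg (sq_nonneg M) (sq_nonneg (pderiv 0 φ x)),
      mul_nonneg (sq_nonneg M) (sq_nonneg (pderiv 1 φ x))]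

/-- The **trace inequality** on a bounded Lipschitz domain. -/
theorem IsLipschitzDomain.trace_inequality (hΩ : IsLipschitzDomain Ω) :
    ∃ C : ℝ, 0 ≤ C ∧ ∀ φ, IsC1Closure Ω φ → ∫ y, φ y ^ 2 ∂(arcLength Ω) ≤ C * h1NormSq Ω φ := by
  have hi : ∀ {χ φ : Plane → ℝ}, ContDiff ℝ ∞ χ → IsC1Closure Ω φ →
      Integrable (fun y => (χ y * φ y) ^ 2) (arcLength Ω) := fun hχ hφ =>
    (hΩ.memLp_arcLength (hχ.continuous.continuousOn.mul
      (hφ.continuousOn.mono frontier_subset_closure)) 2).integrable_sq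
  have key : ∃ χ : Plane → ℝ, ContDiff ℝ ∞ χ ∧ HasCompactSupport χ ∧ (∀ᶠ x in 𝓝ˢ (closure Ω), χ x = 1) ∧
      ∃ C : ℝ, 0 ≤ C ∧ ∀ φ, IsC1Closure Ω φ →
        ∫ y, (χ y * φ y) ^ 2 ∂(arcLength Ω) ≤ C * h1NormSq Ω φ := by
    refine exists_cutoff_of_local hΩ.isCompact_closure (fun χ => ∃ C : ℝ, 0 ≤ C ∧ ∀ φ, IsC1Closure Ω φ →
        ∫ y, (χ y * φ y) ^ 2 ∂(arcLength Ω) ≤ C * h1NormSq Ω φ) ⟨0, le_rfl, by simp⟩ ?_ fun x hx => ?_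
    · rintro χ θ hχ - hθ - ⟨C, hC0, hC⟩ ⟨D, hD0, hD⟩
      refine ⟨2 * C + 2 * D, by positivity, fun φ hφ => ?_⟩
      calc ∫ y, ((χ y + θ y) * φ y) ^ 2 ∂(arcLength Ω)
          ≤ ∫ y, (2 * (χ y * φ y) ^ 2 + 2 * (θ y * φ y) ^ 2) ∂(arcLength Ω) := by
            refine integral_mono (hi (hχ.add hθ) hφ) (((hi hχ hφ).const_mul 2).add ((hi hθ hφ).const_mul 2))
              fun y => ?_
            simp only
            nlinarith [sq_nonneg (χ y * φ y - θ y * φ y)]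
        _ = 2 * (∫ y, (χ y * φ y) ^ 2 ∂(arcLength Ω)) + 2 * ∫ y, (θ y * φ y) ^ 2 ∂(arcLength Ω) := by
            rw [integral_add ((hi hχ hφ).const_mul 2) ((hi hθ hφ).const_mul 2), integral_const_mul,
              integral_const_mul]
        _ ≤ _ := by
            have := hC φ hφ
            have := hD φ hφ
            linarith
    · by_cases hxΩ : x ∈ Ω
      · refine ⟨Ω, hΩ.isOpen, hxΩ, fun χ hχ hχc hχΩ => ⟨0, le_rfl, fun φ hφ => ?_⟩⟩
        rw [zero_mul]
        refine (setIntegral_eq_zero_of_forall_eq_zero fun y hy => ?_).le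
        have : y ∉ tsupport χ := fun h => by
          rw [hΩ.isOpen.frontier_eq] at hy
          exact hy.2 (hχΩ h)
        rw [image_eq_zero_of_notMem_tsupport this, zero_mul, sq, zero_mul]
      · obtain ⟨U, e, K, γ, hxU, h⟩ := hΩ.exists_chart (x := x) (by
          rw [hΩ.isOpen.frontier_eq]
          exact ⟨hx, hxΩ⟩)
        exact ⟨U, h.isOpen, hxU, fun χ hχ hχc hχU => h.trace_inequality hΩ (hχ.of_le (by simp)) hχc hχU⟩
  obtain ⟨χ, -, -, hχ1, C, hC0, hC⟩ := key
  refine ⟨C, hC0, fun φ hφ => (le_of_eq ?_).trans (hC φ hφ)⟩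
  refine setIntegral_congr_fun isClosed_frontier.measurableSet fun y hy => ?_
  simp only [hχ1.self_of_nhdsSet y (frontier_subset_closure hy), one_mul]

lemma eLpNorm_two_sq_eq_ofReal {X : Type*} [MeasurableSpace X] {μ : Measure X} {f : X → ℝ} (hf : MemLp f 2 μ) :
    eLpNorm f 2 μ ^ 2 = ENNReal.ofReal (∫ x, f x ^ 2 ∂μ) := by
  rw [eLpNorm_two_sq, ofReal_integral_eq_lintegral_ofReal hf.integrable_sq
    (Eventually.of_forall fun x => sq_nonneg _)]
  refine lintegral_congr fun x => ?_
  rw [← Real.enorm_of_nonneg (sq_nonneg (f x)), enorm_pow]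

lemma IsLipschitzDomain.eLpNorm_trace_le (hΩ : IsLipschitzDomain Ω) :
    ∃ C : ℝ≥0∞, C ≠ ⊤ ∧ ∀ φ, IsC1Closure Ω φ → eLpNorm φ 2 (arcLength Ω) ≤
      C * (eLpNorm φ 2 (volume.restrict Ω) + ∑ j, eLpNorm (pderiv j φ) 2 (volume.restrict Ω)) := by
  obtain ⟨C, hC0, hC⟩ := hΩ.trace_inequality
  -- Norms are compared through their squares, and `C ≤ (C + 1) ^ 2` avoids a square root.
  refine ⟨ENNReal.ofReal (C + 1), ENNReal.ofReal_ne_top, fun φ hφ => ?_⟩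
  rw [← ENNReal.pow_le_pow_left_iff two_ne_zero, mul_pow,
    eLpNorm_two_sq_eq_ofReal (hΩ.memLp_arcLength (hφ.continuousOn.mono frontier_subset_closure) 2)]
  have hL := hΩ.memLp_of_continuousOn hφ.continuousOn 2
  have hLd := fun j => hΩ.memLp_pderiv hφ 2 j
  have hsum : ENNReal.ofReal (h1NormSq Ω φ) = eLpNorm φ 2 (volume.restrict Ω) ^ 2 +
      ∑ j, eLpNorm (pderiv j φ) 2 (volume.restrict Ω) ^ 2 := by
    rw [h1NormSq, integral_add hL.integrable_sq (integrable_finsetSum _ fun j _ => (hLd j).integrable_sq),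
      integral_finsetSum _ fun j _ => (hLd j).integrable_sq,
      ENNReal.ofReal_add (integral_nonneg fun x => sq_nonneg _)
        (Finset.sum_nonneg fun j _ => integral_nonneg fun x => sq_nonneg _),
      ENNReal.ofReal_sum_of_nonneg fun j _ => integral_nonneg fun x => sq_nonneg _,
      eLpNorm_two_sq_eq_ofReal hL]
    simp only [fun j => eLpNorm_two_sq_eq_ofReal (hLd j)]
  refine (ENNReal.ofReal_le_ofReal (hC φ hφ)).trans ?_
  rw [ENNReal.ofReal_mul hC0, hsum]
  gcongr
  · rw [← ENNReal.ofReal_pow (by positivity)]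
    exact ENNReal.ofReal_le_ofReal (by nlinarith)
  · rw [Fin.sum_univ_two, Fin.sum_univ_two, add_sq, add_sq, ← add_assoc, ← add_assoc]
    calc _ ≤ _ := le_self_add (a := eLpNorm φ 2 (volume.restrict Ω) ^ 2 +
            eLpNorm (pderiv 0 φ) 2 (volume.restrict Ω) ^ 2 + eLpNorm (pderiv 1 φ) 2 (volume.restrict Ω) ^ 2)
            (b := 2 * eLpNorm φ 2 (volume.restrict Ω) * (eLpNorm (pderiv 0 φ) 2 (volume.restrict Ω) +
              eLpNorm (pderiv 1 φ) 2 (volume.restrict Ω)) + 2 * eLpNorm (pderiv 0 φ) 2 (volume.restrict Ω) *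
              eLpNorm (pderiv 1 φ) 2 (volume.restrict Ω))
      _ = _ := by ring

lemma pderiv_sub {f g : Plane → ℝ} {x : Plane} (hf : DifferentiableAt ℝ f x) (hg : DifferentiableAt ℝ g x)
    (j : Fin 2) : pderiv j (fun y => f y - g y) x = pderiv j f x - pderiv j g x := by
  rw [pderiv, fderiv_fun_sub hf hg]
  rfl

/-- **Trace theorem**: on a bounded Lipschitz domain, every function in `H¹(Ω)` has a trace. -/
theorem MemH1.exists_isTrace (hΩ : IsLipschitzDomain Ω) {f : Plane → ℝ} (hf : MemH1 Ω f) :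
    ∃ t, IsTrace Ω f t := by
  obtain ⟨φ, hφ, hφ0, hφd⟩ := hΩ.exists_approximatesH1 hf
  obtain ⟨C, hC, hCφ⟩ := hΩ.eLpNorm_trace_le
  have hc1 := fun n => isC1Closure_of_contDiff Ω (hφ n)
  have hL : ∀ n, MemLp (φ n) 2 (arcLength Ω) := fun n =>
    hΩ.memLp_arcLength (hφ n).continuous.continuousOn 2
  set a : ℕ → ℝ≥0∞ := fun n => eLpNorm (φ n - f) 2 (volume.restrict Ω) +
    ∑ j, eLpNorm (pderiv j (φ n) - weakPDeriv Ω j f) 2 (volume.restrict Ω) with ha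
  have ha0 : Tendsto a atTop (𝓝 0) := by
    have := hφ0.add (tendsto_finsetSum Finset.univ fun j _ => hφd j)
    simpa only [Finset.sum_const_zero, add_zero] using this
  have htri : ∀ {p q r : Plane → ℝ}, AEStronglyMeasurable p (volume.restrict Ω) →
      AEStronglyMeasurable q (volume.restrict Ω) → AEStronglyMeasurable r (volume.restrict Ω) →
      eLpNorm (p - q) 2 (volume.restrict Ω) ≤ eLpNorm (p - r) 2 (volume.restrict Ω) +
        eLpNorm (q - r) 2 (volume.restrict Ω) := fun {p q r} hp hq hr => by
    have : p - q = (p - r) - (q - r) := by abel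
    rw [this]
    exact eLpNorm_sub_le (hp.sub hr) (hq.sub hr) one_le_two
  -- The trace inequality for differences makes the boundary values Cauchy; completeness of `L²(∂Ω)`
  -- supplies the trace.
  have hbound : ∀ n m, eLpNorm (φ n - φ m) 2 (arcLength Ω) ≤ C * (a n + a m) := by
    intro n m
    refine (hCφ (φ n - φ m) (isC1Closure_of_contDiff Ω ((hφ n).sub (hφ m)))).trans ?_
    refine mul_le_mul' le_rfl ?_
    have hp : ∀ j, pderiv j (φ n - φ m) = pderiv j (φ n) - pderiv j (φ m) := fun j => funext fun x =>
      pderiv_sub ((hφ n).differentiable one_ne_zero x) ((hφ m).differentiable one_ne_zero x) j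
    simp only [hp, ha]
    rw [add_add_add_comm, ← Finset.sum_add_distrib]
    refine add_le_add (htri (hφ n).continuous.aestronglyMeasurable (hφ m).continuous.aestronglyMeasurable
      hf.1.aestronglyMeasurable) (Finset.sum_le_sum fun j _ => ?_)
    exact htri (ContDiff.continuous_pderiv (hφ n) j).aestronglyMeasurable
      (ContDiff.continuous_pderiv (hφ m) j).aestronglyMeasurable (hf.weakPDeriv_spec j).1.aestronglyMeasurable
  have hfact : Fact ((1 : ℝ≥0∞) ≤ 2) := ⟨one_le_two⟩
  have hcauchy : CauchySeq fun n => (hL n).toLp (φ n) := by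
    rw [Lp.cauchySeq_Lp_iff_cauchySeq_eLpNorm]
    have hlim : Tendsto (fun p : ℕ × ℕ => C * (a p.1 + a p.2)) atTop (𝓝 0) := by
      rw [← prod_atTop_atTop_eq]
      have h1 := (ha0.comp tendsto_fst).add (ha0.comp (tendsto_snd (f := (atTop : Filter ℕ))))
      have := ENNReal.Tendsto.const_mul h1 (Or.inr hC)
      simpa using this
    refine tendsto_of_tendsto_of_tendsto_of_le_of_le tendsto_const_nhds hlim (fun _ => zero_le) fun p => ?_
    refine (le_of_eq (eLpNorm_congr_ae ?_)).trans (hbound p.1 p.2)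
    exact (hL p.1).coeFn_toLp.sub (hL p.2).coeFn_toLp
  obtain ⟨T, hT⟩ := cauchySeq_tendsto_of_complete hcauchy
  refine ⟨T, Lp.memLp T, φ, hc1, hφ0, hφd, ?_⟩
  have := (Lp.tendsto_Lp_iff_tendsto_eLpNorm' _ _).1 hT
  refine this.congr fun n => eLpNorm_congr_ae ?_
  exact (hL n).coeFn_toLp.sub (ae_eq_refl _)

end

/-! ### The penalised least-squares functional -/

section energy

variable {Ω : Set Plane} {g u v : Plane → Plane} {α : ℝ}

/-- By the trace theorem the default value zero is never taken on `H¹(Ω)`. -/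
lemma isTrace_trace (hΩ : IsLipschitzDomain Ω) {f : Plane → ℝ} (hf : MemH1 Ω f) :
    IsTrace Ω f (trace Ω f) := by
  have H := hf.exists_isTrace hΩ
  rw [trace, dif_pos H]
  exact H.choose_spec

/-- Completing the square: if `u` solves the Cauchy-Riemann Neumann problem, then the functional
measures the distance of the gradient of `v` to the gradient of `u`. -/
lemma IsCRNeumannSolution.energy_eq (hΩ : IsLipschitzDomain Ω) (hg : ContinuousOn g (frontier Ω))
    (hu2 : ContDiffOn ℝ 2 u Ω) (hu : IsCRNeumannSolution Ω g u) (hv : ∀ i, MemH1 Ω fun x => v x i) :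
    energy Ω g α v = 1 / 2 * (∫ x in Ω, ‖weakCrOp Ω v x‖ ^ 2) +
      α / 2 * (∑ i, ∑ j, ∫ x in Ω,
        (weakPDeriv Ω j (fun y => v y i) x - pderiv j (fun y => u y i) x) ^ 2) -
      α / 2 * ∑ i, ∑ j, ∫ x in Ω, pderiv j (fun y => u y i) x ^ 2 := by
  have hD : ∀ i j, MemLp (weakPDeriv Ω j fun y => v y i) 2 (volume.restrict Ω) := fun i j =>
    ((hv i).weakPDeriv_spec j).1
  have hW : ∀ i j, MemLp (pderiv j fun y => u y i) 2 (volume.restrict Ω) := fun i j =>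
    hΩ.memLp_pderiv (hu.isC1Closure.apply hΩ.isOpen i) 2 j
  have h1 : ∫ x in Ω, ∑ i, ∑ j, weakPDeriv Ω j (fun y => v y i) x ^ 2 =
      ∑ i, ∑ j, ∫ x in Ω, weakPDeriv Ω j (fun y => v y i) x ^ 2 := by
    rw [integral_finsetSum _ fun i _ => integrable_finsetSum _ fun j _ => (hD i j).integrable_sq]
    exact Finset.sum_congr rfl fun i _ => integral_finsetSum _ fun j _ => (hD i j).integrable_sq
  have h2 : ∫ x, ∑ i, g x i * trace Ω (fun y => v y i) x ∂(arcLength Ω) =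
      ∑ i, ∑ j, ∫ x in Ω, pderiv j (fun y => u y i) x * weakPDeriv Ω j (fun y => v y i) x := by
    rw [integral_finsetSum]
    · exact Finset.sum_congr rfl fun i _ => hu.green_trace hΩ hg hu2 (hv i) (isTrace_trace hΩ (hv i)) i
    · exact fun i _ => integrable_mul_of_memLp_two
        (hΩ.memLp_arcLength ((EuclideanSpace.proj (𝕜 := ℝ) i).continuous.comp_continuousOn hg) 2)
        (isTrace_trace hΩ (hv i)).1
  have h3 : ∀ i j, ∫ x in Ω, (weakPDeriv Ω j (fun y => v y i) x - pderiv j (fun y => u y i) x) ^ 2 =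
      (∫ x in Ω, weakPDeriv Ω j (fun y => v y i) x ^ 2) -
        2 * (∫ x in Ω, pderiv j (fun y => u y i) x * weakPDeriv Ω j (fun y => v y i) x) +
        ∫ x in Ω, pderiv j (fun y => u y i) x ^ 2 := fun i j => by
    have hm := (integrable_mul_of_memLp_two (hW i j) (hD i j)).const_mul 2
    have hs : Integrable (fun x => weakPDeriv Ω j (fun y => v y i) x ^ 2 -
        2 * (pderiv j (fun y => u y i) x * weakPDeriv Ω j (fun y => v y i) x)) (volume.restrict Ω) :=
      (hD i j).integrable_sq.sub hm
    rw [← integral_const_mul, ← integral_sub (hD i j).integrable_sq hm,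
      ← integral_add hs (hW i j).integrable_sq]
    exact integral_congr_ae (Eventually.of_forall fun x => by ring)
  rw [energy, h1, h2]
  simp only [h3, Finset.sum_add_distrib, Finset.sum_sub_distrib, ← Finset.mul_sum]
  ring

lemma pderiv_sub_const (u : Plane → Plane) (c : Plane) (i j : Fin 2) :
    pderiv j (fun y => (u y - c) i) = pderiv j fun y => u y i := by
  funext x
  have : (fun y => (u y - c) i) = fun y => u y i - c i := rfl
  rw [this, pderiv, pderiv, fderiv_sub_const]

/-- Weak derivatives of `u - c` are the classical derivatives of `u`, so both nonnegative squares in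
`energy_eq` vanish. -/
lemma IsCRNeumannSolution.energy_sub_const (hΩ : IsLipschitzDomain Ω) (hg : ContinuousOn g (frontier Ω))
    (hu2 : ContDiffOn ℝ 2 u Ω) (hu : IsCRNeumannSolution Ω g u) (c : Plane) :
    energy Ω g α (fun x => u x - c) =
      -(α / 2 * ∑ i, ∑ j, ∫ x in Ω, pderiv j (fun y => u y i) x ^ 2) := by
  have hc1 : ∀ i, IsC1Closure Ω fun x => (u x - c) i := (hu.isC1Closure.sub_const c).apply hΩ.isOpen
  have hW : ∀ i j, weakPDeriv Ω j (fun y => (u y - c) i) =ᵐ[volume.restrict Ω] pderiv j fun y => u y i :=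
    fun i j => (weakPDeriv_ae_eq hΩ (hc1 i) j).trans (by rw [pderiv_sub_const])
  rw [hu.energy_eq hΩ hg hu2 fun i => memH1_of_isC1Closure hΩ (hc1 i)]
  have h1 : ∫ x in Ω, ‖weakCrOp Ω (fun x => u x - c) x‖ ^ 2 = 0 := by
    refine integral_eq_zero_of_ae ?_
    filter_upwards [hW 0 0, hW 0 1, hW 1 0, hW 1 1, ae_restrict_mem hΩ.isOpen.measurableSet]
      with x h00 h01 h10 h11 hx
    have := hu.crOp_eq_zero x hx
    rw [crOp] at this
    rw [weakCrOp, h00, h01, h10, h11, this]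
    simp
  have h2 : ∀ i j, ∫ x in Ω,
      (weakPDeriv Ω j (fun y => (u y - c) i) x - pderiv j (fun y => u y i) x) ^ 2 = 0 := fun i j => by
    refine integral_eq_zero_of_ae ?_
    filter_upwards [hW i j] with x hx
    rw [hx, sub_self, zero_pow two_ne_zero, Pi.zero_apply]
  simp only [h1, h2, Finset.sum_const_zero]
  ring

/-- Fields with mean zero and the same gradient agree almost everywhere. -/
lemma MemH1MeanZero.ae_eq_of_weakPDeriv (hΩ : IsLipschitzDomain Ω) {w : Plane → Plane}
    (hv : MemH1MeanZero Ω v) (hw : MemH1MeanZero Ω w)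
    (h : ∀ i j, weakPDeriv Ω j (fun y => v y i) =ᵐ[volume.restrict Ω] weakPDeriv Ω j fun y => w y i) :
    ∀ᵐ x ∂(volume.restrict Ω), v x = w x := by
  have hfin : IsFiniteMeasure (volume.restrict Ω) := by
    rw [isFiniteMeasure_restrict]
    exact hΩ.isBounded.measure_lt_top.ne
  have hpos : 0 < (volume.restrict Ω).real univ := by
    rw [measureReal_restrict_apply_univ]
    exact ENNReal.toReal_pos (hΩ.isOpen.measure_pos volume hΩ.isConnected.nonempty).ne'
      hΩ.isBounded.measure_lt_top.ne
  have key : ∀ i, ∀ᵐ x ∂(volume.restrict Ω), v x i = w x i := fun i => by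
    have hvi := (hv i).1
    have hwi := (hw i).1
    have hzero : ∀ j, HasWeakPDeriv Ω j (fun x => v x i - w x i) 0 := fun j =>
      (HasWeakPDeriv.sub hvi.1 hwi.1 (hvi.weakPDeriv_spec j).1 (hwi.weakPDeriv_spec j).1
        (hvi.weakPDeriv_spec j).2 (hwi.weakPDeriv_spec j).2).congr (by
          filter_upwards [h i j] with x hx
          simp [hx])
    obtain ⟨c, hc⟩ := ae_eq_const_of_hasWeakPDeriv_zero hΩ.isOpen hΩ.isConnected (hvi.1.sub hwi.1) hzero
    have h0 : ∫ x in Ω, (v x i - w x i) = 0 := by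
      rw [integral_sub (hvi.1.integrable one_le_two) (hwi.1.integrable one_le_two), (hv i).2, (hw i).2,
        sub_zero]
    have hc0 : c = 0 := by
      have hc' : (fun x => v x i - w x i) =ᵐ[volume.restrict Ω] fun _ => c := hc
      rw [integral_congr_ae hc', integral_const, smul_eq_mul] at h0
      exact (mul_eq_zero.1 h0).resolve_left hpos.ne'
    filter_upwards [hc] with x hx
    exact sub_eq_zero.1 (hx.trans hc0)
  filter_upwards [ae_all_iff.2 key] with x hx
  exact PiLp.ext hx

/-- The mean of a field over `Ω`. -/
def fieldMean (Ω : Set Plane) (u : Plane → Plane) : Plane :=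
  WithLp.toLp 2 fun i => ⨍ x in Ω, u x i

lemma IsC1Closure.memH1MeanZero_sub_fieldMean (hΩ : IsLipschitzDomain Ω) (hu : IsC1Closure Ω u) :
    MemH1MeanZero Ω fun x => u x - fieldMean Ω u := fun i => by
  refine ⟨memH1_of_isC1Closure hΩ ((hu.sub_const _).apply hΩ.isOpen i), ?_⟩
  have hfin : IsFiniteMeasure (volume.restrict Ω) := by
    rw [isFiniteMeasure_restrict]
    exact hΩ.isBounded.measure_lt_top.ne
  exact integral_sub_average _ _

/-- By `energy_eq` every competitor has this value of the functional plus two nonnegative terms. -/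
lemma IsCRNeumannSolution.isMinimiser_sub_fieldMean (hΩ : IsLipschitzDomain Ω)
    (hg : ContinuousOn g (frontier Ω)) (hu2 : ContDiffOn ℝ 2 u Ω) (hu : IsCRNeumannSolution Ω g u)
    (hα : 0 < α) : IsMinimiser Ω g α fun x => u x - fieldMean Ω u := by
  refine ⟨hu.isC1Closure.memH1MeanZero_sub_fieldMean hΩ, fun v hv => ?_⟩
  rw [hu.energy_sub_const hΩ hg hu2, hu.energy_eq hΩ hg hu2 fun i => (hv i).1]
  have h1 : 0 ≤ ∫ x in Ω, ‖weakCrOp Ω v x‖ ^ 2 := integral_nonneg fun x => sq_nonneg _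
  have h2 : 0 ≤ α / 2 * (∑ i, ∑ j, ∫ x in Ω,
      (weakPDeriv Ω j (fun y => v y i) x - pderiv j (fun y => u y i) x) ^ 2) :=
    mul_nonneg (by positivity) (Finset.sum_nonneg fun i _ => Finset.sum_nonneg fun j _ =>
      integral_nonneg fun x => sq_nonneg _)
  linarith

/-- Minimality forces the gradient square in `energy_eq` to vanish, as `α > 0` and the
Cauchy–Riemann term is nonnegative; the gradient and the zero mean then determine the field. -/
lemma IsMinimiser.ae_eq_sub_fieldMean (hΩ : IsLipschitzDomain Ω)
    (hg : ContinuousOn g (frontier Ω)) (hu2 : ContDiffOn ℝ 2 u Ω) (hu : IsCRNeumannSolution Ω g u)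
    (hα : 0 < α) (hv : IsMinimiser Ω g α v) :
    ∀ᵐ x ∂(volume.restrict Ω), v x = u x - fieldMean Ω u := by
  have hu0 := hu.isC1Closure.memH1MeanZero_sub_fieldMean hΩ
  have hle := hv.2 _ hu0
  rw [hu.energy_sub_const hΩ hg hu2, hu.energy_eq hΩ hg hu2 fun i => (hv.1 i).1] at hle
  have h1 : 0 ≤ ∫ x in Ω, ‖weakCrOp Ω v x‖ ^ 2 := integral_nonneg fun x => sq_nonneg _
  have hnn : ∀ i j, 0 ≤ ∫ x in Ω,
      (weakPDeriv Ω j (fun y => v y i) x - pderiv j (fun y => u y i) x) ^ 2 := fun i j =>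
    integral_nonneg fun x => sq_nonneg _
  have hsum : ∑ i, ∑ j, ∫ x in Ω,
      (weakPDeriv Ω j (fun y => v y i) x - pderiv j (fun y => u y i) x) ^ 2 = 0 := by
    refine le_antisymm ?_ (Finset.sum_nonneg fun i _ => Finset.sum_nonneg fun j _ => hnn i j)
    refine nonpos_of_mul_nonpos_right (a := α / 2) ?_ (by positivity)
    linarith
  refine hv.1.ae_eq_of_weakPDeriv hΩ hu0 fun i j => ?_
  have hc1 : IsC1Closure Ω fun x => (u x - fieldMean Ω u) i :=
    (hu.isC1Closure.sub_const _).apply hΩ.isOpen i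
  have hij := (Finset.sum_eq_zero_iff_of_nonneg fun j _ => hnn i j).1
    ((Finset.sum_eq_zero_iff_of_nonneg fun i _ => Finset.sum_nonneg fun j _ => hnn i j).1 hsum i
      (Finset.mem_univ i)) j (Finset.mem_univ j)
  have hL : MemLp (fun x => weakPDeriv Ω j (fun y => v y i) x - pderiv j (fun y => u y i) x) 2
      (volume.restrict Ω) := ((hv.1 i).1.weakPDeriv_spec j).1.sub
    (hΩ.memLp_pderiv (hu.isC1Closure.apply hΩ.isOpen i) 2 j)
  have hae := (integral_eq_zero_iff_of_nonneg (fun x => sq_nonneg _) hL.integrable_sq).1 hij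
  refine EventuallyEq.trans ?_ (weakPDeriv_ae_eq hΩ hc1 j).symm
  rw [pderiv_sub_const]
  filter_upwards [hae] with x hx
  exact sub_eq_zero.1 (pow_eq_zero_iff two_ne_zero |>.1 hx)

end energy

end CRNeumann

end

theorem corollary3p3 (Ω : Set CRNeumann.Plane) (hΩ : CRNeumann.IsLipschitzDomain Ω)
    (g : CRNeumann.Plane → CRNeumann.Plane) (hg : ContinuousOn g (frontier Ω))
    (u : CRNeumann.Plane → CRNeumann.Plane) (hu2 : ContDiffOn ℝ 2 u Ω)
    (hu : CRNeumann.IsCRNeumannSolution Ω g u) :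
    (∃ c : CRNeumann.Plane, ∀ α : ℝ, 0 < α →
      CRNeumann.IsMinimiser Ω g α (fun x => u x - c) ∧
      ∀ w : CRNeumann.Plane → CRNeumann.Plane, CRNeumann.IsMinimiser Ω g α w →
        ∀ᵐ x ∂(volume.restrict Ω), w x = u x - c) ∧
    (∀ x ∈ Ω, Laplacian.laplacian u x = 0) ∧
    CRNeumann.NeumannCondition Ω g u :=
  ⟨⟨CRNeumann.fieldMean Ω u, fun _ hα => ⟨hu.isMinimiser_sub_fieldMean hΩ hg hu2 hα,
    fun _ hw => hw.ae_eq_sub_fieldMean hΩ hg hu2 hu hα⟩⟩,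
    fun _ hx => CRNeumann.laplacian_eq_zero hΩ.isOpen hu2 hu.crOp_eq_zero hx, hu.neumann⟩
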